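/- Let $\mathcal D$ be an operadic model category, i.e. a simplicial symmetric tensor model category: a model category that is - a simplicial model category in the sense of Quillen (enriched in simplicial sets via mapping spaces $\mathrm{Map}$, with tensors $K\otimes x$ and cotensors by finite simplicial sets $K$, satisfying SM7); - a symmetric tensor model category (a symmetric monoidal category with product $\otimes$ and unit $I$ such that the pushout product axiom holds for cofibrations, the product with an initial object is initial, and taking the product with a cofibrant object on either side preserves weak equivalences); - such that these structures are compatible: the symmetric monoidal structure is simplicially enriched, for finite $K$ the canonical maps $K\otimes x\to x\otimes(K\otimes I)$ and $K\otimes x\to(K\otimes I)\otimes x$ are isomorphisms, and $\mathrm{Map}(I,-)$ is a right Quillen functor (equivalently, $I$ is cofibrant). Let $\mathrm{ho}(\mathcal D)$ be the homotopy category, with derived product $\otimes^{\mathbb L}$ and derived mapping spaces $\mathbb R\mathrm{Map}$ valued in the homotopy category of spaces. A weak function object is a functor $F\colon \mathrm{ho}(\mathcal D)^{op}\times \mathrm{ho}(\mathcal D)\to \mathrm{ho}(\mathcal D)$ with a transformation, natural in $x,y,z$, $$\mathbb R\mathrm{Map}(x\otimes^{\mathbb L}y,z)\to\mathbb R\mathrm{Map}(x,F(y,z))$$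 in the homotopy category of spaces. It provides an adjoint for $x\otimes^{\mathbb L}y\to z$ if this map is an isomorphism for these $x,y,z$. A map $\eta\colon x\to y$ in $\mathrm{ho}(\mathcal D)$ is rigid if $\eta^*\colon F(y,y)\to F(x,y)$ is an isomorphism in $\mathrm{ho}(\mathcal D)$. Operads are symmetric operads in simplicial sets; fibrations and weak equivalences of operads are levelwise. An $E_\infty$-operad is an operad that is levelwise weakly equivalent to the commutative operad. For a cofibrant operad $\mathcal E$, an $\mathcal E$-algebra structure on $x$ is a map of operads from $\mathcal E$ to the endomorphism operad $\mathrm{End}(x)=\{\mathrm{Map}(x^{\otimes n},x)\}_n$; those on a map $p\colon x\to y$ are maps to $\mathrm{End}(p)=\{\mathrm{Map}(x^{\otimes n},x)\times_{\mathrm{Map}(x^{\otimes n},y)}\mathrm{Map}(y^{\otimes n},y)\}_n$. The simplicial sets of such structures have as $n$-simplices the maps of operads from $\mathcal E$ to the levelwise mapping complexes out of $\Delta^n$ into these operads. **Corollary.** Suppose that $\mathcal D$ has a weak function object, that $\eta\colon I\to y$ is a rigid map in $\mathrm{ho}(\mathcal D)$, and that for all $n\ge0$ the weak function object provides adjoints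 for the maps $$y^{\otimes^{\mathbb L}n}\otimes^{\mathbb L}y\to y\quad\text{and}\quad y^{\otimes^{\mathbb L}n}\otimes^{\mathbb L}I\to y .$$ Then for every cofibrant $E_\infty$-operad $\mathcal E$ the space of extensions to an action of $\mathcal E$ on $y$ making $\eta$ into an $E_\infty$-algebra map is contractible (a Kan complex weakly equivalent to a point), in both of the following senses. 1. If $j\colon I\to Y$ is a cofibration to a cofibrant-fibrant object that represents $\eta$, then the space of $\mathcal E$-algebra structures on $Y$ that make $j$ a map of $\mathcal E$-algebras is contractible, where $I$ carries its canonical structure $\mathcal E\to\mathrm{Com}\to\mathrm{End}(I)$. 2. If $f\colon I\to X$ is an acyclic cofibration to a fibrant object, $p\colon X\to Y$ is a fibration to a cofibrant-fibrant object, $p\circ f$ represents $\eta$, and $\theta$ is an $\mathcal E$-algebra structure on $X$ that makes $f$ a map of $\mathcal E$-algebras, then the homotopy fiber over $\theta$ of the map $\mathrm{Map}_{\mathrm{operad}}(\mathcal E,\mathrm{End}(p))\to\mathrm{Map}_{\mathrm{operad}}(\mathcal E,\mathrm{End}(X))$ is contractible. -/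

import Mathlib

open CategoryTheory MonoidalCategory CartesianMonoidalCategory Limits HomotopicalAlgebra Opposite

universe v u

noncomputable section

namespace RigidOperad

/-! ### Homotopy theory of simplicial sets -/

section Spaces

open scoped Simplicial

/-- Kan fibrations: the right lifting property against all horn inclusions. -/
def KanFibration {S T : SSet.{v}} (f : S ⟶ T) : Prop :=
  SSet.modelCategoryQuillen.J.rlp f

/-- Weak homotopy equivalences of simplicial sets: the maps `f : S ⟶ T` such that for every Kan
complex `Z` precomposition with `f` is a bijection from homotopy classes of maps `T ⟶ Z` to
homotopy classes of maps `S ⟶ Z`. -/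
def weakHomotopyEquivalences : MorphismProperty SSet.{v} := fun _ _ f =>
  ∀ (Z : SSet.{v}) [SSet.KanComplex Z],
    Function.Bijective (SSet.mapπ₀ ((MonoidalClosed.pre f).app Z))

/-- The homotopy category of spaces. -/
abbrev HoSpace : Type (v + 1) := (weakHomotopyEquivalences.{v}).Localization

/-- The localization functor from simplicial sets to the homotopy category of spaces. -/
abbrev toHoSpace : SSet.{v} ⥤ HoSpace.{v} := (weakHomotopyEquivalences.{v}).Q

/-- A contractible space: a Kan complex that is weakly equivalent to a point. -/
def Contractible (S : SSet.{v}) : Prop :=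
  SSet.KanComplex S ∧ weakHomotopyEquivalences (toUnit S)

/-- The evaluation of paths at the starting point. -/
def pathStart (B : SSet.{v}) : (ihom (Δ[1] : SSet.{v})).obj B ⟶ B :=
  SSet.ι₀ ≫ (β_ _ _).hom ≫ (ihom.ev Δ[1]).app B

/-- The evaluation of paths at the end point. -/
def pathEnd (B : SSet.{v}) : (ihom (Δ[1] : SSet.{v})).obj B ⟶ B :=
  SSet.ι₁ ≫ (β_ _ _).hom ≫ (ihom.ev Δ[1]).app B

/-- The space of paths in `B` that start at the vertex `b`. -/
def pathsFrom (B : SSet.{v}) (b : B _⦋0⦌) : SSet.{v} :=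
  pullback (pathStart B) ((SSet.unitHomEquiv B).symm b)

/-- The end point of a path that starts at `b`. -/
def pathsFromEnd (B : SSet.{v}) (b : B _⦋0⦌) : pathsFrom B b ⟶ B :=
  pullback.fst (pathStart B) ((SSet.unitHomEquiv B).symm b) ≫ pathEnd B

/-- The homotopy fiber of `f : A ⟶ B` over a vertex `b` of (the Kan complex) `B`: pairs of a point
of `A` and a path in `B` from `b` to its image. -/
def homotopyFiber {A B : SSet.{v}} (f : A ⟶ B) (b : B _⦋0⦌) : SSet.{v} :=
  pullback f (pathsFromEnd B b)

end Spaces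

/-! ### Simplices of mapping spaces -/

section Simplices

variable {D : Type u} [Category.{v} D] [SimplicialCategory D]

/-- The mapping space `Map(x, y)`. -/
abbrev Map (x y : D) : SSet.{v} := SimplicialCategory.sHom x y

/-- The (degenerate) `n`-simplex of `Map(x, y)` given by a morphism. -/
def sOf {x y : D} (f : x ⟶ y) (n : SimplexCategoryᵒᵖ) : (Map x y).obj n :=
  (eHomEquiv SSet f).app n PUnit.unit

/-- Composition of `n`-simplices of mapping spaces, in diagrammatic order. -/
def sComp {x y z : D} {n : SimplexCategoryᵒᵖ} (f : (Map x y).obj n) (g : (Map y z).obj n) :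
    (Map x z).obj n :=
  (SimplicialCategory.sHomComp x y z).app n ⟨f, g⟩

lemma sOf_map {x y : D} (f : x ⟶ y) {n m : SimplexCategoryᵒᵖ} (φ : n ⟶ m) :
    (Map x y).map φ (sOf f n) = sOf f m :=
  (ConcreteCategory.congr_hom ((eHomEquiv SSet f).naturality φ) PUnit.unit).symm

lemma sComp_map {x y z : D} {n m : SimplexCategoryᵒᵖ} (φ : n ⟶ m) (f : (Map x y).obj n)
    (g : (Map y z).obj n) :
    (Map x z).map φ (sComp f g) = sComp ((Map x y).map φ f) ((Map y z).map φ g) :=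
  (ConcreteCategory.congr_hom ((SimplicialCategory.sHomComp x y z).naturality φ) ⟨f, g⟩).symm

/-- `u : K ⟶ Map(x, t)` exhibits `t` as the tensor `K ⊗ x`: composition with `u` induces an
isomorphism `Map(t, y) ≅ Map(K, Map(x, y))` of simplicial sets for every `y`. -/
def IsTensor (K : SSet.{v}) (x t : D) (u : K ⟶ Map x t) : Prop :=
  ∀ (y : D) (L : SSet.{v}), Function.Bijective
    (fun φ : L ⟶ Map t y => (u ⊗ₘ φ) ≫ SimplicialCategory.sHomComp x t y)

/-- `c : K ⟶ Map(t, y)` exhibits `t` as the cotensor `y ^ K`: composition with `c` induces an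
isomorphism `Map(x, t) ≅ Map(K, Map(x, y))` of simplicial sets for every `x`. -/
def IsCotensor (K : SSet.{v}) (y t : D) (c : K ⟶ Map t y) : Prop :=
  ∀ (x : D) (L : SSet.{v}), Function.Bijective
    (fun φ : L ⟶ Map x t => (φ ⊗ₘ c) ≫ SimplicialCategory.sHomComp x t y)

end Simplices

/-! ### Operadic model categories -/

/-- A simplicial model category in the sense of Quillen: a model category enriched in simplicial
sets, with tensors and cotensors by finite simplicial sets, that satisfies the axiom SM7. -/
class SimplicialModelCategory (D : Type u) [Category.{v} D] [ModelCategory D]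
    [SimplicialCategory D] : Prop where
  exists_tensor (K : SSet.{v}) [K.Finite] (x : D) : ∃ (t : D) (w : K ⟶ Map x t), IsTensor K x t w
  exists_cotensor (K : SSet.{v}) [K.Finite] (y : D) :
    ∃ (t : D) (c : K ⟶ Map t y), IsCotensor K y t c
  /-- For a cofibration `i : a ⟶ b` and a fibration `p : x ⟶ y`, the map
  `Map(b, x) ⟶ Map(a, x) ×_{Map(a, y)} Map(b, y)` is a Kan fibration. -/
  sm7_fibration {a b x y : D} (i : a ⟶ b) (p : x ⟶ y) [Cofibration i] [Fibration p]
    (sq : (SimplicialCategory.sHomFunctor D).PullbackObjObj i p) : KanFibration sq.π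
  sm7_left {a b x y : D} (i : a ⟶ b) (p : x ⟶ y) [Cofibration i] [Fibration p] [WeakEquivalence i]
    (sq : (SimplicialCategory.sHomFunctor D).PullbackObjObj i p) : weakHomotopyEquivalences sq.π
  sm7_right {a b x y : D} (i : a ⟶ b) (p : x ⟶ y) [Cofibration i] [Fibration p] [WeakEquivalence p]
    (sq : (SimplicialCategory.sHomFunctor D).PullbackObjObj i p) : weakHomotopyEquivalences sq.π

/-- A tensor model category: a model category with a monoidal product that satisfies the pushout
product axiom, preserves initial objects in each variable, and preserves weak equivalences in each
variable when the other input is cofibrant. -/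
class TensorModelCategory (D : Type u) [Category.{v} D] [MonoidalCategory D]
    [ModelCategory D] : Prop where
  pushout_product {x y x' y' : D} (f : x ⟶ y) (f' : x' ⟶ y') [Cofibration f] [Cofibration f']
    (sq : (curriedTensor D).PushoutObjObj f f') : Cofibration sq.ι
  pushout_product_left {x y x' y' : D} (f : x ⟶ y) (f' : x' ⟶ y') [Cofibration f] [Cofibration f']
    [WeakEquivalence f] (sq : (curriedTensor D).PushoutObjObj f f') : WeakEquivalence sq.ι
  pushout_product_right {x y x' y' : D} (f : x ⟶ y) (f' : x' ⟶ y') [Cofibration f] [Cofibration f']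
    [WeakEquivalence f'] (sq : (curriedTensor D).PushoutObjObj f f') : WeakEquivalence sq.ι
  tensor_initial (x z : D) (hz : IsInitial z) : Nonempty (IsInitial (x ⊗ z))
  initial_tensor (x z : D) (hz : IsInitial z) : Nonempty (IsInitial (z ⊗ x))
  whiskerLeft_weakEquivalence (x : D) [IsCofibrant x] {y z : D} (f : y ⟶ z) [WeakEquivalence f] :
    WeakEquivalence (x ◁ f)
  whiskerRight_weakEquivalence (x : D) [IsCofibrant x] {y z : D} (f : y ⟶ z) [WeakEquivalence f] :
    WeakEquivalence (f ▷ x)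

/-- A symmetric monoidal category whose monoidal product is a simplicial functor
`Map(x, y) × Map(x', y') ⟶ Map(x ⊗ x', y ⊗ y')`, in such a way that the associativity, unit and
symmetry isomorphisms are natural in the simplicial sense. -/
class SimplicialSymmetricMonoidal (D : Type u) [Category.{v} D] [MonoidalCategory D]
    [SymmetricCategory D] [SimplicialCategory D] where
  /-- the monoidal product of `n`-simplices of mapping spaces -/
  sTensor {x y x' y' : D} {n : SimplexCategoryᵒᵖ} (f : (Map x y).obj n) (f' : (Map x' y').obj n) :
    (Map (x ⊗ x') (y ⊗ y')).obj n
  sTensor_map {x y x' y' : D} {n m : SimplexCategoryᵒᵖ} (φ : n ⟶ m) (f : (Map x y).obj n)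
    (f' : (Map x' y').obj n) :
    (Map (x ⊗ x') (y ⊗ y')).map φ (sTensor f f') =
      sTensor ((Map x y).map φ f) ((Map x' y').map φ f')
  sTensor_sOf {x y x' y' : D} (f : x ⟶ y) (f' : x' ⟶ y') (n : SimplexCategoryᵒᵖ) :
    sTensor (sOf f n) (sOf f' n) = sOf (f ⊗ₘ f') n
  sTensor_sComp {x y z x' y' z' : D} {n : SimplexCategoryᵒᵖ} (f : (Map x y).obj n)
    (g : (Map y z).obj n) (f' : (Map x' y').obj n) (g' : (Map y' z').obj n) :
    sTensor (sComp f g) (sComp f' g') = sComp (sTensor f f') (sTensor g g')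
  associator_natural {x y x' y' x'' y'' : D} {n : SimplexCategoryᵒᵖ} (f : (Map x y).obj n)
    (f' : (Map x' y').obj n) (f'' : (Map x'' y'').obj n) :
    sComp (sTensor (sTensor f f') f'') (sOf (α_ y y' y'').hom n) =
      sComp (sOf (α_ x x' x'').hom n) (sTensor f (sTensor f' f''))
  leftUnitor_natural {x y : D} {n : SimplexCategoryᵒᵖ} (f : (Map x y).obj n) :
    sComp (sTensor (sOf (𝟙 (𝟙_ D)) n) f) (sOf (λ_ y).hom n) = sComp (sOf (λ_ x).hom n) f
  rightUnitor_natural {x y : D} {n : SimplexCategoryᵒᵖ} (f : (Map x y).obj n) :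
    sComp (sTensor f (sOf (𝟙 (𝟙_ D)) n)) (sOf (ρ_ y).hom n) = sComp (sOf (ρ_ x).hom n) f
  braiding_natural {x y x' y' : D} {n : SimplexCategoryᵒᵖ} (f : (Map x y).obj n)
    (f' : (Map x' y').obj n) :
    sComp (sTensor f f') (sOf (β_ y y').hom n) = sComp (sOf (β_ x x').hom n) (sTensor f' f)

section Comparison

variable {D : Type u} [Category.{v} D] [MonoidalCategory D] [SymmetricCategory D]
  [SimplicialCategory D] [SimplicialSymmetricMonoidal D]

/-- For `w : K ⟶ Map(I, t)`, the induced family `K ⟶ Map(x, x ⊗ t)`. -/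
def unitTensorLeft {K : SSet.{v}} {t : D} (w : K ⟶ Map (𝟙_ D) t) (x : D) : K ⟶ Map x (x ⊗ t) where
  app n := ↾fun k => sComp (sOf (ρ_ x).inv n)
    (SimplicialSymmetricMonoidal.sTensor (sOf (𝟙 x) n) (w.app n k))
  naturality n m φ := by
    ext k
    have h := ConcreteCategory.congr_hom (w.naturality φ) k
    simp only [ConcreteCategory.comp_apply] at h
    simp [sComp_map, sOf_map, SimplicialSymmetricMonoidal.sTensor_map, h]

/-- For `w : K ⟶ Map(I, t)`, the induced family `K ⟶ Map(x, t ⊗ x)`. -/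
def unitTensorRight {K : SSet.{v}} {t : D} (w : K ⟶ Map (𝟙_ D) t) (x : D) :
    K ⟶ Map x (t ⊗ x) where
  app n := ↾fun k => sComp (sOf (λ_ x).inv n)
    (SimplicialSymmetricMonoidal.sTensor (w.app n k) (sOf (𝟙 x) n))
  naturality n m φ := by
    ext k
    have h := ConcreteCategory.congr_hom (w.naturality φ) k
    simp only [ConcreteCategory.comp_apply] at h
    simp [sComp_map, sOf_map, SimplicialSymmetricMonoidal.sTensor_map, h]

end Comparison

/-- An operadic model category, that is, a simplicial symmetric tensor model category: a simplicial
model category and a tensor model category whose symmetric monoidal structure is compatible with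
the simplicial structure.  Compatibility means that the monoidal structure is simplicial, that the
canonical maps `K ⊗ x ⟶ x ⊗ (K ⊗ I)` and `K ⊗ x ⟶ (K ⊗ I) ⊗ x` are isomorphisms for finite `K`,
and that `Map(I, -)` is a right Quillen functor, i.e. that the unit `I` is cofibrant. -/
class OperadicModelCategory (D : Type u) [Category.{v} D] [MonoidalCategory D]
    [SymmetricCategory D] [ModelCategory D] [SimplicialCategory D] extends
    SimplicialModelCategory D, TensorModelCategory D, SimplicialSymmetricMonoidal D where
  isTensor_left (K : SSet.{v}) [K.Finite] (t : D) (w : K ⟶ Map (𝟙_ D) t)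
    (hw : IsTensor K (𝟙_ D) t w) (x : D) : IsTensor K x (x ⊗ t) (unitTensorLeft w x)
  isTensor_right (K : SSet.{v}) [K.Finite] (t : D) (w : K ⟶ Map (𝟙_ D) t)
    (hw : IsTensor K (𝟙_ D) t w) (x : D) : IsTensor K x (t ⊗ x) (unitTensorRight w x)
  unit_cofibrant : IsCofibrant (𝟙_ D)

attribute [instance] OperadicModelCategory.unit_cofibrant

/-! ### Simplicial operads -/

/-- A symmetric operad in simplicial sets, in coordinate-free form: the operations are indexed by
finite sets and their bijections instead of the sets `Fin n` and the symmetric groups, and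
composition plugs operations with inputs `S t` into the inputs `t` of an operation with inputs
`T`, to give an operation whose inputs are the disjoint union of the sets `S t`. -/
structure SimplicialOperad where
  /-- the space of operations with the finite set `S` of inputs -/
  obj (S : Type) [Finite S] : SSet.{v}
  /-- relabelling of the inputs -/
  map {S T : Type} [Finite S] [Finite T] (e : S ≃ T) : obj S ⟶ obj T
  map_refl (S : Type) [Finite S] : map (Equiv.refl S) = 𝟙 (obj S)
  map_trans {S T R : Type} [Finite S] [Finite T] [Finite R] (e : S ≃ T) (e' : T ≃ R) :
    map (e.trans e') = map e ≫ map e'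
  /-- the identity operation -/
  one (n : SimplexCategoryᵒᵖ) : (obj Unit).obj n
  one_map {n m : SimplexCategoryᵒᵖ} (φ : n ⟶ m) : (obj Unit).map φ (one n) = one m
  /-- composition of operations -/
  comp {T : Type} [Finite T] {S : T → Type} [∀ t, Finite (S t)] {n : SimplexCategoryᵒᵖ}
    (p : (obj T).obj n) (q : ∀ t, (obj (S t)).obj n) : (obj (Σ t, S t)).obj n
  comp_map {T : Type} [Finite T] {S : T → Type} [∀ t, Finite (S t)] {n m : SimplexCategoryᵒᵖ}
    (φ : n ⟶ m) (p : (obj T).obj n) (q : ∀ t, (obj (S t)).obj n) :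
    (obj (Σ t, S t)).map φ (comp p q) = comp ((obj T).map φ p) (fun t => (obj (S t)).map φ (q t))
  comp_relabel_left {T T' : Type} [Finite T] [Finite T'] (e : T ≃ T') {S : T' → Type}
    [∀ t, Finite (S t)] {n : SimplexCategoryᵒᵖ} (p : (obj T).obj n)
    (q : ∀ t, (obj (S t)).obj n) :
    comp ((map e).app n p) q =
      (map (Equiv.sigmaCongrLeft (β := S) e)).app n (comp p (fun t => q (e t)))
  comp_relabel_right {T : Type} [Finite T] {S S' : T → Type} [∀ t, Finite (S t)]
    [∀ t, Finite (S' t)] (e : ∀ t, S t ≃ S' t) {n : SimplexCategoryᵒᵖ} (p : (obj T).obj n)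
    (q : ∀ t, (obj (S t)).obj n) :
    comp p (fun t => (map (e t)).app n (q t)) = (map (Equiv.sigmaCongrRight e)).app n (comp p q)
  one_comp {S : Type} [Finite S] {n : SimplexCategoryᵒᵖ} (p : (obj S).obj n) :
    (map (Equiv.uniqueSigma (fun _ : Unit => S))).app n (comp (one n) (fun _ => p)) = p
  comp_one {T : Type} [Finite T] {n : SimplexCategoryᵒᵖ} (p : (obj T).obj n) :
    (map (Equiv.sigmaUnique T (fun _ => Unit))).app n (comp p (fun _ => one n)) = p
  assoc {T : Type} [Finite T] {S : T → Type} [∀ t, Finite (S t)] {R : ∀ t, S t → Type}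
    [∀ t s, Finite (R t s)] {n : SimplexCategoryᵒᵖ} (p : (obj T).obj n)
    (q : ∀ t, (obj (S t)).obj n) (r : ∀ t s, (obj (R t s)).obj n) :
    (map (Equiv.sigmaAssoc R)).app n (comp (comp p q) (fun ts : Σ t, S t => r ts.1 ts.2)) =
      comp p (fun t => comp (q t) (r t))

namespace SimplicialOperad

/-- Maps of operads. -/
structure Hom (P Q : SimplicialOperad.{v}) where
  app (S : Type) [Finite S] : P.obj S ⟶ Q.obj S
  app_map {S T : Type} [Finite S] [Finite T] (e : S ≃ T) :
    P.map e ≫ app T = app S ≫ Q.map e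
  app_one (n : SimplexCategoryᵒᵖ) : (app Unit).app n (P.one n) = Q.one n
  app_comp {T : Type} [Finite T] {S : T → Type} [∀ t, Finite (S t)] {n : SimplexCategoryᵒᵖ}
    (p : (P.obj T).obj n) (q : ∀ t, (P.obj (S t)).obj n) :
    (app (Σ t, S t)).app n (P.comp p q) =
      Q.comp ((app T).app n p) (fun t => (app (S t)).app n (q t))

/-- An operad is cofibrant, in the model structure whose fibrations and weak equivalences are
defined levelwise, if it has the left lifting property against all maps of operads that are
levelwise Kan fibrations and weak homotopy equivalences. -/
def IsCofibrant (E : SimplicialOperad.{v}) : Prop :=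
  ∀ (P Q : SimplicialOperad.{v}) (f : Hom P Q),
    (∀ (S : Type) [Finite S], KanFibration (f.app S) ∧ weakHomotopyEquivalences (f.app S)) →
    ∀ g : Hom E Q, ∃ h : Hom E P, ∀ (S : Type) [Finite S], h.app S ≫ f.app S = g.app S

/-- An `E_∞`-operad: an operad for which the map to the commutative operad, which is a point in
each degree, is a levelwise weak homotopy equivalence. -/
def IsEInfinity (E : SimplicialOperad.{v}) : Prop :=
  ∀ (S : Type) [Finite S], weakHomotopyEquivalences (toUnit (E.obj S))

end SimplicialOperad

/-! ### Tensor powers -/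

section Powers

variable {D : Type u} [Category.{v} D] [MonoidalCategory D]

/-- The tensor power `x^{⊗ k} = x ⊗ (x ⊗ ⋯ (x ⊗ I))`. -/
def pow (x : D) : ℕ → D
  | 0 => 𝟙_ D
  | k + 1 => x ⊗ pow x k

/-- The tensor power of a morphism. -/
def powMap {x y : D} (f : x ⟶ y) : (k : ℕ) → (pow x k ⟶ pow y k)
  | 0 => 𝟙 (𝟙_ D)
  | k + 1 => f ⊗ₘ powMap f k

/-- The canonical isomorphism `I^{⊗ k} ⟶ I`. -/
def unitMul (D : Type u) [Category.{v} D] [MonoidalCategory D] :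
    (k : ℕ) → (pow (𝟙_ D) k ⟶ 𝟙_ D)
  | 0 => 𝟙 (𝟙_ D)
  | k + 1 => (λ_ (pow (𝟙_ D) k)).hom ≫ unitMul D k

/-- The symmetry of `x^{⊗ k}` that exchanges the adjacent factors number `i` and `i + 1`
(counted from `0`). -/
def powSwap [SymmetricCategory D] (x : D) : (k i : ℕ) → (pow x k ⟶ pow x k)
  | k + 2, 0 => (α_ x x (pow x k)).inv ≫ (β_ x x).hom ▷ pow x k ≫ (α_ x x (pow x k)).hom
  | k + 1, i + 1 => x ◁ powSwap x k i
  | 0, _ => 𝟙 _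
  | 1, 0 => 𝟙 _

/-- The canonical isomorphism `x^{⊗ (a + b)} ⟶ x^{⊗ a} ⊗ x^{⊗ b}`. -/
def powAdd (x : D) : (a b : ℕ) → (pow x (a + b) ⟶ pow x a ⊗ pow x b)
  | 0, b => eqToHom (congrArg (pow x) (Nat.zero_add b)) ≫ (λ_ (pow x b)).inv
  | a + 1, b => eqToHom (congrArg (pow x) (Nat.succ_add a b)) ≫
      x ◁ powAdd x a b ≫ (α_ x (pow x a) (pow x b)).inv

/-- The tensor product `x^{⊗ m 0} ⊗ (x^{⊗ m 1} ⊗ ⋯)`. -/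
def powFamily (x : D) : {k : ℕ} → (Fin k → ℕ) → D
  | 0, _ => 𝟙_ D
  | _ + 1, m => pow x (m 0) ⊗ powFamily x (fun i => m i.succ)

/-- The canonical isomorphism `x^{⊗ (m 0 + ⋯ + m (k - 1))} ⟶ x^{⊗ m 0} ⊗ ⋯ ⊗ x^{⊗ m (k - 1)}`. -/
def powSplit (x : D) : {k : ℕ} → (m : Fin k → ℕ) → (pow x (∑ i, m i) ⟶ powFamily x m)
  | 0, m => eqToHom (congrArg (pow x) (Fin.sum_univ_zero m))
  | _ + 1, m => eqToHom (congrArg (pow x) (Fin.sum_univ_succ m)) ≫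
      powAdd x (m 0) (∑ i, m (Fin.succ i)) ≫ pow x (m 0) ◁ powSplit x (fun i => m i.succ)

/-- The tensor product of simplices `f i` of `Map(x^{⊗ m i}, x)`. -/
def sTensorFamily [SymmetricCategory D] [SimplicialCategory D] [SimplicialSymmetricMonoidal D]
    {x : D} {n : SimplexCategoryᵒᵖ} : {k : ℕ} → (m : Fin k → ℕ) →
    (∀ i, (Map (pow x (m i)) x).obj n) → (Map (powFamily x m) (pow x k)).obj n
  | 0, _, _ => sOf (𝟙 (𝟙_ D)) n
  | _ + 1, m, f => SimplicialSymmetricMonoidal.sTensor (f 0)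
      (sTensorFamily (fun i => m i.succ) (fun i => f i.succ))

end Powers

/-! ### Spaces of algebra structures -/

section Algebras

variable {D : Type u} [Category.{v} D] [MonoidalCategory D] [SymmetricCategory D]
  [SimplicialCategory D] [SimplicialSymmetricMonoidal D]

/-- A family of `E`-algebra structures on `x` that is parametrized by a simplicial set `K`: maps
`K × E(k) ⟶ Map(x^{⊗ k}, x)` that are compatible with units, symmetries and compositions.
For `K` a point this is a map of operads from `E` to the endomorphism operad
`End(x) = {Map(x^{⊗ k}, x)}`, and in general it is a map of operads `E ⟶ End(x)^K`.
Equivariance is stated for the adjacent transpositions, which generate the symmetric group. -/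
@[ext]
structure AlgebraFamily (E : SimplicialOperad.{v}) (x : D) (K : SSet.{v}) where
  act (k : ℕ) {n : SimplexCategoryᵒᵖ} (d : K.obj n) (e : (E.obj (Fin k)).obj n) :
    (Map (pow x k) x).obj n
  act_map (k : ℕ) {n m : SimplexCategoryᵒᵖ} (φ : n ⟶ m) (d : K.obj n)
    (e : (E.obj (Fin k)).obj n) :
    (Map (pow x k) x).map φ (act k d e) = act k (K.map φ d) ((E.obj (Fin k)).map φ e)
  act_one {n : SimplexCategoryᵒᵖ} (d : K.obj n) :
    act 1 d ((E.map (Equiv.ofUnique Unit (Fin 1))).app n (E.one n)) = sOf (ρ_ x).hom n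
  act_swap (k i : ℕ) (hi : i + 1 < k) {n : SimplexCategoryᵒᵖ} (d : K.obj n)
    (e : (E.obj (Fin k)).obj n) :
    act k d ((E.map (Equiv.swap ⟨i, Nat.lt_of_succ_lt hi⟩ ⟨i + 1, hi⟩)).app n e) =
      sComp (sOf (powSwap x k i) n) (act k d e)
  act_comp {k : ℕ} (m : Fin k → ℕ) {n : SimplexCategoryᵒᵖ} (d : K.obj n)
    (p : (E.obj (Fin k)).obj n) (q : ∀ i, (E.obj (Fin (m i))).obj n) :
    act (∑ i, m i) d ((E.map finSigmaFinEquiv).app n (E.comp p q)) =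
      sComp (sOf (powSplit x m) n)
        (sComp (sTensorFamily m (fun i => act (m i) d (q i))) (act k d p))

/-- Reparametrization of a family of algebra structures. -/
@[simps]
def AlgebraFamily.precomp {E : SimplicialOperad.{v}} {x : D} {K L : SSet.{v}} (f : L ⟶ K)
    (θ : AlgebraFamily E x K) : AlgebraFamily E x L where
  act k n d e := θ.act k (f.app n d) e
  act_map k n m φ d e := by
    have h := ConcreteCategory.congr_hom (f.naturality φ) d
    simp only [ConcreteCategory.comp_apply] at h
    rw [θ.act_map, h]
  act_one d := θ.act_one _
  act_swap k i hi n d e := θ.act_swap k i hi _ e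
  act_comp m n d p q := θ.act_comp m _ p q

lemma AlgebraFamily.precomp_map_id {E : SimplicialOperad.{v}} {x : D} {n : SimplexCategory}
    (θ : AlgebraFamily E x (SSet.stdSimplex.obj n)) :
    θ.precomp (SSet.stdSimplex.map (𝟙 n)) = θ :=
  congrArg (fun f => θ.precomp f) (CategoryTheory.Functor.map_id SSet.stdSimplex n)

lemma AlgebraFamily.precomp_map_comp {E : SimplicialOperad.{v}} {x : D} {n m l : SimplexCategory}
    (θ : AlgebraFamily E x (SSet.stdSimplex.obj n)) (f : l ⟶ m) (g : m ⟶ n) :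
    θ.precomp (SSet.stdSimplex.map (f ≫ g)) =
      (θ.precomp (SSet.stdSimplex.map g)).precomp (SSet.stdSimplex.map f) :=
  congrArg (fun h => θ.precomp h) (CategoryTheory.Functor.map_comp SSet.stdSimplex f g)

/-- The space `Map_operad(E, End(x))` of `E`-algebra structures on `x`. -/
def algebraSpace (E : SimplicialOperad.{v}) (x : D) : SSet.{v} where
  obj n := AlgebraFamily E x (SSet.stdSimplex.obj n.unop)
  map φ := ↾fun θ => θ.precomp (SSet.stdSimplex.map φ.unop)
  map_id _ := ConcreteCategory.hom_ext _ _ fun θ =>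
    AlgebraFamily.precomp_map_id θ
  map_comp φ ψ := ConcreteCategory.hom_ext _ _ fun θ =>
    AlgebraFamily.precomp_map_comp θ ψ.unop φ.unop

/-- A `K`-parametrized family of `E`-algebra structures on a morphism `p : x ⟶ y`: families of
`E`-algebra structures on `x` and on `y` that make `p` a map of `E`-algebras.  This is a map of
operads `E ⟶ End(p)^K`. -/
@[ext]
structure ArrowAlgebraFamily (E : SimplicialOperad.{v}) {x y : D} (p : x ⟶ y) (K : SSet.{v}) where
  source : AlgebraFamily E x K
  target : AlgebraFamily E y K
  comm (k : ℕ) {n : SimplexCategoryᵒᵖ} (d : K.obj n) (e : (E.obj (Fin k)).obj n) :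
    sComp (source.act k d e) (sOf p n) = sComp (sOf (powMap p k) n) (target.act k d e)

/-- The space `Map_operad(E, End(p))` of `E`-algebra structures on a morphism `p`. -/
def arrowAlgebraSpace (E : SimplicialOperad.{v}) {x y : D} (p : x ⟶ y) : SSet.{v} where
  obj n := ArrowAlgebraFamily E p (SSet.stdSimplex.obj n.unop)
  map φ := ↾fun θ =>
    { source := θ.source.precomp (SSet.stdSimplex.map φ.unop)
      target := θ.target.precomp (SSet.stdSimplex.map φ.unop)
      comm := fun k _ _ e => θ.comm k _ e }
  map_id _ := ConcreteCategory.hom_ext _ _ fun θ =>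
    ArrowAlgebraFamily.ext (θ.source.precomp_map_id) (θ.target.precomp_map_id)
  map_comp φ ψ := ConcreteCategory.hom_ext _ _ fun θ =>
    ArrowAlgebraFamily.ext (θ.source.precomp_map_comp ψ.unop φ.unop)
      (θ.target.precomp_map_comp ψ.unop φ.unop)

/-- The restriction `Map_operad(E, End(p)) ⟶ Map_operad(E, End(x))` for `p : x ⟶ y`. -/
def arrowAlgebraSpaceSource (E : SimplicialOperad.{v}) {x y : D} (p : x ⟶ y) :
    arrowAlgebraSpace E p ⟶ algebraSpace E x where
  app _ := ↾fun θ => ArrowAlgebraFamily.source θ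
  naturality _ _ _ := rfl

/-- A `K`-parametrized family of extensions along `η : I ⟶ y` of the canonical algebra structure
on the unit `I` (the one pulled back from the commutative operad, given by the canonical
isomorphisms `I^{⊗ k} ⟶ I`): a family of `E`-algebra structures on `y` that makes `η` a map of
`E`-algebras. -/
@[ext]
structure UnitExtension (E : SimplicialOperad.{v}) {y : D} (η : 𝟙_ D ⟶ y) (K : SSet.{v}) where
  algebra : AlgebraFamily E y K
  comm (k : ℕ) {n : SimplexCategoryᵒᵖ} (d : K.obj n) (e : (E.obj (Fin k)).obj n) :
    sOf (unitMul D k ≫ η) n = sComp (sOf (powMap η k) n) (algebra.act k d e)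

/-- The space of extensions to an action of `E` on `y` that makes `η : I ⟶ y` a map of
`E`-algebras. -/
def unitExtensionSpace (E : SimplicialOperad.{v}) {y : D} (η : 𝟙_ D ⟶ y) : SSet.{v} where
  obj n := UnitExtension E η (SSet.stdSimplex.obj n.unop)
  map φ := ↾fun θ =>
    { algebra := θ.algebra.precomp (SSet.stdSimplex.map φ.unop)
      comm := fun k _ _ e => θ.comm k _ e }
  map_id _ := ConcreteCategory.hom_ext _ _ fun θ =>
    UnitExtension.ext (θ.algebra.precomp_map_id)
  map_comp φ ψ := ConcreteCategory.hom_ext _ _ fun θ =>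
    UnitExtension.ext (θ.algebra.precomp_map_comp ψ.unop φ.unop)

/-- The inclusion of the space of extensions into the space of all algebra structures. -/
def unitExtensionSpaceToAlgebraSpace (E : SimplicialOperad.{v}) {y : D} (η : 𝟙_ D ⟶ y) :
    unitExtensionSpace E η ⟶ algebraSpace E y where
  app _ := ↾fun θ => UnitExtension.algebra θ
  naturality _ _ _ := rfl

end Algebras

/-! ### The homotopy category and its derived functors -/

section Ho

variable (D : Type u) [Category.{v} D] [MonoidalCategory D] [SymmetricCategory D]
  [ModelCategory D] [SimplicialCategory D] [OperadicModelCategory D]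

/-- The homotopy category `ho(D)` of cofibrant-fibrant objects and homotopy classes of maps. -/
abbrev Ho : Type u := BifibrantObject.HoCat D

/-- The localization functor from cofibrant objects to `ho(D)`; it sends a cofibrant object to
(the class of) a fibrant replacement. -/
abbrev toHo : CofibrantObject D ⥤ Ho D := CofibrantObject.HoCat.bifibrantResolution'

variable {D}

lemma isTerminal_of_existsUnique (S : SSet.{v})
    (h : ∀ n : SimplexCategory, ∃! _f : SSet.stdSimplex.obj n ⟶ S, True) :
    Nonempty (IsTerminal S) := by
  have hu (n : SimplexCategoryᵒᵖ) : Nonempty (Unique (S.obj n)) := by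
    obtain ⟨f, -, hf⟩ := h n.unop
    exact ⟨⟨⟨SSet.yonedaEquiv f⟩, fun s => by
      have := hf (SSet.yonedaEquiv.symm s) trivial
      rw [Equiv.symm_apply_eq] at this
      exact this⟩⟩
  have u (n : SimplexCategoryᵒᵖ) : Unique (S.obj n) := (hu n).some
  exact ⟨IsTerminal.ofUniqueHom
    (fun L => { app := fun n => ↾fun _ => (u n).default
                naturality := fun n m φ => by
                  ext l
                  exact ((u m).uniq _).symm })
    (fun L f => by
      ext n l
      exact (u n).uniq _)⟩

lemma isTerminal_map_terminal {z : D} (hz : IsTerminal z) (x : D) :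
    Nonempty (IsTerminal (Map x z)) := by
  refine isTerminal_of_existsUnique _ fun n => ?_
  obtain ⟨t, w, hw⟩ := SimplicialModelCategory.exists_tensor (SSet.stdSimplex.{v}.obj n) x
  have hb := hw z (𝟙_ SSet.{v})
  have hs : Subsingleton (𝟙_ SSet.{v} ⟶ Map t z) :=
    ⟨fun f g => (eHomEquiv SSet).symm.injective (hz.hom_ext _ _)⟩
  refine ⟨(ρ_ _).inv ≫ (w ⊗ₘ eHomEquiv SSet (hz.from t)) ≫ SimplicialCategory.sHomComp x t z,
    trivial, fun f _ => ?_⟩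
  obtain ⟨φ, hφ⟩ := hb.2 ((ρ_ _).hom ≫ f)
  rw [Subsingleton.elim (eHomEquiv SSet (hz.from t)) φ, ← cancel_epi (ρ_ _).hom, ← hφ]
  simp

lemma isTerminal_map_initial {z : D} (hz : IsInitial z) (y : D) :
    Nonempty (IsTerminal (Map z y)) := by
  refine isTerminal_of_existsUnique _ fun n => ?_
  obtain ⟨t, c, hc⟩ := SimplicialModelCategory.exists_cotensor (SSet.stdSimplex.{v}.obj n) y
  have hb := hc z (𝟙_ SSet.{v})
  have hs : Subsingleton (𝟙_ SSet.{v} ⟶ Map z t) :=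
    ⟨fun f g => (eHomEquiv SSet).symm.injective (hz.hom_ext _ _)⟩
  refine ⟨(λ_ _).inv ≫ (eHomEquiv SSet (hz.to t) ⊗ₘ c) ≫ SimplicialCategory.sHomComp z t y,
    trivial, fun f _ => ?_⟩
  obtain ⟨φ, hφ⟩ := hb.2 ((λ_ _).hom ≫ f)
  rw [Subsingleton.elim (eHomEquiv SSet (hz.to t)) φ, ← cancel_epi (λ_ _).hom, ← hφ]
  simp

/-- `Map(x, -)` sends acyclic fibrations to weak homotopy equivalences for `x` cofibrant. -/
lemma map_acyclicFibration (x : D) [IsCofibrant x] {y z : D} (p : y ⟶ z) [Fibration p]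
    [WeakEquivalence p] :
    weakHomotopyEquivalences (((SimplicialCategory.sHomFunctor D).obj (op x)).map p) := by
  obtain ⟨hy⟩ := isTerminal_map_initial (initialIsInitial (C := D)) y
  obtain ⟨hz⟩ := isTerminal_map_initial (initialIsInitial (C := D)) z
  have hi : Cofibration (initial.to x) := (isCofibrant_iff x).1 inferInstance
  exact SimplicialModelCategory.sm7_right (initial.to x) p
    { pt := Map x z
      fst := hy.from _
      snd := 𝟙 _
      isPullback := by
        have : IsIso (((SimplicialCategory.sHomFunctor D).obj (op (⊥_ D))).map p) :=
          isIso_of_isTerminal hy hz _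
        exact @IsPullback.of_vert_isIso _ _ _ _ _ _ _ _ _ _ (IsIso.id (Map x z)) this ⟨hz.hom_ext _ _⟩
      π := ((SimplicialCategory.sHomFunctor D).obj (op x)).map p
      π_fst := hy.hom_ext _ _ }

/-- `Map(-, y)` sends acyclic cofibrations to weak homotopy equivalences for `y` fibrant. -/
lemma map_acyclicCofibration (y : D) [IsFibrant y] {x z : D} (i : x ⟶ z) [Cofibration i]
    [WeakEquivalence i] :
    weakHomotopyEquivalences (((SimplicialCategory.sHomFunctor D).map i.op).app y) := by
  obtain ⟨hx⟩ := isTerminal_map_terminal (terminalIsTerminal (C := D)) x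
  obtain ⟨hz⟩ := isTerminal_map_terminal (terminalIsTerminal (C := D)) z
  have hp : Fibration (terminal.from y) := (isFibrant_iff y).1 inferInstance
  exact SimplicialModelCategory.sm7_left i (terminal.from y)
    { pt := Map x y
      fst := 𝟙 _
      snd := hz.from _
      isPullback := by
        have : IsIso (((SimplicialCategory.sHomFunctor D).map i.op).app (⊤_ D)) :=
          isIso_of_isTerminal hz hx _
        exact @IsPullback.of_horiz_isIso _ _ _ _ _ _ _ _ _ _ (IsIso.id (Map x y)) this ⟨hx.hom_ext _ _⟩
      π := ((SimplicialCategory.sHomFunctor D).map i.op).app y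
      π_snd := hz.hom_ext _ _ }

variable (D) in
/-- The mapping space functor on cofibrant-fibrant objects, with values in the homotopy category
of spaces. -/
def mapFunctor : (BifibrantObject D)ᵒᵖ × BifibrantObject D ⥤ HoSpace.{v} :=
  Functor.prod BifibrantObject.ι.op BifibrantObject.ι ⋙
    Functor.uncurry.obj (SimplicialCategory.sHomFunctor D) ⋙ toHoSpace

lemma isIso_map_left (y : D) [IsFibrant y] {x z : D} [IsCofibrant x] [IsCofibrant z] (f : x ⟶ z)
    [WeakEquivalence f] :
    IsIso (toHoSpace.map (((SimplicialCategory.sHomFunctor D).map f.op).app y)) := by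
  let G : Dᵒᵖ ⥤ HoSpace.{v} := (SimplicialCategory.sHomFunctor D).flip.obj y ⋙ toHoSpace
  have hG {a b : D} (i : a ⟶ b) [Cofibration i] [WeakEquivalence i] : IsIso (G.map i.op) :=
    Localization.inverts toHoSpace weakHomotopyEquivalences _ (map_acyclicCofibration y i)
  obtain ⟨h⟩ : Nonempty (CofibrantBrownFactorization f) := inferInstance
  have h1 := hG h.i
  have h2 := hG h.s
  have h3 : G.map h.p.op ≫ G.map h.s.op = 𝟙 _ := by
    rw [← G.map_comp, ← op_comp, h.s_p, op_id, G.map_id]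
  have h4 : IsIso (G.map h.p.op) :=
    (IsIso.inv_eq_of_inv_hom_id h3) ▸ (inferInstance : IsIso (inv (G.map h.s.op)))
  have h5 : G.map f.op = G.map h.p.op ≫ G.map h.i.op := by
    rw [← G.map_comp, ← op_comp, h.fac]
  have : IsIso (G.map f.op) := by
    rw [h5]; infer_instance
  exact this

lemma isIso_map_right (x : D) [IsCofibrant x] {y z : D} [IsFibrant y] [IsFibrant z] (f : y ⟶ z)
    [WeakEquivalence f] :
    IsIso (toHoSpace.map (((SimplicialCategory.sHomFunctor D).obj (op x)).map f)) := by
  let G : D ⥤ HoSpace.{v} := (SimplicialCategory.sHomFunctor D).obj (op x) ⋙ toHoSpace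
  have hG {a b : D} (p : a ⟶ b) [Fibration p] [WeakEquivalence p] : IsIso (G.map p) :=
    Localization.inverts toHoSpace weakHomotopyEquivalences _ (map_acyclicFibration x p)
  obtain ⟨h⟩ : Nonempty (FibrantBrownFactorization f) := inferInstance
  have h1 := hG h.p
  have h2 := hG h.r
  have h3 : G.map h.i ≫ G.map h.r = 𝟙 _ := by
    rw [← G.map_comp, h.i_r, G.map_id]
  have h4 : IsIso (G.map h.i) :=
    (IsIso.inv_eq_of_inv_hom_id h3) ▸ (inferInstance : IsIso (inv (G.map h.r)))
  have : IsIso (G.map f) := by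
    rw [← h.fac, G.map_comp]; infer_instance
  exact this

lemma mapFunctor_inverts :
    ((weakEquivalences (BifibrantObject D)).op.prod
      (weakEquivalences (BifibrantObject D))).IsInvertedBy (mapFunctor D) := by
  rintro ⟨x, y⟩ ⟨x', y'⟩ ⟨f, g⟩ ⟨hf, hg⟩
  have hf' : WeakEquivalence f.unop.hom := ⟨hf⟩
  have hg' : WeakEquivalence g.hom := ⟨hg⟩
  have h1 := isIso_map_left y.obj f.unop.hom
  have h2 := isIso_map_right x'.unop.obj g.hom
  have h3 : (mapFunctor D).map (f, g) =
      toHoSpace.map (((SimplicialCategory.sHomFunctor D).map f.unop.hom.op).app y.obj) ≫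
        toHoSpace.map (((SimplicialCategory.sHomFunctor D).obj (op x'.unop.obj)).map g.hom) := by
    rw [← Functor.map_comp]
    rfl
  rw [h3]
  exact @IsIso.comp_isIso _ _ _ _ _ _ _ h1 h2

variable (D) in
/-- The derived mapping space functor on `ho(D)`. -/
def RMap : (Ho D)ᵒᵖ × Ho D ⥤ HoSpace.{v} :=
  Localization.lift (mapFunctor D) mapFunctor_inverts
    (BifibrantObject.toHoCat.op.prod BifibrantObject.toHoCat)

instance isCofibrant_tensor (x y : D) [IsCofibrant x] [IsCofibrant y] : IsCofibrant (x ⊗ y) := by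
  obtain ⟨hx⟩ := TensorModelCategory.initial_tensor x (⊥_ D) initialIsInitial
  obtain ⟨hy⟩ := TensorModelCategory.initial_tensor y (⊥_ D) initialIsInitial
  obtain ⟨h0⟩ := TensorModelCategory.tensor_initial x (⊥_ D) initialIsInitial
  obtain ⟨h00⟩ := TensorModelCategory.tensor_initial (⊥_ D) (⊥_ D) initialIsInitial
  have hx' : Cofibration (initial.to x) := (isCofibrant_iff x).1 inferInstance
  have hy' : Cofibration (initial.to y) := (isCofibrant_iff y).1 inferInstance
  have := TensorModelCategory.pushout_product (initial.to x) (initial.to y)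
    { pt := x ⊗ (⊥_ D)
      inl := 𝟙 _
      inr := hy.to _
      isPushout := by
        have : IsIso (((curriedTensor D).obj (⊥_ D)).map (initial.to y)) :=
          isIso_of_isInitial h00 hy _
        exact IsPushout.of_vert_isIso ⟨h00.hom_ext _ _⟩
      ι := x ◁ initial.to y
      inl_ι := Category.id_comp _
      inr_ι := hy.hom_ext _ _ }
  exact (isCofibrant_iff_of_isInitial (x ◁ initial.to y) h0).2 this

variable (D) in
/-- The tensor product of cofibrant-fibrant objects, with values in `ho(D)`. -/
def tensorFunctor : BifibrantObject D × BifibrantObject D ⥤ Ho D :=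
  (cofibrantObjects D).lift (Functor.prod BifibrantObject.ι BifibrantObject.ι ⋙ tensor D)
    (fun x => isCofibrant_tensor x.1.obj x.2.obj) ⋙ toHo D

lemma tensorFunctor_inverts :
    ((weakEquivalences (BifibrantObject D)).prod
      (weakEquivalences (BifibrantObject D))).IsInvertedBy (tensorFunctor D) := by
  rintro ⟨x, y⟩ ⟨x', y'⟩ ⟨f, g⟩ ⟨hf, hg⟩
  have hf' : WeakEquivalence f.hom := ⟨hf⟩
  have hg' : WeakEquivalence g.hom := ⟨hg⟩
  have h1 : WeakEquivalence (f.hom ▷ y.obj) :=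
    TensorModelCategory.whiskerRight_weakEquivalence y.obj f.hom
  have h2 : WeakEquivalence (x'.obj ◁ g.hom) :=
    TensorModelCategory.whiskerLeft_weakEquivalence x'.obj g.hom
  have h3 : weakEquivalences D (f.hom ⊗ₘ g.hom) := by
    rw [MonoidalCategory.tensorHom_def]
    exact (weakEquivalences D).comp_mem _ _ h1.mem h2.mem
  let k : CofibrantObject.mk (x.obj ⊗ y.obj) ⟶ CofibrantObject.mk (x'.obj ⊗ y'.obj) :=
    CofibrantObject.homMk (f.hom ⊗ₘ g.hom)
  have hk : WeakEquivalence k := ⟨h3⟩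
  have : IsIso (BifibrantObject.toHoCat.map (CofibrantObject.bifibrantResolutionMap k)) :=
    inferInstance
  exact this

variable (D) in
/-- The derived tensor product on `ho(D)`. -/
def LTensor : Ho D × Ho D ⥤ Ho D :=
  Localization.lift (tensorFunctor D) tensorFunctor_inverts
    (BifibrantObject.toHoCat.prod BifibrantObject.toHoCat)

variable (D) in
/-- The unit object of `ho(D)`. -/
abbrev hoUnit : Ho D := (toHo D).obj (CofibrantObject.mk (𝟙_ D))

/-- The iterated derived tensor power in `ho(D)`. -/
def hoPow (y : Ho D) : ℕ → Ho D
  | 0 => hoUnit D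
  | n + 1 => (LTensor D).obj (hoPow y n, y)

open scoped Prod

variable (D) in
/-- A weak function object for `ho(D)`. -/
structure WeakFunctionObject where
  functor : (Ho D)ᵒᵖ × Ho D ⥤ Ho D
  adj (x y z : Ho D) : (RMap D).obj (op ((LTensor D).obj (x, y)), z) ⟶
    (RMap D).obj (op x, functor.obj (op y, z))
  adj_natural {x x' y y' z z' : Ho D} (f : x' ⟶ x) (g : y' ⟶ y) (h : z ⟶ z') :
    (RMap D).map (((LTensor D).map (f ×ₘ g)).op ×ₘ h) ≫ adj x' y' z' =
      adj x y z ≫ (RMap D).map (f.op ×ₘ functor.map (g.op ×ₘ h))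

namespace WeakFunctionObject

/-- The weak function object provides an adjoint for maps `x ⊗ y ⟶ z`. -/
def ProvidesAdjoint (F : WeakFunctionObject D) (x y z : Ho D) : Prop := IsIso (F.adj x y z)

/-- A map `η : x ⟶ y` in `ho(D)` is rigid if `η^* : F(y, y) ⟶ F(x, y)` is an isomorphism in
`ho(D)`. -/
def IsRigid (F : WeakFunctionObject D) {x y : Ho D} (η : x ⟶ y) : Prop :=
  IsIso (F.functor.map (η.op ×ₘ 𝟙 y))

end WeakFunctionObject

end Ho

end RigidOperad

end

open RigidOperad

/-! The heart is that every restriction map `Map(Y^{⊗ n}, Y) ⟶ Map(I^{⊗ n}, Y)` along a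
representative of `η` is a weak equivalence. The adjoints identify restriction along `y^{⊗ n} ⊗ η`,
from `RMap(y^{⊗ n} ⊗ y, y)` to `RMap(y^{⊗ n} ⊗ I, y)`, with the map `RMap(y^{⊗ n}, F(y, y)) ⟶
RMap(y^{⊗ n}, F(I, y))` induced by `η^*`, and rigidity makes the latter an isomorphism
(`WeakFunctionObject.IsRigid.isIso_rMap`). Exchanging the factors `I` for `Y` one at a time gives
the claim for all tensor powers (`mapIso_powMap_of_isRigid`).

Both contractibility statements then follow by lifting maps out of the cofibrant operad `E` along a
levelwise trivial fibration of operads (`IsCofibrant.exists_lift`).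

For a cofibration `j`, restriction along `j^{⊗ n}` is a Kan fibration as well, hence a trivial
fibration. The operations on `Y` compatible with the multiplication of `I` form a suboperad `unitSub
j` of `End(Y)` whose levels are fibers of these maps. So it is trivially fibered over the
commutative operad, and the space of maps from `E` to it is contractible
(`contractible_unitExtensionSpace`).

For a fibration `p` with `p ∘ f` representing `η`, two out of three shows that restriction `Map(Y^{⊗
n}, Y) ⟶ Map(X^{⊗ n}, Y)` is a weak equivalence, while `p` induces Kan fibrations `Map(X^{⊗ n}, X) ⟶
Map(X^{⊗ n}, Y)`. Consider the operad `arrowSub p` of pairs of an operation on `Y` and a path of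
operations on `X` whose end is compatible with it. Taking the start of the path is levelwise a
trivial fibration onto `End(X)`, by the lifting property of mapping path fibrations. Maps from `E`
to this operad lying over `θ` are the points of the homotopy fiber (`contractible_homotopyFiber`).

Algebra structures are given in coordinates (`Fin k`, adjacent transpositions, bracketed powers),
whereas operads are indexed by finite sets. The bridge is a coordinate-free endomorphism operad
`endOperad`, whose operations are families of simplices indexed by enumerations of the inputs. It
rests on a coherence theorem for symmetries of tensor powers (`Symm.unique`): a composite of
adjacent exchanges is determined by its effect on distinct labels. -/

noncomputable section

namespace RigidOperad

/-! ### Lifting properties and homotopies of simplicial sets -/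

section SimplicialSets

open scoped Simplicial
open SSet.modelCategoryQuillen

/-- Trivial fibrations of simplicial sets: the right lifting property against monomorphisms. -/
abbrev TrivialFibration {S T : SSet.{v}} (f : S ⟶ T) : Prop :=
  (MorphismProperty.monomorphisms SSet.{v}).rlp f

lemma TrivialFibration.kanFibration {S T : SSet.{v}} {f : S ⟶ T} (hf : TrivialFibration f) :
    KanFibration f :=
  fun _ _ i hi => hf i (J_le_monomorphisms i hi)

lemma KanFibration.fibration {S T : SSet.{v}} {f : S ⟶ T} (hf : KanFibration f) :
    Fibration f := (SSet.modelCategoryQuillen.fibration_iff f).2 hf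

lemma TrivialFibration.exists_lift {S T A B : SSet.{v}} {f : S ⟶ T} (hf : TrivialFibration f)
    (i : A ⟶ B) [Mono i] (u : A ⟶ S) (w : B ⟶ T) (h : u ≫ f = i ≫ w) :
    ∃ l : B ⟶ S, i ≫ l = u ∧ l ≫ f = w := by
  have := hf i (inferInstanceAs (Mono i))
  have sq : CommSq u i f w := ⟨h⟩
  exact ⟨sq.lift, sq.fac_left, sq.fac_right⟩

lemma trivialFibration_of_exists_lift {S T : SSet.{v}} {f : S ⟶ T}
    (h : ∀ (B : SSet.{v}) (A : B.Subcomplex) (u : (A : SSet.{v}) ⟶ S) (w : B ⟶ T),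
      u ≫ f = A.ι ≫ w → ∃ l : B ⟶ S, A.ι ≫ l = u ∧ l ≫ f = w) : TrivialFibration f := by
  dsimp only [TrivialFibration]
  rw [SSet.rlp_monomorphisms]
  rintro _ _ _ ⟨n⟩
  refine ⟨fun {u w} sq => ?_⟩
  obtain ⟨l, h1, h2⟩ := h _ _ u w sq.w
  exact ⟨⟨⟨l, h1, h2⟩⟩⟩

/-- `A.unionProd B` is the pushout of `X ⊗ B` and `A ⊗ Y` over `A ⊗ B`, so a lifting problem against
its inclusion amounts to the compatible pair `u`, `w` together with `r`. -/
lemma exists_lift_unionProd {X Y P R : SSet.{v}} (A : X.Subcomplex) (B : Y.Subcomplex) (f : P ⟶ R)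
    (hf : HasLiftingProperty (A.unionProd B).ι f)
    (u : X ⊗ (B : SSet.{v}) ⟶ P) (w : (A : SSet.{v}) ⊗ Y ⟶ P) (h : A.ι ▷ _ ≫ u = _ ◁ B.ι ≫ w)
    (r : X ⊗ Y ⟶ R) (hu : u ≫ f = X ◁ B.ι ≫ r) (hw : w ≫ f = A.ι ▷ Y ≫ r) :
    ∃ l : X ⊗ Y ⟶ P, X ◁ B.ι ≫ l = u ∧ A.ι ▷ Y ≫ l = w ∧ l ≫ f = r := by
  have sq : CommSq ((SSet.Subcomplex.unionProd.isPushout A B).desc u w h) (A.unionProd B).ι f r := by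
    constructor
    apply (SSet.Subcomplex.unionProd.isPushout A B).hom_ext
    · rw [IsPushout.inl_desc_assoc, hu]; rfl
    · rw [IsPushout.inr_desc_assoc, hw]; rfl
  refine ⟨sq.lift, ?_, ?_, sq.fac_right⟩
  · rw [← SSet.Subcomplex.unionProd.ι₁_ι, Category.assoc, sq.fac_left, IsPushout.inl_desc]
  · rw [← SSet.Subcomplex.unionProd.ι₂_ι, Category.assoc, sq.fac_left, IsPushout.inr_desc]

lemma whiskerLeft_eq_fst_ι₀ {X : SSet.{v}} {L : SSet.{v}} (j : L ⟶ Δ[1])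
    (hj : j = SSet.const (SSet.stdSimplex.obj₀Equiv.{v}.symm 0)) :
    X ◁ j = fst X L ≫ SSet.ι₀ := by
  subst hj; rfl

lemma whiskerLeft_eq_fst_ι₁ {X : SSet.{v}} {L : SSet.{v}} (j : L ⟶ Δ[1])
    (hj : j = SSet.const (SSet.stdSimplex.obj₀Equiv.{v}.symm 1)) :
    X ◁ j = fst X L ≫ SSet.ι₁ := by
  subst hj; rfl

/-- The face `δ 1` omits the vertex `1`, so it picks out the start of a homotopy; `δ 0` picks out
the end. -/
lemma δ_one_comp_curry {X Z : SSet.{v}} (H : X ⊗ Δ[1] ⟶ Z) :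
    SSet.stdSimplex.δ (1 : Fin 2) ≫ MonoidalClosed.curry H =
      MonoidalClosed.curry (fst X Δ[0] ≫ SSet.ι₀ ≫ H) := by
  rw [← MonoidalClosed.curry_natural_left,
    whiskerLeft_eq_fst_ι₀ _ SSet.stdSimplex.δ_one_eq_const, Category.assoc]

lemma δ_zero_comp_curry {X Z : SSet.{v}} (H : X ⊗ Δ[1] ⟶ Z) :
    SSet.stdSimplex.δ (0 : Fin 2) ≫ MonoidalClosed.curry H =
      MonoidalClosed.curry (fst X Δ[0] ≫ SSet.ι₁ ≫ H) := by
  rw [← MonoidalClosed.curry_natural_left,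
    whiskerLeft_eq_fst_ι₁ _ SSet.stdSimplex.δ_zero_eq_const, Category.assoc]

/-- Only the face opposite to the vertex `1` remains in `Λ[1, 0]`, and this is the vertex `0`. -/
lemma horn_one_zero_ι :
    (Λ[1, 0] : (Δ[1] : SSet.{v}).Subcomplex).ι =
      SSet.const (SSet.stdSimplex.obj₀Equiv.{v}.symm 0) := by
  apply SSet.horn.hom_ext'
  intro j hj
  obtain rfl : j = 1 := by grind
  rw [SSet.horn.ι_ι, SSet.stdSimplex.δ_one_eq_const]
  rfl

lemma horn_one_one_ι :
    (Λ[1, 1] : (Δ[1] : SSet.{v}).Subcomplex).ι =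
      SSet.const (SSet.stdSimplex.obj₀Equiv.{v}.symm 1) := by
  apply SSet.horn.hom_ext'
  intro j hj
  obtain rfl : j = 0 := by grind
  rw [SSet.horn.ι_ι, SSet.stdSimplex.δ_zero_eq_const]
  rfl

/-- The pushout product of a monomorphism with a horn inclusion is anodyne. -/
lemma KanFibration.hasLiftingProperty_unionProd {P R : SSet.{v}} {f : P ⟶ R}
    (hf : KanFibration f) {X : SSet.{v}} (A : X.Subcomplex) (k : Fin 2) :
    HasLiftingProperty (A.unionProd Λ[1, k]).ι f :=
  SSet.anodyneExtensions_unionProd_ι A _ (SSet.anodyneExtensions.horn_ι k) f hf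

/-- The covering homotopy extension property, for homotopies with given start. -/
lemma KanFibration.exists_lift_ι₀ {P R : SSet.{v}} {f : P ⟶ R} (hf : KanFibration f)
    {X : SSet.{v}} (A : X.Subcomplex) (u : X ⟶ P) (w : (A : SSet.{v}) ⊗ Δ[1] ⟶ P)
    (h : SSet.ι₀ ≫ w = A.ι ≫ u) (r : X ⊗ Δ[1] ⟶ R) (hu : u ≫ f = SSet.ι₀ ≫ r)
    (hw : w ≫ f = A.ι ▷ _ ≫ r) :
    ∃ l : X ⊗ Δ[1] ⟶ P, SSet.ι₀ ≫ l = u ∧ A.ι ▷ _ ≫ l = w ∧ l ≫ f = r := by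
  obtain ⟨l, h1, h2, h3⟩ := exists_lift_unionProd A Λ[1, 0] f
    (hf.hasLiftingProperty_unionProd A 0) (fst _ _ ≫ u) w
    (by rw [whiskerLeft_eq_fst_ι₀ _ horn_one_zero_ι, Category.assoc, h]; rfl) r
    (by rw [whiskerLeft_eq_fst_ι₀ _ horn_one_zero_ι, Category.assoc, Category.assoc, hu]) hw
  refine ⟨l, ?_, h2, h3⟩
  rw [whiskerLeft_eq_fst_ι₀ _ horn_one_zero_ι, Category.assoc] at h1
  -- `h1` concerns maps out of `X ⊗ Λ[1, 0]`. Precomposition with the section at the only vertex of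
  -- the horn turns it into an equation of maps out of `X`.
  have h4 := lift (𝟙 X) (SSet.const (X := X) (Y := Δ[0])
    (SSet.stdSimplex.obj₀Equiv.{v}.symm 0) ≫ SSet.horn.ι 0 1 (by decide)) ≫= h1
  rwa [lift_fst_assoc, lift_fst_assoc, Category.id_comp, Category.id_comp] at h4

/-- The covering homotopy extension property, for homotopies with given end. -/
lemma KanFibration.exists_lift_ι₁ {P R : SSet.{v}} {f : P ⟶ R} (hf : KanFibration f)
    {X : SSet.{v}} (A : X.Subcomplex) (u : X ⟶ P) (w : (A : SSet.{v}) ⊗ Δ[1] ⟶ P)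
    (h : SSet.ι₁ ≫ w = A.ι ≫ u) (r : X ⊗ Δ[1] ⟶ R) (hu : u ≫ f = SSet.ι₁ ≫ r)
    (hw : w ≫ f = A.ι ▷ _ ≫ r) :
    ∃ l : X ⊗ Δ[1] ⟶ P, SSet.ι₁ ≫ l = u ∧ A.ι ▷ _ ≫ l = w ∧ l ≫ f = r := by
  obtain ⟨l, h1, h2, h3⟩ := exists_lift_unionProd A Λ[1, 1] f
    (hf.hasLiftingProperty_unionProd A 1) (fst _ _ ≫ u) w
    (by rw [whiskerLeft_eq_fst_ι₁ _ horn_one_one_ι, Category.assoc, h]; rfl) r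
    (by rw [whiskerLeft_eq_fst_ι₁ _ horn_one_one_ι, Category.assoc, Category.assoc, hu]) hw
  refine ⟨l, ?_, h2, h3⟩
  rw [whiskerLeft_eq_fst_ι₁ _ horn_one_one_ι, Category.assoc] at h1
  have h4 := lift (𝟙 X) (SSet.const (X := X) (Y := Δ[0])
    (SSet.stdSimplex.obj₀Equiv.{v}.symm 0) ≫ SSet.horn.ι 1 0 (by decide)) ≫= h1
  rwa [lift_fst_assoc, lift_fst_assoc, Category.id_comp, Category.id_comp] at h4

lemma δ_zero_comp_σ_one :
    SSet.stdSimplex.{v}.δ (0 : Fin 3) ≫ SSet.stdSimplex.σ (1 : Fin 2) =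
      SSet.const (SSet.stdSimplex.obj₀Equiv.{v}.symm 1) := by
  have := SSet.stdSimplex.{v}.δ_comp_σ_of_le (i := (0 : Fin 2)) (j := (0 : Fin 1)) le_rfl
  refine Eq.trans this ?_
  rw [SSet.stdSimplex.δ_zero_eq_const]
  rfl

lemma δ_one_comp_σ_one :
    SSet.stdSimplex.{v}.δ (1 : Fin 3) ≫ SSet.stdSimplex.σ (1 : Fin 2) = 𝟙 Δ[1] :=
  SSet.stdSimplex.{v}.δ_comp_σ_self (i := (1 : Fin 2))

lemma δ_two_comp_σ_one :
    SSet.stdSimplex.{v}.δ (2 : Fin 3) ≫ SSet.stdSimplex.σ (1 : Fin 2) = 𝟙 Δ[1] :=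
  SSet.stdSimplex.{v}.δ_comp_σ_succ (i := (1 : Fin 2))

lemma const_comp_δ_zero (X : SSet.{v}) :
    SSet.const (X := X) (SSet.stdSimplex.obj₀Equiv.{v}.symm (0 : Fin 2)) ≫
      SSet.stdSimplex.δ (0 : Fin 3) = SSet.const (SSet.stdSimplex.obj₀Equiv.{v}.symm 1) := by
  rw [SSet.const_comp]
  congr 1

lemma const_comp_δ_zero' (X : SSet.{v}) :
    SSet.const (X := X) (SSet.stdSimplex.obj₀Equiv.{v}.symm (1 : Fin 2)) ≫
      SSet.stdSimplex.δ (0 : Fin 3) = SSet.const (SSet.stdSimplex.obj₀Equiv.{v}.symm 2) := by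
  rw [SSet.const_comp]
  congr 1

lemma const_comp_δ_one (X : SSet.{v}) :
    SSet.const (X := X) (SSet.stdSimplex.obj₀Equiv.{v}.symm (1 : Fin 2)) ≫
      SSet.stdSimplex.δ (1 : Fin 3) = SSet.const (SSet.stdSimplex.obj₀Equiv.{v}.symm 2) := by
  rw [SSet.const_comp]
  congr 1

lemma const_comp_δ_two (X : SSet.{v}) :
    SSet.const (X := X) (SSet.stdSimplex.obj₀Equiv.{v}.symm (1 : Fin 2)) ≫
      SSet.stdSimplex.δ (2 : Fin 3) = SSet.const (SSet.stdSimplex.obj₀Equiv.{v}.symm 1) := by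
  rw [SSet.const_comp]
  congr 1

/-- Two homotopies with the same start and the same image under a Kan fibration differ by a
homotopy whose image is constant. -/
lemma KanFibration.exists_homotopy_of_ι₀_eq {P R : SSet.{v}} {f : P ⟶ R} (hf : KanFibration f)
    {X : SSet.{v}} (H₁ H₂ : X ⊗ Δ[1] ⟶ P) (h : SSet.ι₀ ≫ H₁ = SSet.ι₀ ≫ H₂)
    (h' : H₁ ≫ f = H₂ ≫ f) :
    ∃ H : X ⊗ Δ[1] ⟶ P, SSet.ι₀ ≫ H = SSet.ι₁ ≫ H₁ ∧ SSet.ι₁ ≫ H = SSet.ι₁ ≫ H₂ ∧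
      H ≫ f = fst _ _ ≫ SSet.ι₁ ≫ H₁ ≫ f := by
  have := hf.fibration
  -- A horn `Λ[2, 0]` in the internal hom: `H₁` is the edge from `0` to `1` and `H₂` the edge from
  -- `0` to `2`. It is filled over the degenerate triangle `σ 1` on the common image, and the edge
  -- from `1` to `2` is the homotopy sought. Its image is constant since `σ 1` collapses that edge.
  have hcomp : SSet.horn.IsCompatible (i := (0 : Fin 3)) (X := (ihom X).obj P)
      (fun j _ => if j = 1 then MonoidalClosed.curry H₂ else MonoidalClosed.curry H₁) := by
    intro j k hj hk hjk
    obtain rfl : j = 1 := by grind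
    obtain rfl : k = 2 := by grind
    change SSet.stdSimplex.δ (1 : Fin 2) ≫ MonoidalClosed.curry H₂ =
      SSet.stdSimplex.δ (1 : Fin 2) ≫ MonoidalClosed.curry H₁
    rw [δ_one_comp_curry, δ_one_comp_curry, h]
  obtain ⟨φ, hφ, hφ'⟩ := hcomp.exists_lift ((ihom X).map f)
    (SSet.stdSimplex.σ (1 : Fin 2) ≫ MonoidalClosed.curry (H₁ ≫ f)) (by
      intro j hj
      have hj' : j = 1 ∨ j = 2 := by grind
      rcases hj' with rfl | rfl
      · rw [if_pos rfl, ← MonoidalClosed.curry_natural_right, ← h', ← Category.assoc,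
          δ_one_comp_σ_one, Category.id_comp]
      · rw [if_neg (by decide), ← MonoidalClosed.curry_natural_right, ← Category.assoc,
          δ_two_comp_σ_one, Category.id_comp])
  have h₁ : X ◁ SSet.stdSimplex.δ (1 : Fin 3) ≫ MonoidalClosed.uncurry φ = H₂ := by
    rw [← MonoidalClosed.uncurry_natural_left, hφ 1 (by decide), if_pos rfl,
      MonoidalClosed.uncurry_curry]
  have h₂ : X ◁ SSet.stdSimplex.δ (2 : Fin 3) ≫ MonoidalClosed.uncurry φ = H₁ := by
    rw [← MonoidalClosed.uncurry_natural_left, hφ 2 (by decide), if_neg (by decide),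
      MonoidalClosed.uncurry_curry]
  refine ⟨X ◁ SSet.stdSimplex.δ (0 : Fin 3) ≫ MonoidalClosed.uncurry φ, ?_, ?_, ?_⟩
  · rw [← h₂, ← Category.assoc, ← Category.assoc, SSet.ι₀, SSet.ι₁, lift_whiskerLeft,
      lift_whiskerLeft, const_comp_δ_zero, const_comp_δ_two]
  · rw [← h₁, ← Category.assoc, ← Category.assoc, SSet.ι₁, lift_whiskerLeft,
      lift_whiskerLeft, const_comp_δ_zero', const_comp_δ_one]
  · rw [Category.assoc, ← MonoidalClosed.uncurry_natural_right, hφ',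
      MonoidalClosed.uncurry_natural_left, MonoidalClosed.uncurry_curry,
      ← MonoidalCategory.whiskerLeft_comp_assoc, whiskerLeft_eq_fst_ι₁ _ δ_zero_comp_σ_one,
      Category.assoc]

/-- Simplicial homotopies. -/
def Homotopic {X Y : SSet.{v}} (f g : X ⟶ Y) : Prop :=
  ∃ H : X ⊗ Δ[1] ⟶ Y, SSet.ι₀ ≫ H = f ∧ SSet.ι₁ ≫ H = g

lemma Homotopic.refl {X Y : SSet.{v}} (f : X ⟶ Y) : Homotopic f f :=
  ⟨fst _ _ ≫ f, rfl, rfl⟩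

lemma kanFibration_toUnit (Y : SSet.{v}) [SSet.KanComplex Y] : KanFibration (toUnit Y) :=
  (SSet.modelCategoryQuillen.fibration_iff _).1
    ((isFibrant_iff_of_isTerminal (toUnit Y) isTerminalTensorUnit).1 inferInstance)

lemma kanComplex_of_kanFibration_toUnit {Y : SSet.{v}} (h : KanFibration (toUnit Y)) :
    SSet.KanComplex Y :=
  (isFibrant_iff_of_isTerminal (toUnit Y) isTerminalTensorUnit).2 h.fibration

lemma KanFibration.comp {X Y Z : SSet.{v}} {f : X ⟶ Y} {g : Y ⟶ Z} (hf : KanFibration f)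
    (hg : KanFibration g) : KanFibration (f ≫ g) :=
  MorphismProperty.comp_mem (SSet.modelCategoryQuillen.J.rlp) _ _ hf hg

lemma KanFibration.kanComplex {X Y : SSet.{v}} {f : X ⟶ Y} (hf : KanFibration f)
    [SSet.KanComplex Y] : SSet.KanComplex X :=
  kanComplex_of_kanFibration_toUnit (hf.comp (kanFibration_toUnit Y))

/-- This is `KanFibration.exists_homotopy_of_ι₀_eq` over the point; symmetry and transitivity of
homotopy both follow from it. -/
lemma Homotopic.of_left {X Y : SSet.{v}} [SSet.KanComplex Y] {f g h : X ⟶ Y} (h₁ : Homotopic f g)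
    (h₂ : Homotopic f h) : Homotopic g h := by
  obtain ⟨H₁, rfl, rfl⟩ := h₁
  obtain ⟨H₂, h, rfl⟩ := h₂
  obtain ⟨H, h₁, h₂, -⟩ :=
    (kanFibration_toUnit Y).exists_homotopy_of_ι₀_eq H₁ H₂ h.symm (toUnit_unique _ _)
  exact ⟨H, h₁, h₂⟩

lemma Homotopic.symm {X Y : SSet.{v}} [SSet.KanComplex Y] {f g : X ⟶ Y} (h : Homotopic f g) :
    Homotopic g f := h.of_left (.refl f)

lemma Homotopic.trans {X Y : SSet.{v}} [SSet.KanComplex Y] {f g h : X ⟶ Y} (h₁ : Homotopic f g)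
    (h₂ : Homotopic g h) : Homotopic f h := h₁.symm.of_left h₂

/-- The vertex of the internal hom that corresponds to a map. -/
def vertexOfHom {X Y : SSet.{v}} (f : X ⟶ Y) : ((ihom X).obj Y) _⦋0⦌ :=
  SSet.yonedaEquiv (MonoidalClosed.curry (fst X Δ[0] ≫ f))

instance isIso_fst_stdSimplex_zero (X : SSet.{v}) : IsIso (fst X Δ[0]) :=
  ⟨lift (𝟙 X) (SSet.const (SSet.stdSimplex.obj₀Equiv.{v}.symm 0)),
    CartesianMonoidalCategory.hom_ext _ _ (by simp) SSet.stdSimplex.ext₀, by simp⟩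

lemma vertexOfHom_surjective {X Y : SSet.{v}} :
    Function.Surjective (vertexOfHom : (X ⟶ Y) → _) := by
  intro x
  refine ⟨inv (fst X Δ[0]) ≫ MonoidalClosed.uncurry (SSet.yonedaEquiv.symm x), ?_⟩
  rw [vertexOfHom, IsIso.hom_inv_id_assoc, MonoidalClosed.curry_uncurry, Equiv.apply_symm_apply]

lemma vertexOfHom_injective {X Y : SSet.{v}} :
    Function.Injective (vertexOfHom : (X ⟶ Y) → _) := by
  intro f g h
  have := MonoidalClosed.curry_injective (SSet.yonedaEquiv.injective h)
  rwa [cancel_epi] at this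

lemma vertexOfHom_pre {X' X Y : SSet.{v}} (a : X' ⟶ X) (f : X ⟶ Y) :
    ((MonoidalClosed.pre a).app Y).app _ (vertexOfHom f) = vertexOfHom (a ≫ f) := by
  rw [vertexOfHom, ← SSet.yonedaEquiv_comp, MonoidalClosed.curry_pre_app]
  simp [vertexOfHom]

lemma δ_one_vertexOfHom {X Y : SSet.{v}} (H : X ⊗ Δ[1] ⟶ Y) :
    ((ihom X).obj Y).δ 1 (SSet.yonedaEquiv (MonoidalClosed.curry H)) =
      vertexOfHom (SSet.ι₀ ≫ H) := by
  rw [vertexOfHom, ← δ_one_comp_curry]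
  exact (SSet.stdSimplex.yonedaEquiv_δ_comp _ _).symm

lemma δ_zero_vertexOfHom {X Y : SSet.{v}} (H : X ⊗ Δ[1] ⟶ Y) :
    ((ihom X).obj Y).δ 0 (SSet.yonedaEquiv (MonoidalClosed.curry H)) =
      vertexOfHom (SSet.ι₁ ≫ H) := by
  rw [vertexOfHom, ← δ_zero_comp_curry]
  exact (SSet.stdSimplex.yonedaEquiv_δ_comp _ _).symm

lemma homotopic_of_edge {X Y : SSet.{v}} {f g : X ⟶ Y}
    (e : SSet.Edge (vertexOfHom f) (vertexOfHom g)) : Homotopic f g := by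
  refine ⟨MonoidalClosed.uncurry (SSet.yonedaEquiv.symm e.edge), ?_, ?_⟩
  · apply vertexOfHom_injective
    rw [← δ_one_vertexOfHom, MonoidalClosed.curry_uncurry, Equiv.apply_symm_apply, e.src_eq]
  · apply vertexOfHom_injective
    rw [← δ_zero_vertexOfHom, MonoidalClosed.curry_uncurry, Equiv.apply_symm_apply, e.tgt_eq]

lemma Homotopic.nonempty_edge {X Y : SSet.{v}} {f g : X ⟶ Y} (h : Homotopic f g) :
    Nonempty (SSet.Edge (vertexOfHom f) (vertexOfHom g)) := by
  obtain ⟨H, rfl, rfl⟩ := h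
  exact ⟨SSet.Edge.mk _ (δ_one_vertexOfHom H) (δ_zero_vertexOfHom H)⟩

/-- The set `π₀` is the quotient by the equivalence relation generated by edges. Edges of the
internal hom are homotopies, and homotopy of maps to a Kan complex is already an equivalence
relation. -/
lemma mk_vertexOfHom_eq_iff {X Y : SSet.{v}} [SSet.KanComplex Y] (f g : X ⟶ Y) :
    SSet.π₀.mk (vertexOfHom f) = SSet.π₀.mk (vertexOfHom g) ↔ Homotopic f g := by
  refine ⟨fun h => ?_, fun h => SSet.π₀.sound h.nonempty_edge.some⟩
  rw [SSet.π₀.mk_eq_mk_iff] at h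
  generalize hx : vertexOfHom f = x at h
  generalize hy : vertexOfHom g = y at h
  induction h generalizing f g with
  | rel x y h =>
    subst hx hy
    exact homotopic_of_edge h.some
  | refl x =>
    obtain rfl := vertexOfHom_injective (hx.trans hy.symm)
    exact .refl f
  | symm x y _ ih => exact (ih _ _ hy hx).symm
  | trans x y z _ _ ih₁ ih₂ =>
    obtain ⟨k, rfl⟩ := vertexOfHom_surjective y
    exact (ih₁ f k hx rfl).trans (ih₂ k g rfl hy)

lemma weakHomotopyEquivalences_of_homotopic {X Y : SSet.{v}} (f : X ⟶ Y) (g : Y ⟶ X)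
    (h : Homotopic (f ≫ g) (𝟙 X)) (h' : Homotopic (g ≫ f) (𝟙 Y)) :
    weakHomotopyEquivalences f := by
  intro Z _
  have key {A B : SSet.{v}} (a : A ⟶ B) (b : B ⟶ A) (h : Homotopic (a ≫ b) (𝟙 A)) (x) :
      SSet.mapπ₀ ((MonoidalClosed.pre a).app Z) (SSet.mapπ₀ ((MonoidalClosed.pre b).app Z) x) =
        x := by
    obtain ⟨y, rfl⟩ := SSet.π₀.mk_surjective x
    obtain ⟨y, rfl⟩ := vertexOfHom_surjective y
    rw [SSet.mapπ₀_mk, SSet.mapπ₀_mk, vertexOfHom_pre, vertexOfHom_pre, mk_vertexOfHom_eq_iff]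
    obtain ⟨H, h₁, h₂⟩ := h
    exact ⟨H ≫ y, by rw [reassoc_of% h₁], by rw [reassoc_of% h₂]⟩
  exact ⟨Function.LeftInverse.injective (key g f h'), Function.RightInverse.surjective (key f g h)⟩

lemma weakHomotopyEquivalences.exists_homotopy_inverse {X Y : SSet.{v}} [SSet.KanComplex X]
    [SSet.KanComplex Y] {f : X ⟶ Y} (hf : weakHomotopyEquivalences f) :
    ∃ g : Y ⟶ X, Homotopic (f ≫ g) (𝟙 X) ∧ Homotopic (g ≫ f) (𝟙 Y) := by
  -- A Yoneda argument: surjectivity for the target `X` provides the inverse `g`, and injectivity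
  -- for the target `Y` the second homotopy.
  obtain ⟨x, hx⟩ := (hf X).2 (SSet.π₀.mk (vertexOfHom (𝟙 X)))
  obtain ⟨x, rfl⟩ := SSet.π₀.mk_surjective x
  obtain ⟨g, rfl⟩ := vertexOfHom_surjective x
  rw [SSet.mapπ₀_mk, vertexOfHom_pre, mk_vertexOfHom_eq_iff] at hx
  refine ⟨g, hx, ?_⟩
  rw [← mk_vertexOfHom_eq_iff]
  apply (hf Y).1
  rw [SSet.mapπ₀_mk, SSet.mapπ₀_mk, vertexOfHom_pre, vertexOfHom_pre, mk_vertexOfHom_eq_iff]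
  obtain ⟨H, h₁, h₂⟩ := hx
  exact ⟨H ≫ f, by rw [reassoc_of% h₁], by rw [reassoc_of% h₂, Category.comp_id]⟩

lemma TrivialFibration.exists_section {S T : SSet.{v}} {f : S ⟶ T} (hf : TrivialFibration f) :
    ∃ s : T ⟶ S, s ≫ f = 𝟙 T := by
  obtain ⟨s, -, hs⟩ := hf.exists_lift (initial.to T) (initial.to S) (𝟙 T)
    (initialIsInitial.hom_ext _ _)
  exact ⟨s, hs⟩

lemma range_ι₀_inf_range_ι₁ (X : SSet.{v}) :
    SSet.Subcomplex.range (SSet.ι₀ : X ⟶ X ⊗ Δ[1]) ⊓ SSet.Subcomplex.range SSet.ι₁ = ⊥ := by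
  ext ⟨⟨n⟩⟩ x
  refine ⟨?_, False.elim⟩
  rintro ⟨⟨a, rfl⟩, ⟨b, hb⟩⟩
  have h := congr_arg (fun t : (X ⊗ Δ[1] : SSet.{v}) _⦋n⦌ => t.2 0) hb
  simp at h

/-- The two ends of the cylinder are disjoint, so `a` and `b` define a map on their union; lift the
constant homotopy of the common image relative to it. -/
lemma TrivialFibration.homotopic_of_comp_eq {S T : SSet.{v}} {f : S ⟶ T}
    (hf : TrivialFibration f) {X : SSet.{v}} {a b : X ⟶ S} (h : a ≫ f = b ≫ f) :
    Homotopic a b := by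
  let A₀ := SSet.Subcomplex.range (SSet.ι₀ : X ⟶ X ⊗ Δ[1])
  let A₁ := SSet.Subcomplex.range (SSet.ι₁ : X ⟶ X ⊗ Δ[1])
  have sq : SSet.Subcomplex.BicartSq ⊥ A₀ A₁ (A₀ ⊔ A₁) := ⟨rfl, range_ι₀_inf_range_ι₁ X⟩
  obtain ⟨l, h₁, h₂⟩ := hf.exists_lift (A₀ ⊔ A₁).ι
    (sq.isPushout.desc (A₀.ι ≫ fst _ _ ≫ a) (A₁.ι ≫ fst _ _ ≫ b)
      (SSet.Subcomplex.isInitialBot.hom_ext _ _)) (fst _ _ ≫ a ≫ f) (by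
      apply sq.isPushout.hom_ext
      · rw [IsPushout.inl_desc_assoc]
        simp only [Category.assoc]
        rfl
      · rw [IsPushout.inr_desc_assoc]
        simp only [Category.assoc, ← h]
        rfl)
  refine ⟨l, ?_, ?_⟩
  · have := sq.isPushout.inl_desc (A₀.ι ≫ fst _ _ ≫ a) (A₁.ι ≫ fst _ _ ≫ b)
      (SSet.Subcomplex.isInitialBot.hom_ext _ _)
    rw [← h₁] at this
    exact SSet.Subcomplex.toRange SSet.ι₀ ≫= this
  · have := sq.isPushout.inr_desc (A₀.ι ≫ fst _ _ ≫ a) (A₁.ι ≫ fst _ _ ≫ b)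
      (SSet.Subcomplex.isInitialBot.hom_ext _ _)
    rw [← h₁] at this
    exact SSet.Subcomplex.toRange SSet.ι₁ ≫= this

lemma TrivialFibration.weakHomotopyEquivalences {S T : SSet.{v}} {f : S ⟶ T}
    (hf : TrivialFibration f) : weakHomotopyEquivalences f := by
  obtain ⟨s, hs⟩ := hf.exists_section
  exact weakHomotopyEquivalences_of_homotopic f s
    (hf.homotopic_of_comp_eq (by rw [Category.assoc, hs, Category.comp_id, Category.id_comp]))
    (by rw [hs]; exact .refl _)

/-- A Kan fibration between Kan complexes that is a weak equivalence is a trivial fibration. -/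
lemma KanFibration.trivialFibration {P R : SSet.{v}} [SSet.KanComplex R]
    {f : P ⟶ R} (hf : KanFibration f) (hf' : weakHomotopyEquivalences f) :
    TrivialFibration f := by
  have : SSet.KanComplex P := hf.kanComplex
  obtain ⟨s₀, h₁, h₂⟩ := hf'.exists_homotopy_inverse
  -- a section
  obtain ⟨s, hs, h₃⟩ : ∃ s : R ⟶ P, s ≫ f = 𝟙 R ∧ Homotopic (f ≫ s) (𝟙 P) := by
    obtain ⟨H, h₃, h₄⟩ := h₂
    have hi : IsInitial ((⊥ : R.Subcomplex) ⊗ Δ[1] : SSet.{v}) :=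
      IsInitial.isInitialObj (tensorRight (Δ[1] : SSet.{v})) _
        SSet.Subcomplex.isInitialBot
    -- The homotopy from `s₀ ≫ f` to the identity is lifted with start `s₀`; the end of the lift is
    -- a strict section. No relative condition is needed, hence the empty subcomplex.
    obtain ⟨l, h₅, -, h₆⟩ := hf.exists_lift_ι₀ (⊥ : R.Subcomplex) s₀ (hi.to _)
      (SSet.Subcomplex.isInitialBot.hom_ext _ _) H h₃.symm (hi.hom_ext _ _)
    refine ⟨SSet.ι₁ ≫ l, by rw [Category.assoc, h₆, h₄], Homotopic.of_left ?_ h₁⟩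
    exact ⟨f ▷ _ ≫ l, by rw [SSet.ι₀_comp_assoc, h₅], by rw [SSet.ι₁_comp_assoc]⟩
  obtain ⟨H, h₄, h₅⟩ := h₃
  -- The homotopy `H` from `f ≫ s` to the identity is made fiberwise: `H ≫ f ≫ s` and `H` have the
  -- same start and, as `s` is a section, the same image under `f`. So their ends `f ≫ s` and `𝟙 P`
  -- are homotopic by some `G` over `R`.
  obtain ⟨G, g₁, g₂, g₃⟩ := hf.exists_homotopy_of_ι₀_eq (H ≫ f ≫ s) H
    (by rw [reassoc_of% h₄, reassoc_of% hs, h₄])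
    (by rw [Category.assoc, Category.assoc, hs, Category.comp_id])
  rw [reassoc_of% h₅] at g₁
  rw [h₅] at g₂
  simp only [Category.assoc, hs, Category.comp_id, reassoc_of% h₅] at g₃
  refine trivialFibration_of_exists_lift fun B A u w h => ?_
  -- The lift `w ≫ s` is correct over the base but on `A` it is only `u ≫ f ≫ s`. Pushing it along
  -- `G` on `A`, over the constant homotopy of `w`, corrects it.
  obtain ⟨l, l₁, l₂, l₃⟩ := hf.exists_lift_ι₀ A (w ≫ s) (u ▷ _ ≫ G)
    (by rw [SSet.ι₀_comp_assoc, g₁, reassoc_of% h]) (fst _ _ ≫ w)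
    (by rw [Category.assoc, hs, Category.comp_id]; rfl)
    (by rw [Category.assoc, g₃, whiskerRight_fst_assoc, whiskerRight_fst_assoc, h])
  refine ⟨SSet.ι₁ ≫ l, ?_, ?_⟩
  · rw [← SSet.ι₁_comp_assoc, l₂, SSet.ι₁_comp_assoc, g₂, Category.comp_id]
  · rw [Category.assoc, l₃, SSet.ι₁_fst_assoc]

end SimplicialSets

end RigidOperad

end

noncomputable section

namespace RigidOperad

/-! ### Saturation of weak equivalences, path spaces and mapping path fibrations -/

section WeakEquivalences

open scoped Simplicial
open SSet.modelCategoryQuillen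

lemma contractible_of_trivialFibration {S : SSet.{v}} (h : TrivialFibration (toUnit S)) :
    Contractible S :=
  ⟨kanComplex_of_kanFibration_toUnit h.kanFibration, h.weakHomotopyEquivalences⟩

/-- The contravariant functor of homotopy classes of maps to `Z`. -/
def homotopyClasses (Z : SSet.{v}) : SSet.{v} ⥤ (Type v)ᵒᵖ :=
  (MonoidalClosed.internalHom.flip.obj Z ⋙ SSet.π₀Functor).rightOp

lemma isIso_homotopyClasses_map_iff (Z : SSet.{v}) {S T : SSet.{v}} (f : S ⟶ T) :
    IsIso ((homotopyClasses Z).map f) ↔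
      Function.Bijective (SSet.mapπ₀ ((MonoidalClosed.pre f).app Z)) := by
  have : (homotopyClasses Z).map f =
      (TypeCat.ofHom (SSet.mapπ₀ ((MonoidalClosed.pre f).app Z))).op := rfl
  rw [this]
  exact (isIso_op_iff (TypeCat.ofHom (SSet.mapπ₀ ((MonoidalClosed.pre f).app Z)))).trans
    (isIso_iff_bijective _)

/-- The class is saturated: each functor of homotopy classes of maps to a Kan complex inverts weak
equivalences, hence factors through the localization, and together these functors detect weak
equivalences. -/
lemma weakHomotopyEquivalences_iff_isIso {S T : SSet.{v}} (f : S ⟶ T) :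
    weakHomotopyEquivalences f ↔ IsIso (toHoSpace.map f) := by
  refine ⟨fun h => Localization.inverts toHoSpace weakHomotopyEquivalences _ h, fun h Z _ => ?_⟩
  rw [← isIso_homotopyClasses_map_iff]
  have hZ : weakHomotopyEquivalences.{v}.IsInvertedBy (homotopyClasses Z) := fun _ _ g hg =>
    (isIso_homotopyClasses_map_iff Z g).2 (hg Z)
  have e := Localization.fac (homotopyClasses Z) hZ toHoSpace
  exact ((MorphismProperty.isomorphisms _).arrow_mk_iso_iff
    (((Functor.mapArrowFunctor _ _).mapIso e).app (Arrow.mk f))).1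
      (inferInstanceAs (IsIso ((Localization.lift _ hZ toHoSpace).map (toHoSpace.map f))))

instance : (weakHomotopyEquivalences.{v}).HasTwoOutOfThreeProperty := by
  have : weakHomotopyEquivalences.{v} =
      (MorphismProperty.isomorphisms _).inverseImage toHoSpace := by
    ext S T f
    exact weakHomotopyEquivalences_iff_isIso f
  rw [this]
  infer_instance

lemma TrivialFibration.of_isPullback {P Q R S : SSet.{v}} {t : P ⟶ Q} {l : P ⟶ R} {r : Q ⟶ S}
    {b : R ⟶ S} (sq : IsPullback t l r b) (hr : TrivialFibration r) : TrivialFibration l :=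
  MorphismProperty.of_isPullback (P := (MorphismProperty.monomorphisms SSet.{v}).rlp) sq hr

lemma boundary_one_bicartSq :
    SSet.Subcomplex.BicartSq ⊥ (SSet.stdSimplex.face.{v} {(1 : Fin 2)}ᶜ)
      (SSet.stdSimplex.face {(0 : Fin 2)}ᶜ) ∂Δ[1] where
  sup_eq := by
    rw [SSet.boundary_eq_iSup]
    refine le_antisymm (sup_le (le_iSup (fun i : Fin 2 => SSet.stdSimplex.face.{v} {i}ᶜ) 1)
      (le_iSup (fun i : Fin 2 => SSet.stdSimplex.face.{v} {i}ᶜ) 0)) (iSup_le fun i => ?_)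
    fin_cases i
    · exact le_sup_right
    · exact le_sup_left
  inf_eq := by
    rw [SSet.stdSimplex.face_inter_face, ← SSet.stdSimplex.face_empty]
    rfl

lemma exists_boundary_one_desc {Z : SSet.{v}} (z₀ z₁ : Δ[0] ⟶ Z) :
    ∃ u : (∂Δ[1] : SSet.{v}) ⟶ Z,
      SSet.boundary.ι 1 ≫ u = z₀ ∧ SSet.boundary.ι 0 ≫ u = z₁ := by
  have c (X : SSet.{v}) : X ⟶ Δ[0] := SSet.stdSimplex.isTerminalObj₀.from X
  have h := SSet.Subcomplex.isInitialBot.hom_ext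
    (SSet.Subcomplex.homOfLE boundary_one_bicartSq.{v}.le₁₂ ≫ c _ ≫ z₀)
    (SSet.Subcomplex.homOfLE boundary_one_bicartSq.{v}.le₁₃ ≫ c _ ≫ z₁)
  refine ⟨boundary_one_bicartSq.isPushout.desc (c _ ≫ z₀) (c _ ≫ z₁) h, ?_, ?_⟩
  · have := boundary_one_bicartSq.isPushout.inl_desc _ _ h
    have h' := (SSet.stdSimplex.faceSingletonComplIso (1 : Fin 2)).hom ≫= this
    rw [← Category.assoc, ← Category.assoc, SSet.stdSimplex.isTerminalObj₀.hom_ext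
      ((SSet.stdSimplex.faceSingletonComplIso (1 : Fin 2)).hom ≫ c _) (𝟙 _),
      Category.id_comp] at h'
    exact h'
  · have := boundary_one_bicartSq.isPushout.inr_desc _ _ h
    have h' := (SSet.stdSimplex.faceSingletonComplIso (0 : Fin 2)).hom ≫= this
    rw [← Category.assoc, ← Category.assoc, SSet.stdSimplex.isTerminalObj₀.hom_ext
      ((SSet.stdSimplex.faceSingletonComplIso (0 : Fin 2)).hom ≫ c _) (𝟙 _),
      Category.id_comp] at h'
    exact h'

/-- The homotopy extension property with given start and end, relative to an anodyne extension. -/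
lemma exists_homotopy_extension {R X : SSet.{v}} [SSet.KanComplex R] (A : X.Subcomplex)
    (hA : SSet.anodyneExtensions A.ι) (w : (A : SSet.{v}) ⊗ Δ[1] ⟶ R) (r₀ r₁ : X ⟶ R)
    (h₀ : SSet.ι₀ ≫ w = A.ι ≫ r₀) (h₁ : SSet.ι₁ ≫ w = A.ι ≫ r₁) :
    ∃ w' : X ⊗ Δ[1] ⟶ R, A.ι ▷ _ ≫ w' = w ∧ SSet.ι₀ ≫ w' = r₀ ∧ SSet.ι₁ ≫ w' = r₁ := by
  obtain ⟨u, u₀, u₁⟩ := exists_boundary_one_desc (MonoidalClosed.curry (fst X Δ[0] ≫ r₀))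
    (MonoidalClosed.curry (fst X Δ[0] ≫ r₁))
  have ext {Y : SSet.{v}} {f g : Y ⊗ (∂Δ[1] : SSet.{v}) ⟶ R}
      (h₀ : Y ◁ SSet.boundary.ι 1 ≫ f = Y ◁ SSet.boundary.ι 1 ≫ g)
      (h₁ : Y ◁ SSet.boundary.ι 0 ≫ f = Y ◁ SSet.boundary.ι 0 ≫ g) : f = g := by
    apply MonoidalClosed.curry_injective
    apply SSet.boundary.hom_ext
    intro i
    rw [← MonoidalClosed.curry_natural_left, ← MonoidalClosed.curry_natural_left]
    congr 1
    fin_cases i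
    · exact h₁
    · exact h₀
  have v₀ : X ◁ SSet.boundary.ι 1 ≫ MonoidalClosed.uncurry u = fst X Δ[0] ≫ r₀ := by
    rw [← MonoidalClosed.uncurry_natural_left, u₀, MonoidalClosed.uncurry_curry]
  have v₁ : X ◁ SSet.boundary.ι 0 ≫ MonoidalClosed.uncurry u = fst X Δ[0] ≫ r₁ := by
    rw [← MonoidalClosed.uncurry_natural_left, u₁, MonoidalClosed.uncurry_curry]
  have i₀ (Y : SSet.{v}) : Y ◁ SSet.boundary.ι 1 ≫ Y ◁ ∂Δ[1].ι = fst Y Δ[0] ≫ SSet.ι₀ := by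
    rw [← MonoidalCategory.whiskerLeft_comp, SSet.boundary.ι_ι,
      whiskerLeft_eq_fst_ι₀ _ SSet.stdSimplex.δ_one_eq_const]
  have i₁ (Y : SSet.{v}) : Y ◁ SSet.boundary.ι 0 ≫ Y ◁ ∂Δ[1].ι = fst Y Δ[0] ≫ SSet.ι₁ := by
    rw [← MonoidalCategory.whiskerLeft_comp, SSet.boundary.ι_ι,
      whiskerLeft_eq_fst_ι₁ _ SSet.stdSimplex.δ_zero_eq_const]
  -- The two prescribed ends form a map on `X ⊗ ∂Δ[1]`. This time `A.ι` is the anodyne factor of the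
  -- pushout product, so both ends can be fixed.
  obtain ⟨l, l₁, l₂, -⟩ := exists_lift_unionProd A ∂Δ[1] (toUnit R)
    (SSet.anodyneExtensions_unionProd_ι' A _ hA _ (kanFibration_toUnit R))
    (MonoidalClosed.uncurry u) w (ext
      (by rw [whisker_exchange_assoc, v₀, reassoc_of% i₀, h₀, whiskerRight_fst_assoc])
      (by rw [whisker_exchange_assoc, v₁, reassoc_of% i₁, h₁, whiskerRight_fst_assoc]))
    (toUnit _) (toUnit_unique _ _) (toUnit_unique _ _)
  refine ⟨l, l₂, ?_, ?_⟩
  · rw [← cancel_epi (fst X Δ[0]), ← v₀, ← l₁, reassoc_of% i₀]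
  · rw [← cancel_epi (fst X Δ[0]), ← v₁, ← l₁, reassoc_of% i₁]

/-- Families of paths correspond to homotopies. -/
def pathEquiv (X B : SSet.{v}) : (X ⊗ Δ[1] ⟶ B) ≃ (X ⟶ (ihom (Δ[1] : SSet.{v})).obj B) where
  toFun w := MonoidalClosed.curry ((β_ _ _).hom ≫ w)
  invFun g := (β_ _ _).hom ≫ MonoidalClosed.uncurry g
  left_inv w := by simp
  right_inv g := by simp

lemma ι₀_pathEquiv_symm {X B : SSet.{v}} (g : X ⟶ (ihom (Δ[1] : SSet.{v})).obj B) :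
    SSet.ι₀ ≫ (pathEquiv X B).symm g = g ≫ pathStart B := by
  rw [pathStart, ← SSet.ι₀_comp_assoc, BraidedCategory.braiding_naturality_left_assoc,
    ← MonoidalClosed.uncurry_eq]
  rfl

lemma ι₁_pathEquiv_symm {X B : SSet.{v}} (g : X ⟶ (ihom (Δ[1] : SSet.{v})).obj B) :
    SSet.ι₁ ≫ (pathEquiv X B).symm g = g ≫ pathEnd B := by
  rw [pathEnd, ← SSet.ι₁_comp_assoc, BraidedCategory.braiding_naturality_left_assoc,
    ← MonoidalClosed.uncurry_eq]
  rfl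

lemma pathEquiv_pathStart {X B : SSet.{v}} (w : X ⊗ Δ[1] ⟶ B) :
    pathEquiv X B w ≫ pathStart B = SSet.ι₀ ≫ w := by
  rw [← ι₀_pathEquiv_symm, Equiv.symm_apply_apply]

lemma pathEquiv_pathEnd {X B : SSet.{v}} (w : X ⊗ Δ[1] ⟶ B) :
    pathEquiv X B w ≫ pathEnd B = SSet.ι₁ ≫ w := by
  rw [← ι₁_pathEquiv_symm, Equiv.symm_apply_apply]

lemma pathEquiv_naturality {X X' B : SSet.{v}} (f : X' ⟶ X) (w : X ⊗ Δ[1] ⟶ B) :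
    pathEquiv X' B (f ▷ _ ≫ w) = f ≫ pathEquiv X B w := by
  simp only [pathEquiv, Equiv.coe_fn_mk]
  rw [← MonoidalClosed.curry_natural_left, BraidedCategory.braiding_naturality_right_assoc]

lemma pathEquiv_symm_naturality {X X' B : SSet.{v}} (f : X' ⟶ X)
    (g : X ⟶ (ihom (Δ[1] : SSet.{v})).obj B) :
    (pathEquiv X' B).symm (f ≫ g) = f ▷ _ ≫ (pathEquiv X B).symm g := by
  rw [Equiv.symm_apply_eq, pathEquiv_naturality, Equiv.apply_symm_apply]

/-- A lifting problem for `pathEnd` is a homotopy extension problem with prescribed end. -/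
lemma trivialFibration_pathEnd (R : SSet.{v}) [SSet.KanComplex R] :
    TrivialFibration (pathEnd R) := by
  refine trivialFibration_of_exists_lift fun X A u r h => ?_
  obtain ⟨l, l₁, l₂, -⟩ := (kanFibration_toUnit R).exists_lift_ι₁ A r ((pathEquiv _ _).symm u)
    (by rw [ι₁_pathEquiv_symm, h]) (toUnit _) (toUnit_unique _ _) (toUnit_unique _ _)
  exact ⟨pathEquiv _ _ l, by rw [← pathEquiv_naturality, l₂, Equiv.apply_symm_apply],
    by rw [pathEquiv_pathEnd, l₁]⟩

/-- The lifting property of the mapping path fibration of a weak equivalence between Kan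
complexes. -/
lemma exists_lift_mappingPath {P R : SSet.{v}} [SSet.KanComplex P] [SSet.KanComplex R]
    {f : P ⟶ R} (hf : weakHomotopyEquivalences f) {X : SSet.{v}} (A : X.Subcomplex)
    (u : (A : SSet.{v}) ⟶ P) (w : (A : SSet.{v}) ⊗ Δ[1] ⟶ R) (h : SSet.ι₁ ≫ w = u ≫ f)
    (r : X ⟶ R) (hr : SSet.ι₀ ≫ w = A.ι ≫ r) :
    ∃ (u' : X ⟶ P) (w' : X ⊗ Δ[1] ⟶ R), A.ι ≫ u' = u ∧ A.ι ▷ _ ≫ w' = w ∧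
      SSet.ι₁ ≫ w' = u' ≫ f ∧ SSet.ι₀ ≫ w' = r := by
  -- The mapping path fibration: a point of `P` with a path in `R` that ends at its image, sent to
  -- the start of the path. A horn is filled first in `P`, and then the homotopy is extended with
  -- both ends prescribed.
  let q : pullback f (pathEnd R) ⟶ R := pullback.snd _ _ ≫ pathStart R
  have hq : KanFibration q := by
    intro _ _ _ hi
    simp only [J, MorphismProperty.iSup_iff] at hi
    obtain ⟨m, ⟨k⟩⟩ := hi
    refine ⟨fun {t b} sq => ?_⟩
    obtain ⟨u', hu', -⟩ : ∃ u' : Δ[m + 1] ⟶ P, Λ[m + 1, k].ι ≫ u' = t ≫ pullback.fst _ _ ∧ True := by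
      obtain ⟨u', hu'⟩ := SSet.KanComplex.hornFilling (t ≫ pullback.fst _ _)
      exact ⟨u', hu'.symm, trivial⟩
    obtain ⟨w', h₁, h₂, h₃⟩ := exists_homotopy_extension Λ[m + 1, k]
      (SSet.anodyneExtensions.horn_ι k) ((pathEquiv _ _).symm (t ≫ pullback.snd _ _)) b (u' ≫ f)
      (by rw [ι₀_pathEquiv_symm, Category.assoc]; exact sq.w)
      (by rw [ι₁_pathEquiv_symm, Category.assoc, ← pullback.condition, reassoc_of% hu'])
    refine ⟨⟨⟨pullback.lift u' (pathEquiv _ _ w') (by rw [pathEquiv_pathEnd, h₃]), ?_, ?_⟩⟩⟩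
    · apply pullback.hom_ext
      · rw [Category.assoc, pullback.lift_fst, hu']
      · rw [Category.assoc, pullback.lift_snd, ← pathEquiv_naturality, h₁, Equiv.apply_symm_apply]
    · rw [pullback.lift_snd_assoc, pathEquiv_pathStart, h₂]
  -- The inclusion `c` of constant paths is a section of the trivial fibration `pullback.fst`, hence
  -- a weak equivalence. As `c ≫ q = f`, two out of three makes `q` a weak equivalence, and so a
  -- trivial fibration.
  let c : P ⟶ pullback f (pathEnd R) := pullback.lift (𝟙 P) (pathEquiv _ _ (fst _ _ ≫ f)) (by
    rw [pathEquiv_pathEnd, SSet.ι₁_fst_assoc, Category.id_comp])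
  have hfst : TrivialFibration (pullback.fst f (pathEnd R)) :=
    .of_isPullback (IsPullback.of_hasPullback f (pathEnd R)).flip (trivialFibration_pathEnd R)
  have hc : weakHomotopyEquivalences c := by
    refine weakHomotopyEquivalences.of_postcomp _ _ hfst.weakHomotopyEquivalences ?_
    rw [pullback.lift_fst, weakHomotopyEquivalences_iff_isIso]
    infer_instance
  have hcq : c ≫ q = f := by
    rw [pullback.lift_snd_assoc, pathEquiv_pathStart, SSet.ι₀_fst_assoc]
  have hq' : weakHomotopyEquivalences q :=
    weakHomotopyEquivalences.of_precomp _ _ hc (by rwa [hcq])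
  obtain ⟨l, l₁, l₂⟩ := (hq.trivialFibration hq').exists_lift A.ι
    (pullback.lift u (pathEquiv _ _ w) (by rw [pathEquiv_pathEnd, h])) r
    (by rw [pullback.lift_snd_assoc, pathEquiv_pathStart, hr])
  refine ⟨l ≫ pullback.fst _ _, (pathEquiv _ _).symm (l ≫ pullback.snd _ _), ?_, ?_, ?_, ?_⟩
  · rw [reassoc_of% l₁, pullback.lift_fst]
  · rw [← pathEquiv_symm_naturality, reassoc_of% l₁, pullback.lift_snd, Equiv.symm_apply_apply]
  · rw [ι₁_pathEquiv_symm, Category.assoc, Category.assoc, pullback.condition]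
  · rw [ι₀_pathEquiv_symm, Category.assoc]
    exact l₂

/-- The lifting property of the mapping path fibration of a weak equivalence, relative to a Kan
fibration. -/
lemma KanFibration.exists_lift_mappingPath {P Q R : SSet.{v}} [SSet.KanComplex P]
    [SSet.KanComplex R] {f : P ⟶ R} (hf : weakHomotopyEquivalences f) {g : Q ⟶ R}
    (hg : KanFibration g) {X : SSet.{v}} (A : X.Subcomplex)
    (u : (A : SSet.{v}) ⟶ P) (w : (A : SSet.{v}) ⊗ Δ[1] ⟶ Q) (h : SSet.ι₁ ≫ w ≫ g = u ≫ f)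
    (r : X ⟶ Q) (hr : SSet.ι₀ ≫ w = A.ι ≫ r) :
    ∃ (u' : X ⟶ P) (w' : X ⊗ Δ[1] ⟶ Q), A.ι ≫ u' = u ∧ A.ι ▷ _ ≫ w' = w ∧
      SSet.ι₁ ≫ w' ≫ g = u' ≫ f ∧ SSet.ι₀ ≫ w' = r := by
  -- The problem is solved in `R` first; the resulting homotopy is then lifted through `g` with
  -- start `r`, relative to `A`.
  obtain ⟨u', w', h₁, h₂, h₃, h₄⟩ := RigidOperad.exists_lift_mappingPath hf A u (w ≫ g) h (r ≫ g)
    (by rw [reassoc_of% hr])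
  obtain ⟨l, l₁, l₂, l₃⟩ := hg.exists_lift_ι₀ A r w hr w' h₄.symm h₂.symm
  exact ⟨u', l, h₁, l₂, by rw [l₃, h₃], l₁⟩

end WeakEquivalences

end RigidOperad

end

noncomputable section

namespace RigidOperad

/-! ### Splittings and symmetries of tensor powers -/

section Symmetries

variable {D : Type u} [Category.{v} D] [MonoidalCategory D]

/-- The identification of tensor powers with equal exponents. -/
def powCast (x : D) {m n : ℕ} (h : m = n) : pow x m ⟶ pow x n := eqToHom (congrArg (pow x) h)

@[simp]
lemma powCast_rfl (x : D) {m : ℕ} (h : m = m) : powCast x h = 𝟙 _ := rfl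

@[simp]
lemma powCast_trans (x : D) {m n k : ℕ} (h : m = n) (h' : n = k) :
    powCast x h ≫ powCast x h' = powCast x (h.trans h') := by
  subst h h'; simp

@[simp]
lemma powCast_trans_assoc (x : D) {m n k : ℕ} (h : m = n) (h' : n = k) {z : D} (f : pow x k ⟶ z) :
    powCast x h ≫ powCast x h' ≫ f = powCast x (h.trans h') ≫ f := by
  subst h h'; simp

lemma powCast_powMap {x y : D} (f : x ⟶ y) {m n : ℕ} (h : m = n) :
    powCast x h ≫ powMap f n = powMap f m ≫ powCast y h := by
  subst h; simp

/-- The tensor product of `x` with a map between tensor powers of `x`. -/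
def powCons {x : D} {m n : ℕ} (f : pow x m ⟶ pow x n) : pow x (m + 1) ⟶ pow x (n + 1) := x ◁ f

@[simp]
lemma powCons_id (x : D) (m : ℕ) : powCons (𝟙 (pow x m)) = 𝟙 _ := MonoidalCategory.whiskerLeft_id _ _

lemma powCons_comp {x : D} {m n k : ℕ} (f : pow x m ⟶ pow x n) (g : pow x n ⟶ pow x k) :
    powCons (f ≫ g) = powCons f ≫ powCons g :=
  MonoidalCategory.whiskerLeft_comp _ _ _

lemma powCons_powCast (x : D) {m n : ℕ} (h : m = n) :
    powCons (powCast x h) = powCast x (congrArg (· + 1) h) := by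
  subst h; simp

/-- The left unit isomorphism for tensor powers of `x`. -/
def powZeroAdd (x : D) (b : ℕ) : pow x b ⟶ pow x 0 ⊗ pow x b := (λ_ (pow x b)).inv

/-- The tensor product of `x` with a map that splits a tensor power of `x`. -/
def powConsAdd {x : D} {m a b : ℕ} (f : pow x m ⟶ pow x a ⊗ pow x b) :
    pow x (m + 1) ⟶ pow x (a + 1) ⊗ pow x b :=
  x ◁ f ≫ (α_ x (pow x a) (pow x b)).inv

lemma powAdd_zero_left (x : D) (b : ℕ) :
    powAdd x 0 b = powCast x (Nat.zero_add b) ≫ powZeroAdd x b := rfl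

lemma powAdd_succ (x : D) (a b : ℕ) :
    powAdd x (a + 1) b = powCast x (Nat.succ_add a b) ≫ powConsAdd (powAdd x a b) := rfl

instance (x : D) {m n : ℕ} (h : m = n) : IsIso (powCast x h) := by
  unfold powCast; infer_instance

instance isIso_powAdd (x : D) (a b : ℕ) : IsIso (powAdd x a b) := by
  induction a with
  | zero =>
    have : IsIso (powZeroAdd x b) := inferInstanceAs (IsIso (λ_ (pow x b)).inv)
    rw [powAdd_zero_left]
    infer_instance
  | succ a ih =>
    have : IsIso (powConsAdd (powAdd x a b)) :=
      inferInstanceAs (IsIso (x ◁ powAdd x a b ≫ (α_ x (pow x a) (pow x b)).inv))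
    rw [powAdd_succ]
    infer_instance

/-- The tensor product of maps between tensor powers of `x`. -/
def powSum {x : D} {a a' b b' : ℕ} (f : pow x a ⟶ pow x a') (g : pow x b ⟶ pow x b') :
    pow x (a + b) ⟶ pow x (a' + b') :=
  powAdd x a b ≫ (f ⊗ₘ g) ≫ inv (powAdd x a' b')

lemma powSum_comp_powAdd {x : D} {a a' b b' : ℕ} (f : pow x a ⟶ pow x a')
    (g : pow x b ⟶ pow x b') :
    powSum f g ≫ powAdd x a' b' = powAdd x a b ≫ (f ⊗ₘ g) := by
  simp [powSum]

lemma powSum_comp {x : D} {a a' a'' b b' b'' : ℕ} (f : pow x a ⟶ pow x a')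
    (g : pow x b ⟶ pow x b') (f' : pow x a' ⟶ pow x a'') (g' : pow x b' ⟶ pow x b'') :
    powSum (f ≫ f') (g ≫ g') = powSum f g ≫ powSum f' g' := by
  simp [powSum]

@[simp]
lemma powSum_id (x : D) (a b : ℕ) : powSum (𝟙 (pow x a)) (𝟙 (pow x b)) = 𝟙 _ := by
  simp [powSum]

/-- Together with `powSum_powCons` this computes `powSum` by recursion on the left factor. -/
lemma powSum_zero_left (x : D) {b b' : ℕ} (g : pow x b ⟶ pow x b') :
    powSum (𝟙 (pow x 0)) g = powCast x (Nat.zero_add b) ≫ g ≫ powCast x (Nat.zero_add b').symm := by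
  have h : g ≫ powZeroAdd x b' = powZeroAdd x b ≫ pow x 0 ◁ g :=
    MonoidalCategory.leftUnitor_inv_naturality g
  rw [← cancel_mono (powAdd x 0 b'), powSum_comp_powAdd, powAdd_zero_left, powAdd_zero_left]
  simp only [Category.assoc, powCast_trans_assoc, powCast_rfl, Category.id_comp, id_tensorHom, h]

lemma powSum_powCons {x : D} {a a' b b' : ℕ} (f : pow x a ⟶ pow x a') (g : pow x b ⟶ pow x b') :
    powSum (powCons f) g = powCast x (Nat.succ_add a b) ≫ powCons (powSum f g) ≫
      powCast x (Nat.succ_add a' b').symm := by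
  have h : x ◁ powSum f g ≫ x ◁ powAdd x a' b' = x ◁ powAdd x a b ≫ x ◁ (f ⊗ₘ g) := by
    rw [← MonoidalCategory.whiskerLeft_comp, powSum_comp_powAdd,
      MonoidalCategory.whiskerLeft_comp]
  have h' : (x ◁ powAdd x a b ≫ (α_ _ _ _).inv) ≫ (x ◁ f ⊗ₘ g) =
      x ◁ powSum f g ≫ x ◁ powAdd x a' b' ≫ (α_ _ _ _).inv := by
    rw [reassoc_of% h, ← id_tensorHom x f, Category.assoc,
      ← MonoidalCategory.associator_inv_naturality, id_tensorHom]
  have h'' : powConsAdd (powAdd x a b) ≫ (powCons f ⊗ₘ g) =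
      powCons (powSum f g) ≫ powConsAdd (powAdd x a' b') := h'
  rw [← cancel_mono (powAdd x (a' + 1) b'), powSum_comp_powAdd, powAdd_succ, powAdd_succ]
  simp only [Category.assoc, powCast_trans_assoc, powCast_rfl, Category.id_comp, h'']

lemma powSum_powCast_id (x : D) {a a' : ℕ} (b : ℕ) (h : a = a') :
    powSum (powCast x h) (𝟙 (pow x b)) = powCast x (congrArg (· + b) h) := by
  subst h; simp

lemma powConsAdd_powCast_comp {x : D} {m m' a b : ℕ} (h : m = m')
    (f : pow x m' ⟶ pow x a ⊗ pow x b) :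
    powConsAdd (powCast x h ≫ f) = powCast x (congrArg (· + 1) h) ≫ powConsAdd f := by
  subst h; simp

lemma powAdd_succ_succ (x : D) (a b : ℕ) :
    powAdd x (a + 2) b = powCast x (by omega) ≫ powConsAdd (powConsAdd (powAdd x a b)) := by
  rw [powAdd_succ, powAdd_succ, powConsAdd_powCast_comp, powCast_trans_assoc]

lemma powAdd_powCast_right (x : D) (a : ℕ) {b b' : ℕ} (h : b = b') :
    powCast x (congrArg (a + ·) h) ≫ powAdd x a b' = powAdd x a b ≫ pow x a ◁ powCast x h := by
  subst h; simp

lemma powCons_comp_powConsAdd {x : D} {m n a b : ℕ} (f : pow x m ⟶ pow x n)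
    (g : pow x n ⟶ pow x a ⊗ pow x b) :
    powCons f ≫ powConsAdd g = powConsAdd (f ≫ g) := by
  have h : x ◁ f ≫ x ◁ g ≫ (α_ x (pow x a) (pow x b)).inv = x ◁ (f ≫ g) ≫ (α_ _ _ _).inv := by
    simp
  exact h

variable [SymmetricCategory D]

/-- The symmetry of the first two factors of a triple tensor product. -/
def swapFirst (x y z : D) : x ⊗ y ⊗ z ⟶ y ⊗ x ⊗ z :=
  (α_ x y z).inv ≫ (β_ x y).hom ▷ z ≫ (α_ y x z).hom

lemma swapFirst_comp_swapFirst (x y z : D) : swapFirst x y z ≫ swapFirst y x z = 𝟙 _ := by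
  simp [swapFirst, ← comp_whiskerRight_assoc]

lemma swapFirst_naturality_right (x y : D) {z z' : D} (h : z ⟶ z') :
    swapFirst x y z ≫ y ◁ x ◁ h = x ◁ y ◁ h ≫ swapFirst x y z' := by
  simp only [swapFirst, Category.assoc, associator_inv_naturality_right_assoc,
    ← associator_naturality_right, whisker_exchange_assoc]

/-- The Yang–Baxter equation of the braiding, whiskered with `w`; the remaining discrepancy consists
of associators only. -/
lemma swapFirst_yang_baxter (x y z w : D) :
    swapFirst x y (z ⊗ w) ≫ y ◁ swapFirst x z w ≫ swapFirst y z (x ⊗ w) =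
      x ◁ swapFirst y z w ≫ swapFirst x z (y ⊗ w) ≫ z ◁ swapFirst x y w := by
  have h := congrArg (fun f => (𝟙 (x ⊗ y ⊗ z ⊗ w)) ⊗≫ f ▷ w ⊗≫ 𝟙 (z ⊗ y ⊗ x ⊗ w))
    (BraidedCategory.yang_baxter' x y z)
  calc _ = _ := by unfold swapFirst; monoidal
    _ = _ := h
    _ = _ := by unfold swapFirst; monoidal

lemma swapFirst_assoc_right (x y z w : D) :
    swapFirst x y (z ⊗ w) ≫ y ◁ (α_ x z w).inv ≫ (α_ y (x ⊗ z) w).inv =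
      x ◁ (α_ y z w).inv ≫ (α_ x (y ⊗ z) w).inv ≫ swapFirst x y z ▷ w := by
  unfold swapFirst
  monoidal

/-- This and `swapFirst_tensor_left` are the two hexagon identities, phrased for `swapFirst`. -/
lemma swapFirst_tensor_mid (x y z w : D) :
    x ◁ (α_ y z w).inv ≫ swapFirst x (y ⊗ z) w =
      swapFirst x y (z ⊗ w) ≫ y ◁ swapFirst x z w ≫ (α_ y z (x ⊗ w)).inv := by
  unfold swapFirst
  rw [BraidedCategory.braiding_tensor_right_hom]
  monoidal

lemma swapFirst_tensor_left (x y z w : D) :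
    swapFirst (x ⊗ y) z w =
      (α_ x y (z ⊗ w)).hom ≫ x ◁ swapFirst y z w ≫ swapFirst x z (y ⊗ w) ≫
        z ◁ (α_ x y w).inv := by
  unfold swapFirst
  rw [BraidedCategory.braiding_tensor_left_hom]
  monoidal

lemma swapFirst_unit_left (z w : D) :
    swapFirst (𝟙_ D) z w = (λ_ (z ⊗ w)).hom ≫ z ◁ (λ_ w).inv := by
  unfold swapFirst
  rw [braiding_tensorUnit_left]
  monoidal

lemma swapFirst_unit_mid (x w : D) :
    x ◁ (λ_ w).inv ≫ swapFirst x (𝟙_ D) w = (λ_ (x ⊗ w)).inv := by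
  unfold swapFirst
  rw [braiding_tensorUnit_right]
  monoidal

/-- The exchange of the first two factors. -/
def powSwap₀ (x : D) (k : ℕ) : pow x (k + 2) ⟶ pow x (k + 2) := powSwap x (k + 2) 0

@[simp]
lemma powSwap₀_comp_self (x : D) (k : ℕ) : powSwap₀ x k ≫ powSwap₀ x k = 𝟙 _ :=
  swapFirst_comp_swapFirst x x (pow x k)

lemma powSwap₀_naturality {x : D} {m n : ℕ} (f : pow x m ⟶ pow x n) :
    powSwap₀ x m ≫ powCons (powCons f) = powCons (powCons f) ≫ powSwap₀ x n :=
  swapFirst_naturality_right x x f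

lemma powSwap₀_yang_baxter (x : D) (k : ℕ) :
    powSwap₀ x (k + 1) ≫ powCons (powSwap₀ x k) ≫ powSwap₀ x (k + 1) =
      powCons (powSwap₀ x k) ≫ powSwap₀ x (k + 1) ≫ powCons (powSwap₀ x k) :=
  swapFirst_yang_baxter x x x (pow x k)

lemma powSwap₀_comp_powConsAdd {x : D} {m a b : ℕ} (f : pow x m ⟶ pow x a ⊗ pow x b) :
    powSwap₀ x m ≫ powConsAdd (powConsAdd f) = powConsAdd (powConsAdd f) ≫ powSwap₀ x a ▷ _ := by
  have h : swapFirst x x (pow x m) ≫ x ◁ (x ◁ f ≫ (α_ x (pow x a) (pow x b)).inv) ≫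
      (α_ x (x ⊗ pow x a) (pow x b)).inv = (x ◁ (x ◁ f ≫ (α_ x (pow x a) (pow x b)).inv) ≫
      (α_ x (x ⊗ pow x a) (pow x b)).inv) ≫ swapFirst x x (pow x a) ▷ _ := by
    simp only [MonoidalCategory.whiskerLeft_comp, Category.assoc, ← swapFirst_assoc_right]
    rw [reassoc_of% swapFirst_naturality_right x x f]
  exact h

lemma powSum_powSwap₀ (x : D) (a b : ℕ) :
    powSum (powSwap₀ x a) (𝟙 (pow x b)) = powCast x (by omega) ≫ powSwap₀ x (a + b) ≫
      powCast x (by omega) := by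
  rw [← cancel_mono (powAdd x (a + 2) b), powSum_comp_powAdd, powAdd_succ_succ]
  simp only [Category.assoc, powCast_trans_assoc, powCast_rfl, Category.id_comp, tensorHom_id,
    powSwap₀_comp_powConsAdd]

/-- The tensor product of `x` with a map that splits a tensor power of `x`, where the factor `x`
goes to the second part. -/
def powConsAddRight {x : D} {m a b : ℕ} (f : pow x m ⟶ pow x a ⊗ pow x b) :
    pow x (m + 1) ⟶ pow x a ⊗ pow x (b + 1) :=
  x ◁ f ≫ swapFirst x (pow x a) (pow x b)

lemma powConsAddRight_powCast_comp {x : D} {m m' a b : ℕ} (h : m = m')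
    (f : pow x m' ⟶ pow x a ⊗ pow x b) :
    powConsAddRight (powCast x h ≫ f) = powCast x (congrArg (· + 1) h) ≫ powConsAddRight f := by
  subst h; simp

lemma powConsAddRight_powAdd_zero (x : D) (c : ℕ) :
    powConsAddRight (powAdd x 0 c) = powCast x (by omega) ≫ powAdd x 0 (c + 1) := by
  have h : powConsAddRight (powZeroAdd x c) = powZeroAdd x (c + 1) :=
    swapFirst_unit_mid x (pow x c)
  rw [powAdd_zero_left, powAdd_zero_left, powConsAddRight_powCast_comp, h, powCast_trans_assoc]

/-- By a hexagon, a factor passes a block by first passing the front factor of the block and then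
the rest of it. -/
lemma powConsAddRight_powConsAdd {x : D} {m a b : ℕ} (f : pow x m ⟶ pow x a ⊗ pow x b) :
    powConsAddRight (powConsAdd f) = powSwap₀ x m ≫ powConsAdd (powConsAddRight f) := by
  have h : x ◁ (x ◁ f ≫ (α_ x (pow x a) (pow x b)).inv) ≫ swapFirst x (x ⊗ pow x a) (pow x b) =
      swapFirst x x (pow x m) ≫ x ◁ (x ◁ f ≫ swapFirst x (pow x a) (pow x b)) ≫
        (α_ x (pow x a) (x ⊗ pow x b)).inv := by
    simp only [MonoidalCategory.whiskerLeft_comp, Category.assoc, swapFirst_tensor_mid]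
    rw [reassoc_of% swapFirst_naturality_right x x f]
  exact h

lemma powCons_comp_powConsAddRight {x : D} {m n a b : ℕ} (f : pow x m ⟶ pow x n)
    (g : pow x n ⟶ pow x a ⊗ pow x b) :
    powCons f ≫ powConsAddRight g = powConsAddRight (f ≫ g) := by
  have h : x ◁ f ≫ x ◁ g ≫ swapFirst x (pow x a) (pow x b) = x ◁ (f ≫ g) ≫ swapFirst _ _ _ := by
    simp
  exact h

/-- The inductive step for exchanging blocks: if `c` factors are known to pass `a` factors by
`swapFirst`, so do `c + 1` factors, by the hexagon `swapFirst_tensor_left`. -/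
lemma powConsAddRight_whiskerLeft {x : D} {m a b c d e : ℕ} (f : pow x m ⟶ pow x a ⊗ pow x b)
    (g : pow x b ⟶ pow x c ⊗ pow x d) (h : pow x m ⟶ pow x c ⊗ pow x e)
    (k : pow x e ⟶ pow x a ⊗ pow x d)
    (H : f ≫ pow x a ◁ g = h ≫ pow x c ◁ k ≫ swapFirst (pow x c) (pow x a) (pow x d)) :
    powConsAddRight f ≫ pow x a ◁ powConsAdd g =
      powConsAdd h ≫ pow x (c + 1) ◁ k ≫ swapFirst (pow x (c + 1)) (pow x a) (pow x d) := by
  have H' : (x ◁ f ≫ swapFirst x (pow x a) (pow x b)) ≫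
      pow x a ◁ (x ◁ g ≫ (α_ x (pow x c) (pow x d)).inv) =
      (x ◁ h ≫ (α_ _ _ _).inv) ≫ (x ⊗ pow x c) ◁ k ≫
        swapFirst (x ⊗ pow x c) (pow x a) (pow x d) := by
    rw [swapFirst_tensor_left, Category.assoc, Category.assoc,
      ← associator_inv_naturality_right_assoc, Iso.inv_hom_id_assoc,
      MonoidalCategory.whiskerLeft_comp, reassoc_of% swapFirst_naturality_right,
      ← MonoidalCategory.whiskerLeft_comp_assoc, H]
    simp only [MonoidalCategory.whiskerLeft_comp_assoc]
  exact H'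

end Symmetries

/-! ### Coherence for symmetries with labelled factors -/

section Structural

variable {D : Type u} [Category.{v} D] [MonoidalCategory D] [SymmetricCategory D]

/-- The symmetries between tensor powers whose factors are labelled by lists, generated by the
exchange of adjacent factors. -/
inductive Symm (x : D) {L : Type} :
    (l l' : List L) → {m n : ℕ} → (pow x m ⟶ pow x n) → Prop
  | cast (l) {m n} (hm : l.length = m) (hmn : m = n) : Symm x l l (powCast x hmn)
  | cons (a) {l l'} {m n : ℕ} {f : pow x m ⟶ pow x n} : Symm x l l' f →
      Symm x (a :: l) (a :: l') (powCons f)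
  | swap (a b l) {m : ℕ} (hm : l.length = m) : Symm x (a :: b :: l) (b :: a :: l) (powSwap₀ x m)
  | trans {l l' l''} {m n k : ℕ} {f : pow x m ⟶ pow x n} {g : pow x n ⟶ pow x k} :
      Symm x l l' f → Symm x l' l'' g → Symm x l l'' (f ≫ g)

/-- The symmetry that moves a factor with label `b` to the front. -/
inductive Symm.Extract (x : D) {L : Type} (b : L) :
    (l l' : List L) → {m n : ℕ} → (pow x m ⟶ pow x (n + 1)) → Prop
  | head (l) {m n : ℕ} (hn : l.length = n) (hm : m = n + 1) : Symm.Extract x b (b :: l) l (powCast x hm)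
  | tail (a) {l l'} {m n : ℕ} {f : pow x m ⟶ pow x (n + 1)} : Symm.Extract x b l l' f →
      Symm.Extract x b (a :: l) (a :: l') (powCons f ≫ powSwap₀ x n)

namespace Symm

variable {x : D} {L : Type} {l l' l'' : List L} {m n k : ℕ} {f : pow x m ⟶ pow x n}

lemma refl (h : l.length = m) : Symm x l l (𝟙 (pow x m)) := .cast l h rfl

lemma perm (h : Symm x l l' f) : l.Perm l' := by
  induction h with
  | cast l => exact .refl l
  | cons a _ ih => exact ih.cons a
  | swap a b l => exact .swap b a l
  | trans _ _ ih ih' => exact ih.trans ih'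

lemma length_left (h : Symm x l l' f) : l.length = m := by
  induction h with
  | cast l hm => exact hm
  | cons a _ ih => simp [ih]
  | swap a b l hm => simp [hm]
  | trans _ _ ih ih' => exact ih

lemma length_right (h : Symm x l l' f) : l'.length = n := by
  induction h with
  | cast l hm hmn => exact hm.trans hmn
  | cons a _ ih => simp [ih]
  | swap a b l hm => simp [hm]
  | trans _ _ ih ih' => exact ih'

lemma eq_nat (h : Symm x l l' f) : m = n := by
  rw [← h.length_left, ← h.length_right, h.perm.length_eq]

lemma exists_of_perm (x : D) (h : l.Perm l') (hm : l.length = m) (hn : l'.length = n) :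
    ∃ f : pow x m ⟶ pow x n, Symm x l l' f := by
  induction h generalizing m n with
  | nil => exact ⟨_, .cast _ hm (hm.symm.trans hn)⟩
  | cons a _ ih =>
    subst hm hn
    exact ⟨_, .cons a (ih rfl rfl).choose_spec⟩
  | swap a b l =>
    subst hm hn
    exact ⟨_, .swap b a l rfl⟩
  | trans _ _ ih ih' => exact ⟨_, .trans (ih hm rfl).choose_spec (ih' rfl hn).choose_spec⟩

lemma map {L' : Type} (g : L → L') (h : Symm x l l' f) : Symm x (l.map g) (l'.map g) f := by
  induction h with
  | cast l hm hmn => exact .cast _ (by simpa using hm) hmn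
  | cons a _ ih => exact ih.cons (g a)
  | swap a b l hm => exact .swap (g a) (g b) (l.map g) (by simpa using hm)
  | trans _ _ ih ih' => exact ih.trans ih'

lemma Extract.perm {b : L} {f : pow x m ⟶ pow x (n + 1)} (h : Extract x b l l' f) :
    l.Perm (b :: l') := by
  induction h with
  | head l => exact .refl _
  | tail a _ ih => exact (ih.cons a).trans (.swap b a _)

lemma Extract.length {b : L} {f : pow x m ⟶ pow x (n + 1)} (h : Extract x b l l' f) :
    l'.length = n := by
  induction h with
  | head l hn => exact hn
  | tail a _ ih => simp [ih]

/-- The key to coherence: a symmetry followed by an extraction of `b` can be rewritten as an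
extraction of `b` followed by a symmetry of the remaining factors. For an exchange of the first two
factors the three cases are trivial, the involutivity of the exchange, and naturality with
Yang–Baxter. -/
lemma exists_extract (h : Symm x l l' f) {b : L} {l₁' : List L} {g : pow x n ⟶ pow x (k + 1)}
    (hg : Extract x b l' l₁' g) :
    ∃ (l₁ : List L) (g' : pow x m ⟶ pow x (k + 1)) (f' : pow x k ⟶ pow x k),
      Extract x b l l₁ g' ∧ Symm x l₁ l₁' f' ∧ f ≫ g = g' ≫ powCons f' := by
  induction h generalizing l₁' k with
  | cast l hm hmn =>
    subst hmn
    exact ⟨_, _, _, hg, .refl hg.length, by simp⟩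
  | @cons a l l' m n f h ih =>
    cases hg with
    | head _ hn hm =>
      obtain rfl : n = k := by simpa using hm
      obtain rfl := h.eq_nat
      exact ⟨_, _, _, .head _ h.length_left rfl, h, by simp⟩
    | @tail _ _ _ _ k g₀ hg =>
      obtain ⟨l₁, g', f', h₁, h₂, h₃⟩ := ih hg
      refine ⟨_, _, _, .tail a h₁, .cons a h₂, ?_⟩
      rw [← Category.assoc, ← powCons_comp, h₃, powCons_comp, Category.assoc, Category.assoc,
        powSwap₀_naturality]
  | @swap a c l m hm =>
    cases hg with
    | head _ hn hm' =>
      obtain rfl : m + 1 = k := by simpa using hm'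
      refine ⟨_, _, _, .tail a (.head _ hm rfl), .refl (by simpa), ?_⟩
      simp
    | @tail _ _ _ _ k g₀ hg =>
      cases hg with
      | head _ hn hm' =>
        obtain rfl : m = k := by simpa using hm'
        refine ⟨_, _, _, .head _ (by simpa) rfl, .refl (by simpa), ?_⟩
        simp
      | @tail _ _ _ _ k g₁ hg =>
        refine ⟨_, _, _, .tail _ (.tail _ hg), .swap _ _ _ hg.length, ?_⟩
        rw [powCons_comp]
        simp only [Category.assoc]
        rw [reassoc_of% powSwap₀_naturality g₁, powSwap₀_yang_baxter]
  | trans _ _ ih ih' =>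
    obtain ⟨l₁, g', f', h₁, h₂, h₃⟩ := ih' hg
    obtain ⟨l₂, g'', f'', h₁', h₂', h₃'⟩ := ih h₁
    refine ⟨_, _, _, h₁', .trans h₂' h₂, ?_⟩
    rw [Category.assoc, h₃, reassoc_of% h₃', powCons_comp]

/-- A repeated label could be extracted from several positions; distinctness leaves only one. -/
lemma Extract.unique {b : L} {g g' : pow x m ⟶ pow x (n + 1)} (hl : l.Nodup)
    (h : Extract x b l l' g) (h' : Extract x b l l'' g') : l' = l'' ∧ g = g' := by
  induction h generalizing l'' with
  | head l hn hm =>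
    cases h' with
    | head => exact ⟨rfl, rfl⟩
    | tail _ h' => exact absurd (h'.perm.symm.subset List.mem_cons_self) (List.nodup_cons.1 hl).1
  | tail a h ih =>
    cases h' with
    | head => exact absurd (h.perm.symm.subset List.mem_cons_self) (List.nodup_cons.1 hl).1
    | tail _ h' =>
      obtain ⟨rfl, rfl⟩ := ih (List.nodup_cons.1 hl).2 h'
      exact ⟨rfl, rfl⟩

lemma eq_powCast_of_nil (h : Symm x l l' f) (hl : l = []) (hm : m = n) : f = powCast x hm := by
  induction h with
  | cast => rfl
  | cons => simp at hl
  | swap => simp at hl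
  | trans h h' ih ih' =>
    subst hl
    rw [ih rfl h.eq_nat, ih' (List.nil_perm.1 h.perm) h'.eq_nat, powCast_trans]

/-- Coherence: a symmetry is determined by its effect on labels, if these are distinct. -/
theorem unique (hl : l.Nodup) {f g : pow x m ⟶ pow x n} (hf : Symm x l l' f)
    (hg : Symm x l l' g) : f = g := by
  induction l' generalizing l m n with
  | nil =>
    obtain rfl := List.perm_nil.1 hf.perm
    rw [hf.eq_powCast_of_nil rfl hf.eq_nat, hg.eq_powCast_of_nil rfl hf.eq_nat]
  | cons b l₁ ih =>
    obtain rfl : l₁.length + 1 = n := hf.length_right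
    -- The head `b` of the target list is pulled to the front in both symmetries. The extractions
    -- agree because the labels are distinct, and the symmetries of the remaining factors agree by
    -- induction.
    obtain ⟨l₂, g₂, f₂, h₁, h₂, h₃⟩ := hf.exists_extract (.head (b := b) l₁ rfl rfl)
    obtain ⟨l₃, g₃, f₃, h₁', h₂', h₃'⟩ := hg.exists_extract (.head (b := b) l₁ rfl rfl)
    obtain ⟨rfl, rfl⟩ := h₁.unique hl h₁'
    obtain rfl := ih (List.nodup_cons.1 (h₁.perm.nodup hl)).2 h₂ h₂'
    rw [powCast_rfl, Category.comp_id] at h₃ h₃'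
    rw [h₃, h₃']

lemma append_left {A : List L} {a : ℕ} (hA : A.length = a) (h : Symm x l l' f) :
    Symm x (A ++ l) (A ++ l') (powSum (𝟙 (pow x a)) f) := by
  induction A generalizing a with
  | nil =>
    subst hA
    rw [List.length_nil, powSum_zero_left]
    exact (Symm.cast _ (by simpa using h.length_left) _).trans
      (h.trans (.cast _ (by simpa using h.length_right) _))
  | cons b A ih =>
    subst hA
    rw [List.length_cons, ← powCons_id, powSum_powCons]
    have := (ih rfl).cons b
    exact (Symm.cast _ (by have := h.length_left; simp; omega) _).trans
      (this.trans (.cast _ (by have := h.length_right; simp; omega) _))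

lemma append_right {B : List L} {b : ℕ} (hB : B.length = b) (h : Symm x l l' f) :
    Symm x (l ++ B) (l' ++ B) (powSum f (𝟙 (pow x b))) := by
  subst hB
  induction h with
  | cast l hm hmn =>
    rw [powSum_powCast_id]
    exact .cast _ (by simpa) _
  | cons a h ih =>
    rw [powSum_powCons]
    exact (Symm.cast _ (by have := h.length_left; simp; omega) _).trans
      ((ih.cons a).trans (.cast _ (by have := h.length_right; simp; omega) _))
  | @swap a c l m hm =>
    rw [powSum_powSwap₀]
    exact (Symm.cast _ (by simp; omega) _).trans
      ((Symm.swap a c _ (by simp; omega)).trans (.cast _ (by simp; omega) _))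
  | trans h h' ih ih' =>
    rw [← Category.comp_id (𝟙 (pow x B.length)), powSum_comp]
    exact ih.trans ih'

lemma append {l₁ l₁' : List L} {m₁ n₁ : ℕ} {f₁ : pow x m₁ ⟶ pow x n₁} (h : Symm x l l' f)
    (h₁ : Symm x l₁ l₁' f₁) : Symm x (l ++ l₁) (l' ++ l₁') (powSum f f₁) := by
  rw [← Category.comp_id f, ← Category.id_comp f₁, powSum_comp]
  exact (h.append_right h₁.length_left).trans (h₁.append_left h.length_right)

/-- Moving one factor step by step across the block `B` is, after splitting the power, a single use
of the braiding with the whole block. -/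
lemma exists_cons_append (x : D) (t : L) (B C : List L) {b c : ℕ} (hB : B.length = b)
    (hC : C.length = c) :
    ∃ ψ : pow x (b + c + 1) ⟶ pow x (b + (c + 1)), Symm x (t :: (B ++ C)) (B ++ t :: C) ψ ∧
      ψ ≫ powAdd x b (c + 1) = powConsAddRight (powAdd x b c) := by
  induction B generalizing b with
  | nil =>
    obtain rfl : b = 0 := by simpa using hB.symm
    exact ⟨powCast x (by omega), .cast _ (by simpa) _, (powConsAddRight_powAdd_zero x c).symm⟩
  | cons u B ih =>
    obtain rfl : b = B.length + 1 := by simpa using hB.symm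
    obtain ⟨ψ, h₁, h₂⟩ := ih rfl
    refine ⟨powCast x (by omega) ≫ powSwap₀ x (B.length + c) ≫ powCons ψ ≫
      powCast x (by omega), (Symm.cast _ (by simp; omega) _).trans
      ((Symm.swap t u _ (by simp; omega)).trans
      ((h₁.cons u).trans (.cast _ (by simp; omega) _))), ?_⟩
    rw [powAdd_succ, powAdd_succ, powConsAddRight_powCast_comp,
      powConsAddRight_powConsAdd, ← h₂]
    simp only [Category.assoc, powCast_trans_assoc, powCast_rfl, Category.id_comp,
      powCons_comp_powConsAdd]

/-- The exchange of two adjacent blocks of factors. -/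
lemma exists_block_swap (x : D) (A B C : List L) {a b c : ℕ} (hA : A.length = a)
    (hB : B.length = b) (hC : C.length = c) :
    ∃ ψ : pow x (a + (b + c)) ⟶ pow x (b + (a + c)), Symm x (A ++ (B ++ C)) (B ++ (A ++ C)) ψ ∧
      ψ ≫ powAdd x b (a + c) ≫ pow x b ◁ powAdd x a c =
        powAdd x a (b + c) ≫ pow x a ◁ powAdd x b c ≫ swapFirst (pow x a) (pow x b) (pow x c) := by
  induction A generalizing a with
  | nil =>
    obtain rfl : a = 0 := by simpa using hA.symm
    refine ⟨powCast x (by omega), .cast _ (by simp; omega) _, ?_⟩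
    have h : powZeroAdd x (b + c) ≫ pow x 0 ◁ powAdd x b c ≫
        swapFirst (pow x 0) (pow x b) (pow x c) = powAdd x b c ≫ pow x b ◁ powZeroAdd x c := by
      have : (λ_ (pow x (b + c))).inv ≫ 𝟙_ D ◁ powAdd x b c ≫
          swapFirst (𝟙_ D) (pow x b) (pow x c) = powAdd x b c ≫ pow x b ◁ (λ_ (pow x c)).inv := by
        rw [swapFirst_unit_left, ← MonoidalCategory.leftUnitor_inv_naturality_assoc,
          Iso.inv_hom_id_assoc]
      exact this
    have h' := powAdd_powCast_right x b (Nat.zero_add c)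
    rw [powAdd_zero_left, powAdd_zero_left, Category.assoc, h,
      MonoidalCategory.whiskerLeft_comp, ← reassoc_of% h', powCast_trans_assoc]
  | cons u A ih =>
    obtain rfl : a = A.length + 1 := by simpa using hA.symm
    obtain ⟨ψ, h₁, h₂⟩ := ih rfl
    -- The tail of the first block passes `B` by induction; `χ` then lets its head `u` pass `B`.
    obtain ⟨χ, h₃, h₄⟩ := exists_cons_append x u B (A ++ C) hB
      (c := A.length + c) (by simp [hC])
    refine ⟨powCast x (by omega) ≫ powCons ψ ≫ χ ≫ powCast x (by omega),
      (Symm.cast _ (by simp; omega) _).trans ((h₁.cons u).trans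
      (h₃.trans (.cast _ (by simp; omega) _))), ?_⟩
    have h₅ := powAdd_powCast_right x b (Nat.succ_add A.length c)
    have h₆ : powAdd x (A.length + 1) c = powCast x (Nat.succ_add A.length c) ≫
      powConsAdd (powAdd x A.length c) := powAdd_succ x _ _
    have h₇ := powConsAddRight_whiskerLeft (ψ ≫ powAdd x b (A.length + c)) (powAdd x A.length c)
      (powAdd x A.length (b + c)) (powAdd x b c) (by rw [Category.assoc, h₂])
    have h₈ : powAdd x (A.length + 1) (b + c) = powCast x (Nat.succ_add _ _) ≫
      powConsAdd (powAdd x A.length (b + c)) := powAdd_succ x _ _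
    rw [h₆, h₈, MonoidalCategory.whiskerLeft_comp, ← reassoc_of% h₅]
    simp only [Category.assoc, powCast_trans_assoc, powCast_rfl, Category.id_comp]
    rw [reassoc_of% h₄, ← h₇, ← powCons_comp_powConsAddRight]
    simp only [Category.assoc]

end Symm

end Structural
end RigidOperad

end

noncomputable section

namespace RigidOperad

/-! ### Composition of simplices of mapping spaces -/

section Simplices

variable {D : Type u} [Category.{v} D] [SimplicialCategory D] {n : SimplexCategoryᵒᵖ}

lemma sComp_assoc {x y z w : D} (f : (Map x y).obj n) (g : (Map y z).obj n)
    (h : (Map z w).obj n) : sComp (sComp f g) h = sComp f (sComp g h) :=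
  (ConcreteCategory.congr_hom
    (NatTrans.congr_app (EnrichedCategory.assoc (V := SSet.{v}) x y z w) n) ⟨f, g, h⟩ :)

lemma sOf_comp {x y z : D} (f : x ⟶ y) (g : y ⟶ z) (n : SimplexCategoryᵒᵖ) :
    sOf (f ≫ g) n = sComp (sOf f n) (sOf g n) := by
  have := ConcreteCategory.congr_hom (NatTrans.congr_app (eHomEquiv_comp SSet.{v} f g) n) PUnit.unit
  exact this

@[simp]
lemma sOf_id_sComp {x y : D} (f : (Map x y).obj n) : sComp (sOf (𝟙 x) n) f = f := by
  have := ConcreteCategory.congr_hom (NatTrans.congr_app (EnrichedCategory.id_comp (V := SSet.{v}) x y) n) f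
  unfold sOf
  rw [eHomEquiv_id]
  exact this

@[simp]
lemma sComp_sOf_id {x y : D} (f : (Map x y).obj n) : sComp f (sOf (𝟙 y) n) = f := by
  have := ConcreteCategory.congr_hom (NatTrans.congr_app (EnrichedCategory.comp_id (V := SSet.{v}) x y) n) f
  unfold sOf
  rw [eHomEquiv_id]
  exact this

lemma sOf_comp_sComp {x y z w : D} (f : x ⟶ y) (g : y ⟶ z) (h : (Map z w).obj n) :
    sComp (sOf (f ≫ g) n) h = sComp (sOf f n) (sComp (sOf g n) h) := by
  rw [sOf_comp, sComp_assoc]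

lemma sComp_sOf_sOf {x y z w : D} (h : (Map x y).obj n) (f : y ⟶ z) (g : z ⟶ w) :
    sComp (sComp h (sOf f n)) (sOf g n) = sComp h (sOf (f ≫ g) n) := by
  rw [sOf_comp, sComp_assoc]

end Simplices

/-! ### Associativity and unit laws of the splittings of tensor powers -/

section PowAdd

variable {D : Type u} [Category.{v} D] [MonoidalCategory D]

lemma powAdd_powCast_left (x : D) {a a' : ℕ} (b : ℕ) (h : a = a') :
    powCast x (congrArg (· + b) h) ≫ powAdd x a' b = powAdd x a b ≫ powCast x h ▷ pow x b := by
  subst h; simp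

lemma powZeroAdd_naturality {x : D} {b c d : ℕ} (f : pow x b ⟶ pow x c ⊗ pow x d) :
    powZeroAdd x b ≫ pow x 0 ◁ f ≫ (α_ _ _ _).inv = f ≫ powZeroAdd x c ▷ pow x d := by
  have h : (λ_ _).inv ≫ 𝟙_ D ◁ f ≫ (α_ _ _ _).inv = f ≫ (λ_ (pow x c)).inv ▷ pow x d := by
    rw [← MonoidalCategory.leftUnitor_inv_naturality_assoc]
    simp
  exact h

lemma powConsAdd_assoc {x : D} {m m' a b c d : ℕ} (f : pow x m ⟶ pow x a ⊗ pow x b)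
    (g : pow x b ⟶ pow x c ⊗ pow x d) (f' : pow x m ⟶ pow x m' ⊗ pow x d)
    (g' : pow x m' ⟶ pow x a ⊗ pow x c)
    (h : f ≫ pow x a ◁ g ≫ (α_ _ _ _).inv = f' ≫ g' ▷ pow x d) :
    powConsAdd f ≫ pow x (a + 1) ◁ g ≫ (α_ _ _ _).inv =
      powConsAdd f' ≫ powConsAdd g' ▷ pow x d := by
  have h' : (x ◁ f ≫ (α_ _ _ _).inv) ≫ (x ⊗ pow x a) ◁ g ≫ (α_ _ _ _).inv =
      (x ◁ f' ≫ (α_ _ _ _).inv) ≫ (x ◁ g' ≫ (α_ _ _ _).inv) ▷ pow x d := by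
    have h₁ := congrArg (fun k => x ◁ k ≫ (α_ _ _ _).inv ≫ (α_ _ _ _).inv ▷ pow x d) h
    simp only [MonoidalCategory.whiskerLeft_comp, Category.assoc] at h₁
    simp only [Category.assoc, comp_whiskerRight, ← associator_inv_naturality_right_assoc]
    rw [← associator_inv_naturality_middle_assoc, ← h₁]
    simp
  exact h'

/-- The splittings of tensor powers are associative. -/
lemma powAdd_assoc (x : D) (a b c : ℕ) :
    powAdd x a (b + c) ≫ pow x a ◁ powAdd x b c ≫ (α_ _ _ _).inv =
      powCast x (Nat.add_assoc a b c).symm ≫ powAdd x (a + b) c ≫ powAdd x a b ▷ pow x c := by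
  induction a with
  | zero =>
    rw [powAdd_zero_left, powAdd_zero_left, Category.assoc, powZeroAdd_naturality,
      comp_whiskerRight, ← reassoc_of% powAdd_powCast_left x c (Nat.zero_add b),
      powCast_trans_assoc]
  | succ a ih =>
    rw [powAdd_succ x a (b + c), powAdd_succ x a b, comp_whiskerRight,
      ← reassoc_of% powAdd_powCast_left x c (Nat.succ_add a b), Category.assoc,
      powConsAdd_assoc _ _ (powCast x (Nat.add_assoc a b c).symm ≫ powAdd x (a + b) c)
        (powAdd x a b) (by rw [ih, Category.assoc])]
    rw [powConsAdd_powCast_comp, powAdd_succ]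
    simp only [Category.assoc, powCast_trans_assoc]

/-- The canonical isomorphism `x^{⊗ 1} ⟶ x`. -/
def powOne (x : D) : pow x 1 ⟶ x := (ρ_ x).hom

/-- This and `powAdd_zero_right` are the degenerate splittings behind the two unit laws of the
endomorphism operad. -/
lemma powAdd_one_left (x : D) (a : ℕ) :
    powAdd x 1 a ≫ (powOne x ⊗ₘ 𝟙 _) = powCast x (Nat.add_comm 1 a) := by
  have h : powConsAdd (powZeroAdd x a) ≫ (powOne x ⊗ₘ 𝟙 _) = 𝟙 (pow x (a + 1)) := by
    have : (x ◁ (λ_ (pow x a)).inv ≫ (α_ _ _ _).inv) ≫ ((ρ_ x).hom ⊗ₘ 𝟙 (pow x a)) = 𝟙 _ := by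
      simp
    exact this
  rw [powAdd_succ, powAdd_zero_left, powConsAdd_powCast_comp, powCast_trans_assoc, Category.assoc]
  refine (congrArg _ h).trans ?_
  exact Category.comp_id _

lemma powAdd_zero_right (x : D) (m : ℕ) : powAdd x m 0 ≫ (ρ_ (pow x m)).hom = 𝟙 _ := by
  induction m with
  | zero =>
    have : (λ_ (𝟙_ D)).inv ≫ (ρ_ (𝟙_ D)).hom = 𝟙 _ := by
      rw [← unitors_equal, Iso.inv_hom_id]
    refine Eq.trans ?_ this
    rw [powAdd_zero_left, powCast_rfl, Category.id_comp]
    rfl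
  | succ m ih =>
    have h {a b : D} (f : a ⟶ b ⊗ 𝟙_ D) :
        (x ◁ f ≫ (α_ x b (𝟙_ D)).inv) ≫ (ρ_ (x ⊗ b)).hom = x ◁ (f ≫ (ρ_ b).hom) := by
      rw [Category.assoc, rightUnitor_tensor_hom, Iso.inv_hom_id_assoc,
        ← MonoidalCategory.whiskerLeft_comp]
    rw [powAdd_succ, powCast_rfl, Category.id_comp]
    exact (h _).trans ((congrArg (x ◁ ·) ih).trans (MonoidalCategory.whiskerLeft_id _ _))

end PowAdd

/-! ### Tensor products of simplices in blocks -/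

section Blocks

variable {D : Type u} [Category.{v} D] [MonoidalCategory D] [SymmetricCategory D]
  [SimplicialCategory D] [SimplicialSymmetricMonoidal D] {n : SimplexCategoryᵒᵖ}

open SimplicialSymmetricMonoidal

lemma sTensor_sComp_right {x y x' y' z' : D} (f : (Map x y).obj n) (f' : (Map x' y').obj n)
    (g' : (Map y' z').obj n) :
    sTensor f (sComp f' g') = sComp (sTensor f f') (sTensor (sOf (𝟙 y) n) g') := by
  rw [← sTensor_sComp, sComp_sOf_id]

lemma sTensor_sComp_left {x y z x' y' : D} (f : (Map x y).obj n) (g : (Map y z).obj n)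
    (f' : (Map x' y').obj n) :
    sTensor (sComp f g) f' = sComp (sTensor f (sOf (𝟙 x') n)) (sTensor g f') := by
  rw [← sTensor_sComp, sOf_id_sComp]

lemma associator_inv_natural {x y x' y' x'' y'' : D} (f : (Map x y).obj n)
    (f' : (Map x' y').obj n) (f'' : (Map x'' y'').obj n) :
    sComp (sTensor f (sTensor f' f'')) (sOf (α_ y y' y'').inv n) =
      sComp (sOf (α_ x x' x'').inv n) (sTensor (sTensor f f') f'') := by
  have h := congrArg (fun g => sComp (sOf (α_ x x' x'').inv n) (sComp g (sOf (α_ y y' y'').inv n)))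
    (associator_natural f f' f'')
  simp only [sComp_assoc, ← sOf_comp_sComp, ← sOf_comp, Iso.hom_inv_id, Iso.inv_hom_id,
    sComp_sOf_id, sOf_id_sComp] at h
  exact h.symm

lemma leftUnitor_inv_natural {x y : D} (f : (Map x y).obj n) :
    sComp f (sOf (λ_ y).inv n) = sComp (sOf (λ_ x).inv n) (sTensor (sOf (𝟙 (𝟙_ D)) n) f) := by
  have h := congrArg (fun g => sComp (sOf (λ_ x).inv n) (sComp g (sOf (λ_ y).inv n)))
    (leftUnitor_natural f)
  simp only [sComp_assoc, ← sOf_comp_sComp, ← sOf_comp, Iso.hom_inv_id, Iso.inv_hom_id,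
    sComp_sOf_id, sOf_id_sComp] at h
  exact h.symm

lemma swapFirst_natural {x y x' y' x'' y'' : D} (f : (Map x y).obj n)
    (f' : (Map x' y').obj n) (f'' : (Map x'' y'').obj n) :
    sComp (sTensor f (sTensor f' f'')) (sOf (swapFirst y y' y'') n) =
      sComp (sOf (swapFirst x x' x'') n) (sTensor f' (sTensor f f'')) := by
  have h := congrArg (fun g => sTensor g f'') (braiding_natural f f')
  have h' := sTensor_sComp (sTensor f f') (sOf (β_ y y').hom n) f'' (sOf (𝟙 y'') n)
  rw [sComp_sOf_id, sTensor_sOf, tensorHom_id] at h'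
  have h'' := sTensor_sComp_left (sOf (β_ x x').hom n) (sTensor f' f) f''
  rw [sTensor_sOf, tensorHom_id] at h''
  rw [h', h''] at h
  rw [swapFirst, swapFirst, sOf_comp_sComp, sOf_comp_sComp, ← associator_natural, sOf_comp,
    ← sComp_assoc, associator_inv_natural, sOf_comp, sComp_assoc]
  congr 1
  rw [← sComp_assoc, h, sComp_assoc]

variable {x : D}

/-- The tensor product of a simplex of `Map(a, x)` and a simplex of `Map(b, x^{⊗ k})`. -/
def sTensorCons {a b : D} {k : ℕ} (q : (Map a x).obj n) (g : (Map b (pow x k)).obj n) :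
    (Map (a ⊗ b) (pow x (k + 1))).obj n :=
  sTensor q g

lemma sTensor_sTensorCons {a a' b b' : D} {k : ℕ} (f : (Map a' a).obj n) (f' : (Map b' b).obj n)
    (q : (Map a x).obj n) (g : (Map b (pow x k)).obj n) :
    sComp (sTensor f f') (sTensorCons q g) = sTensorCons (sComp f q) (sComp f' g) :=
  (sTensor_sComp f q f' g).symm

lemma sOf_sTensorCons {a a' b b' : D} {k : ℕ} (f : a' ⟶ a) (f' : b' ⟶ b)
    (q : (Map a x).obj n) (g : (Map b (pow x k)).obj n) :
    sComp (sOf (f ⊗ₘ f') n) (sTensorCons q g) =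
      sTensorCons (sComp (sOf f n) q) (sComp (sOf f' n) g) := by
  rw [← sTensor_sTensorCons, sTensor_sOf]

lemma sTensorCons_powCons {a b : D} {k k' : ℕ} (q : (Map a x).obj n)
    (g : (Map b (pow x k)).obj n) (φ : pow x k ⟶ pow x k') :
    sComp (sTensorCons q g) (sOf (powCons φ) n) = sTensorCons q (sComp g (sOf φ n)) := by
  have h := sTensor_sComp_right q g (sOf φ n)
  rw [sTensor_sOf, id_tensorHom] at h
  exact h.symm

lemma sTensorCons_swap {a b c : D} {k : ℕ} (q : (Map a x).obj n) (q' : (Map b x).obj n)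
    (g : (Map c (pow x k)).obj n) :
    sComp (sTensorCons q (sTensorCons q' g)) (sOf (powSwap₀ x k) n) =
      sComp (sOf (swapFirst a b c) n) (sTensorCons q' (sTensorCons q g)) :=
  swapFirst_natural q q' g

lemma sTensorCons_sTensor {a b c : D} {k l : ℕ} (q : (Map a x).obj n)
    (g : (Map b (pow x k)).obj n) (h : (Map c (pow x l)).obj n) {m : ℕ}
    (f : pow x m ⟶ pow x k ⊗ pow x l) [IsIso f] :
    sComp (sTensorCons q (sComp (sTensor g h) (sOf (inv f) n))) (sOf (powConsAdd f) n) =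
      sComp (sOf (α_ a b c).inv n) (sTensor (sTensorCons q g) h) := by
  have h₁ := sTensor_sComp_right q (sTensor g h) (sOf (inv f) n)
  rw [sTensor_sOf, id_tensorHom] at h₁
  have h₂ : sComp (sTensor q (sComp (sTensor g h) (sOf (inv f) n)))
      (sOf (x ◁ f ≫ (α_ _ _ _).inv) n) =
      sComp (sOf (α_ a b c).inv n) (sTensor (sTensor q g) h) := by
    rw [h₁, sComp_sOf_sOf, ← MonoidalCategory.whiskerLeft_comp_assoc, IsIso.inv_hom_id,
      MonoidalCategory.whiskerLeft_id, Category.id_comp, associator_inv_natural]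
  exact h₂

/-- The tensor product of a simplex of `Map(x^{⊗ m}, x)` and a simplex of
`Map(x^{⊗ a}, x^{⊗ k})`. -/
def blockCons {m a k : ℕ} (q : (Map (pow x m) x).obj n) (g : (Map (pow x a) (pow x k)).obj n) :
    (Map (pow x (m + a)) (pow x (k + 1))).obj n :=
  sComp (sOf (powAdd x m a) n) (sTensorCons q g)

lemma powSum_blockCons {m m' a a' k : ℕ} (φ : pow x m ⟶ pow x m') (ψ : pow x a ⟶ pow x a')
    (q : (Map (pow x m') x).obj n) (g : (Map (pow x a') (pow x k)).obj n) :
    sComp (sOf (powSum φ ψ) n) (blockCons q g) =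
      blockCons (sComp (sOf φ n) q) (sComp (sOf ψ n) g) := by
  rw [blockCons, ← sOf_comp_sComp, powSum_comp_powAdd, sOf_comp_sComp, blockCons, sOf_sTensorCons]

lemma blockCons_powCons {m a k k' : ℕ} (q : (Map (pow x m) x).obj n)
    (g : (Map (pow x a) (pow x k)).obj n) (φ : pow x k ⟶ pow x k') :
    sComp (blockCons q g) (sOf (powCons φ) n) = blockCons q (sComp g (sOf φ n)) := by
  rw [blockCons, blockCons, sComp_assoc, sTensorCons_powCons]

lemma blockCons_blockCons {b c d k : ℕ} (q : (Map (pow x b) x).obj n)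
    (q' : (Map (pow x c) x).obj n) (g : (Map (pow x d) (pow x k)).obj n) :
    blockCons q (blockCons q' g) =
      sComp (sOf (powAdd x b (c + d) ≫ pow x b ◁ powAdd x c d) n)
        (sTensorCons q (sTensorCons q' g)) := by
  rw [sOf_comp_sComp, ← id_tensorHom, sOf_sTensorCons, sOf_id_sComp, blockCons, blockCons]

/-- By simplicial naturality of the symmetry, exchanging two outputs amounts to exchanging their
blocks of inputs. The map `ψ` is the one provided by `Symm.exists_block_swap`. -/
lemma blockCons_swap {m m' a k : ℕ} (q : (Map (pow x m) x).obj n) (q' : (Map (pow x m') x).obj n)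
    (g : (Map (pow x a) (pow x k)).obj n) (ψ : pow x (m + (m' + a)) ⟶ pow x (m' + (m + a)))
    (hψ : ψ ≫ powAdd x m' (m + a) ≫ pow x m' ◁ powAdd x m a = powAdd x m (m' + a) ≫
      pow x m ◁ powAdd x m' a ≫ swapFirst (pow x m) (pow x m') (pow x a)) :
    sComp (sOf ψ n) (blockCons q' (blockCons q g)) =
      sComp (blockCons q (blockCons q' g)) (sOf (powSwap₀ x k) n) := by
  rw [blockCons_blockCons, blockCons_blockCons, ← sOf_comp_sComp, hψ, sComp_assoc,
    sTensorCons_swap, ← sOf_comp_sComp, Category.assoc]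

/-- The tensor product of simplices of mapping spaces between tensor powers. -/
def sSum {a a' b b' : ℕ} (f : (Map (pow x a) (pow x a')).obj n)
    (g : (Map (pow x b) (pow x b')).obj n) : (Map (pow x (a + b)) (pow x (a' + b'))).obj n :=
  sComp (sOf (powAdd x a b) n) (sComp (sTensor f g) (sOf (inv (powAdd x a' b')) n))

lemma sSum_blockCons {a a' b b' k : ℕ} (f : (Map (pow x a) (pow x a')).obj n)
    (g : (Map (pow x b) (pow x b')).obj n) (q : (Map (pow x a') x).obj n)
    (h : (Map (pow x b') (pow x k)).obj n) :
    sComp (sSum f g) (blockCons q h) = blockCons (sComp f q) (sComp g h) := by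
  rw [sSum, blockCons, blockCons, sComp_assoc, sComp_assoc, ← sOf_comp_sComp, IsIso.inv_hom_id,
    sOf_id_sComp, sTensor_sTensorCons]

lemma sSum_zero_left {b b' : ℕ} (g : (Map (pow x b) (pow x b')).obj n) :
    sSum (sOf (𝟙 (pow x 0)) n) g = sComp (sOf (powCast x (Nat.zero_add b)) n)
      (sComp g (sOf (powCast x (Nat.zero_add b').symm) n)) := by
  have h : sComp (sOf (powZeroAdd x b) n) (sTensor (sOf (𝟙 (pow x 0)) n) g) =
    sComp g (sOf (powZeroAdd x b') n) := (leftUnitor_inv_natural g).symm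
  rw [sSum, powAdd_zero_left, sOf_comp_sComp, ← sComp_assoc (sOf (powZeroAdd x b) n), h,
    sComp_assoc, ← sOf_comp]
  congr 4
  rw [← cancel_mono (powAdd x 0 b')]
  simp [powAdd_zero_left]

/-- Associativity of the tensor product of blocks, deduced from `powAdd_assoc`; it is the inductive
step of `blockMap_append`. -/
lemma sSum_blockCons_left {m a k b b' : ℕ} (q : (Map (pow x m) x).obj n)
    (g : (Map (pow x a) (pow x k)).obj n) (h : (Map (pow x b) (pow x b')).obj n) :
    sSum (blockCons q g) h = sComp (sOf (powCast x (Nat.add_assoc m a b)) n)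
      (sComp (blockCons q (sSum g h)) (sOf (powCast x (Nat.succ_add k b').symm) n)) := by
  have h₁ := sTensor_sComp (sOf (powAdd x m a) n) (sTensorCons q g) (sOf (𝟙 (pow x b)) n) h
  rw [sTensor_sOf, sOf_id_sComp, tensorHom_id] at h₁
  have h₂ : IsIso (powConsAdd (powAdd x k b')) := by
    have := powAdd_succ x k b'
    exact IsIso.of_isIso_fac_left this.symm
  have h₃ : inv (powAdd x (k + 1) b') =
      inv (powConsAdd (powAdd x k b')) ≫ powCast x (Nat.succ_add k b').symm := by
    rw [← cancel_mono (powAdd x (k + 1) b')]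
    simp [powAdd_succ]
  have h₄ : blockCons q (sSum g h) = sComp (sOf (powAdd x m (a + b) ≫ pow x m ◁ powAdd x a b) n)
      (sTensorCons q (sComp (sTensor g h) (sOf (inv (powAdd x k b')) n))) := by
    rw [blockCons, sSum, sOf_comp_sComp, ← id_tensorHom, sOf_sTensorCons, sOf_id_sComp]
  have h₅ := sTensorCons_sTensor q g h (powAdd x k b')
  have h₆ : sComp (blockCons q (sSum g h)) (sOf (powConsAdd (powAdd x k b')) n) =
      sComp (sOf (powCast x (Nat.add_assoc m a b).symm ≫ powAdd x (m + a) b) n)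
        (sTensor (blockCons q g) h) := by
    rw [h₄, sComp_assoc, h₅, ← sOf_comp_sComp, Category.assoc, powAdd_assoc, ← Category.assoc,
      sOf_comp_sComp, blockCons, h₁]
  have h₇ : blockCons q (sSum g h) =
      sComp (sOf (powCast x (Nat.add_assoc m a b).symm ≫ powAdd x (m + a) b) n)
        (sComp (sTensor (blockCons q g) h) (sOf (inv (powConsAdd (powAdd x k b'))) n)) := by
    rw [← sComp_assoc, ← h₆, sComp_sOf_sOf, IsIso.hom_inv_id, sComp_sOf_id]
  rw [sSum, h₃, h₇, sComp_assoc, ← sOf_comp_sComp, powCast_trans_assoc, powCast_rfl,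
    Category.id_comp, sComp_sOf_sOf]

/-- The tensor product of simplices `q t` of `Map(x^{⊗ m t}, x)`, for `t` in a list. -/
def blockMap {T : Type} {m : T → ℕ} (q : ∀ t, (Map (pow x (m t)) x).obj n) :
    (l : List T) → {a k : ℕ} → (l.map m).sum = a → l.length = k →
      (Map (pow x a) (pow x k)).obj n
  | [], _, _, ha, hk => sOf (powCast x (ha.symm.trans hk)) n
  | t :: l, _, _, ha, hk =>
    sComp (sOf (powCast x (ha.symm.trans List.sum_cons)) n)
      (sComp (blockCons (q t) (blockMap q l rfl rfl)) (sOf (powCast x hk) n))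

lemma sum_map_flatMap {T U : Type} (l : List T) (r : T → List U) (w : U → ℕ) :
    ((l.flatMap r).map w).sum = (l.map fun t => ((r t).map w).sum).sum := by
  induction l with
  | nil => rfl
  | cons t l ih => simp [ih]

section

variable {T : Type} {m : T → ℕ} (q : ∀ t, (Map (pow x (m t)) x).obj n)

lemma blockMap_nil {a : ℕ} (ha : (([] : List T).map m).sum = a) (hk : ([] : List T).length = a) :
    blockMap q [] ha hk = sOf (𝟙 (pow x a)) n := rfl

lemma blockMap_cons {a a' k : ℕ} (t : T) (l : List T) (ha : (l.map m).sum = a) (hk : l.length = k)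
    (h : m t + a = a') :
    blockMap q (t :: l) (a := a') (k := k + 1) (by simp [ha, h]) (by simp [hk]) =
      sComp (sOf (powCast x h.symm) n) (blockCons (q t) (blockMap q l ha hk)) := by
  subst ha hk
  exact congrArg _ (sComp_sOf_id _)

lemma powCast_blockMap {a a' k : ℕ} (l : List T) (ha : (l.map m).sum = a) (hk : l.length = k)
    (h : a' = a) :
    sComp (sOf (powCast x h) n) (blockMap q l ha hk) = blockMap q l (ha.trans h.symm) hk := by
  subst h
  simp

lemma blockMap_powCast {a k k' : ℕ} (l : List T) (ha : (l.map m).sum = a) (hk : l.length = k)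
    (h : k = k') :
    sComp (blockMap q l ha hk) (sOf (powCast x h) n) = blockMap q l ha (hk.trans h) := by
  subst h
  simp

lemma blockMap_map {U : Type} (e : U → T) (l : List U) {a k : ℕ}
    (ha : ((l.map e).map m).sum = a) (hk : (l.map e).length = k) :
    blockMap q (l.map e) ha hk = blockMap (fun u => q (e u)) l (m := fun u => m (e u))
      (by rw [← ha, List.map_map]; rfl) (by simpa using hk) := by
  induction l generalizing a k with
  | nil => rfl
  | cons u l ih =>
    have h : ((l.map e).map m).sum = (l.map fun u => m (e u)).sum := by rw [List.map_map]; rfl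
    obtain rfl : m (e u) + (l.map fun u => m (e u)).sum = a := by rw [← h]; simpa using ha
    obtain rfl : l.length + 1 = k := by simpa using hk
    have e₁ := blockMap_cons q (e u) (l.map e) h (List.length_map e) rfl
    have e₂ := blockMap_cons (m := fun u => m (e u)) (fun u => q (e u)) u l rfl rfl rfl
    exact e₁.trans ((congrArg (fun f => sComp _ (blockCons _ f)) (ih h _)).trans e₂.symm)

/-- Symmetries of the factors of each block. -/
lemma exists_symm_inner {m' : T → ℕ} (q' : ∀ t, (Map (pow x (m' t)) x).obj n) {L : Type}
    (r r' : T → List L) (φ : ∀ t, pow x (m t) ⟶ pow x (m' t))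
    (hφ : ∀ t, Symm x (r t) (r' t) (φ t)) (hq : ∀ t, q t = sComp (sOf (φ t) n) (q' t))
    (l : List T) {a a' k : ℕ} (ha : (l.map m).sum = a) (ha' : (l.map m').sum = a')
    (hk : l.length = k) :
    ∃ ψ : pow x a ⟶ pow x a', Symm x (l.flatMap r) (l.flatMap r') ψ ∧
      blockMap q l ha hk = sComp (sOf ψ n) (blockMap q' l ha' hk) := by
  induction l generalizing a a' k with
  | nil =>
    obtain rfl : a = a' := ha.symm.trans ha'
    exact ⟨𝟙 _, .refl (by simpa using ha), by simp; rfl⟩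
  | cons t l ih =>
    obtain ⟨ψ, h₁, h₂⟩ := ih rfl rfl rfl
    obtain rfl : _ = k := hk
    obtain rfl : _ = a := List.sum_cons.symm.trans ha
    obtain rfl : _ = a' := List.sum_cons.symm.trans ha'
    refine ⟨powSum (φ t) ψ, (hφ t).append h₁, ?_⟩
    have e₁ := blockMap_cons q t l rfl rfl rfl
    have e₂ := blockMap_cons q' t l rfl rfl rfl
    rw [powCast_rfl, sOf_id_sComp] at e₁ e₂
    refine e₁.trans ((Eq.trans ?_ (powSum_blockCons (φ t) ψ (q' t) _).symm).trans
      (congrArg (sComp _) e₂.symm))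
    rw [h₂, hq]

/-- Symmetries of the blocks. -/
lemma exists_symm_outer {L : Type} (r : T → List L) (hr : ∀ t, (r t).length = m t) {l l' : List T}
    {k k' : ℕ} {φ : pow x k ⟶ pow x k'} (h : Symm x l l' φ) {a a' : ℕ} (ha : (l.map m).sum = a)
    (ha' : (l'.map m).sum = a') :
    ∃ ψ : pow x a ⟶ pow x a', Symm x (l.flatMap r) (l'.flatMap r) ψ ∧
      sComp (blockMap q l ha h.length_left) (sOf φ n) =
        sComp (sOf ψ n) (blockMap q l' ha' h.length_right) := by
  have hr' (l : List T) : (l.flatMap r).length = (l.map m).sum := by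
    simp [List.length_flatMap, hr]
  induction h generalizing a a' with
  | cast l hk hkk' =>
    subst hkk'
    obtain rfl : a = a' := ha.symm.trans ha'
    exact ⟨𝟙 _, .refl ((hr' l).trans ha), by simp⟩
  | @cons t l l' k k' φ h ih =>
    obtain ⟨ψ, h₁, h₂⟩ := ih rfl rfl
    obtain rfl : _ = a := List.sum_cons.symm.trans ha
    obtain rfl : _ = a' := List.sum_cons.symm.trans ha'
    refine ⟨powSum (𝟙 _) ψ, h₁.append_left (hr t), ?_⟩
    have e₁ := blockMap_cons q t l rfl h.length_left rfl
    have e₂ := blockMap_cons q t l' rfl h.length_right rfl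
    rw [powCast_rfl, sOf_id_sComp] at e₁ e₂
    refine (congrArg (fun f => sComp f _) e₁).trans (Eq.trans ?_ (congrArg (sComp _) e₂.symm))
    rw [powSum_blockCons, blockCons_powCons, h₂, sOf_id_sComp]
  | @swap t t' l k hk =>
    -- The exchange of the outputs `t` and `t'` is matched by the exchange of the whole blocks `r t`
    -- and `r t'` of inputs.
    obtain ⟨ψ, h₁, h₂⟩ := Symm.exists_block_swap x (r t) (r t') (l.flatMap r) (hr t) (hr t') (hr' l)
    obtain rfl : m t + (m t' + (l.map m).sum) = a := by simpa using ha
    obtain rfl : m t' + (m t + (l.map m).sum) = a' := by simpa using ha'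
    refine ⟨ψ, h₁, ?_⟩
    have e₁ := blockMap_cons q t (t' :: l) (k := k + 1) List.sum_cons (by simpa) rfl
    have e₁' := blockMap_cons q t' l rfl hk rfl
    have e₂ := blockMap_cons q t' (t :: l) (k := k + 1) List.sum_cons (by simpa) rfl
    have e₂' := blockMap_cons q t l rfl hk rfl
    rw [powCast_rfl, sOf_id_sComp] at e₁ e₂ e₁' e₂'
    rw [e₁'] at e₁
    rw [e₂'] at e₂
    exact (congrArg (fun f => sComp f _) e₁).trans
      ((blockCons_swap _ _ _ ψ h₂).symm.trans (congrArg (sComp _) e₂.symm))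
  | @trans l l' l'' k k' k'' φ φ' h h' ih ih' =>
    obtain ⟨ψ, h₁, h₂⟩ := ih ha rfl
    obtain ⟨ψ', h₁', h₂'⟩ := ih' rfl ha'
    refine ⟨_, h₁.trans h₁', ?_⟩
    rw [sOf_comp, ← sComp_assoc, h₂, sComp_assoc, h₂', ← sOf_comp_sComp]

lemma blockMap_append (l l' : List T) {a a' b k k' j : ℕ} (ha : (l.map m).sum = a)
    (ha' : (l'.map m).sum = a') (hb : ((l ++ l').map m).sum = b) (hk : l.length = k)
    (hk' : l'.length = k') (hj : (l ++ l').length = j) :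
    blockMap q (l ++ l') hb hj =
      sComp (sOf (powCast x (by simp [← hb, ← ha, ← ha'])) n)
        (sComp (sSum (blockMap q l ha hk) (blockMap q l' ha' hk'))
          (sOf (powCast x (by simp [← hj, ← hk, ← hk'])) n)) := by
  induction l generalizing a b k j with
  | nil =>
    obtain rfl : 0 = a := by simpa using ha
    obtain rfl : 0 = k := by simpa using hk
    rw [blockMap_nil, sSum_zero_left, blockMap_powCast, powCast_blockMap, blockMap_powCast,
      powCast_blockMap]
    rfl
  | cons t l ih =>
    obtain rfl : m t + (l.map m).sum = a := by simpa using ha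
    obtain rfl : l.length + 1 = k := by simpa using hk
    obtain rfl : m t + ((l.map m).sum + a') = b := by simpa [ha', add_assoc] using hb
    obtain rfl : l.length + k' + 1 = j := by rw [← hj, ← hk']; simp; try omega
    have e₁ := blockMap_cons q t (l ++ l') (a := (l.map m).sum + a') (k := l.length + k')
      (by simp [ha']) (by simp [hk']) rfl
    have e₂ := blockMap_cons q t l rfl rfl rfl
    rw [powCast_rfl, sOf_id_sComp] at e₁ e₂
    rw [e₂, sSum_blockCons_left]
    refine e₁.trans ?_
    rw [ih rfl (by simp [ha']) rfl (by simp [hk'])]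
    simp [sComp_assoc, ← sOf_comp, ← sOf_comp_sComp]

/-- Composition of operations in blocks is associative. -/
lemma blockMap_flatMap {U : Type} {w : U → ℕ} (p : ∀ u, (Map (pow x (w u)) x).obj n)
    (r : T → List U) (hr : ∀ t, (r t).length = m t) (l : List T) {a b k : ℕ}
    (ha : ((l.flatMap r).map w).sum = a) (hb : (l.flatMap r).length = b) (hb' : (l.map m).sum = b)
    (hk : l.length = k) :
    sComp (blockMap p (l.flatMap r) ha hb) (blockMap q l hb' hk) =
      blockMap (m := fun t => ((r t).map w).sum)
        (fun t => sComp (blockMap p (r t) rfl (hr t)) (q t)) l (by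
          rw [← ha, ← sum_map_flatMap]) hk := by
  induction l generalizing a b k with
  | nil =>
    obtain rfl : a = b := ha.symm.trans hb
    obtain rfl : a = k := ha.symm.trans hk
    simp [blockMap_nil]
  | cons t l ih =>
    obtain rfl : m t + (l.map m).sum = b := by simpa using hb'
    obtain rfl : l.length + 1 = k := by simpa using hk
    obtain rfl : ((r t).map w).sum + ((l.flatMap r).map w).sum = a := by simpa using ha
    have hl : (l.flatMap r).length = (l.map m).sum := by simp [List.length_flatMap, hr]
    -- The operations with index in `r t` are split off, so that `sSum_blockCons` composes them with
    -- `q t` separately from the others.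
    have e₁ := blockMap_append p (r t) (l.flatMap r) rfl rfl
      (b := ((r t).map w).sum + ((l.flatMap r).map w).sum) (j := m t + (l.map m).sum)
      (by simp) (hr t) hl (by simp [hr, hl])
    have e₂ := blockMap_cons q t l rfl rfl rfl
    have e₃ := blockMap_cons (m := fun t => ((r t).map w).sum)
        (fun t => sComp (blockMap p (r t) rfl (hr t)) (q t)) t l
        (by rw [← sum_map_flatMap]) rfl rfl
    rw [powCast_rfl, sOf_id_sComp] at e₂ e₃
    rw [powCast_rfl, powCast_rfl, sOf_id_sComp, sComp_sOf_id] at e₁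
    refine (congrArg₂ sComp e₁ e₂).trans (Eq.trans ?_ e₃.symm)
    rw [sSum_blockCons, ih]

/-- This gives the right unit law of the endomorphism operad; `blockMap_singleton` gives the left
one. -/
lemma blockMap_powOne (l : List T) {a k : ℕ} (ha : (l.map fun _ => 1).sum = a)
    (hk : l.length = k) :
    blockMap (fun _ : T => sOf (powOne x) n) l ha hk =
      sOf (powCast x (by rw [← ha, ← hk]; simp)) n := by
  induction l generalizing a k with
  | nil => rfl
  | cons t l ih =>
    obtain rfl : 1 + (l.map fun _ => 1).sum = a := by simpa using ha
    obtain rfl : l.length + 1 = k := by simpa using hk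
    have e := blockMap_cons (m := fun _ => 1) (fun _ : T => sOf (powOne x) n) t l rfl rfl rfl
    have h : (l.map fun _ => 1).sum = l.length := by simp
    rw [powCast_rfl, sOf_id_sComp, ih] at e
    refine e.trans ?_
    have h' := blockCons_powCons (sOf (powOne x) n) (sOf (𝟙 (pow x (l.map fun _ => 1).sum)) n)
      (powCast x h)
    have h'' : blockCons (sOf (powOne x) n) (sOf (𝟙 (pow x (l.map fun _ => 1).sum)) n) =
      sOf (powCast x (Nat.add_comm 1 _)) n := by
      have h₃ : sTensorCons (sOf (powOne x) n) (sOf (𝟙 (pow x (l.map fun _ => 1).sum)) n) =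
        sOf (powOne x ⊗ₘ 𝟙 _) n := sTensor_sOf _ _ _
      rw [blockCons, h₃]
      exact (sOf_comp _ _ n).symm.trans (congrArg (sOf · n) (powAdd_one_left x _))
    rw [h'', ← sOf_comp, sOf_id_sComp, powCons_powCast, powCast_trans] at h'
    exact h'.symm

lemma blockCons_id_powOne {m : ℕ} (q : (Map (pow x m) x).obj n) :
    sComp (blockCons q (sOf (𝟙 (pow x 0)) n)) (sOf (powOne x) n) = q := by
  have h : sComp (sTensorCons q (sOf (𝟙 (pow x 0)) n)) (sOf (powOne x) n) =
      sComp (sOf (ρ_ _).hom n) q := rightUnitor_natural q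
  rw [blockCons, sComp_assoc]
  refine (congrArg _ h).trans ((sOf_comp_sComp _ _ _).symm.trans ?_)
  exact (congrArg (fun f => sComp (sOf f n) q) (powAdd_zero_right x m)).trans (sOf_id_sComp q)

lemma blockMap_singleton (t : T) {a : ℕ} (ha : ([t].map m).sum = a) :
    sComp (blockMap q [t] ha rfl) (sOf (powOne x) n) =
      sComp (sOf (powCast x (by simpa using ha.symm)) n) (q t) := by
  have e := blockMap_cons q t [] (a := 0) (k := 0) (by simp) rfl rfl
  rw [powCast_rfl, sOf_id_sComp, blockMap_nil] at e
  rw [← powCast_blockMap q [t] (a := m t + 0) (by simp) rfl (by simpa using ha.symm), sComp_assoc]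
  refine congrArg _ ((congrArg (fun f => sComp f _) e).trans (blockCons_id_powOne (q t)))

end

end Blocks

end RigidOperad

end

noncomputable section

namespace RigidOperad

/-! ### Enumerations of finite sets -/

section Enumerations

/-- The list `l` enumerates the elements of `S`, and it has length `k`. -/
structure IsEnum {S : Type} (l : List S) (k : ℕ) : Prop where
  nodup : l.Nodup
  mem : ∀ s, s ∈ l
  length : l.length = k

/-- An enumeration of a finite type. -/
def enum (S : Type) [Finite S] : List S :=
  (@Finset.univ S (Fintype.ofFinite S)).toList

lemma isEnum_enum (S : Type) [Finite S] : IsEnum (enum S) (enum S).length where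
  nodup := Finset.nodup_toList _
  mem s := by simp [enum]
  length := rfl

namespace IsEnum

variable {S T : Type} {l l' : List S} {k k' : ℕ}

lemma perm (h : IsEnum l k) (h' : IsEnum l' k') : l.Perm l' :=
  (List.perm_ext_iff_of_nodup h.nodup h'.nodup).2 fun s => by simp [h.mem, h'.mem]

lemma map (h : IsEnum l k) (e : S ≃ T) : IsEnum (l.map e) k where
  nodup := h.nodup.map e.injective
  mem t := List.mem_map.2 ⟨e.symm t, h.mem _, by simp⟩
  length := by simp [h.length]

lemma sigma {l : List T} (hl : IsEnum l k) {S : T → Type} {r : ∀ t, List (S t)} {m : T → ℕ}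
    (hr : ∀ t, IsEnum (r t) (m t)) : IsEnum (l.sigma r) (l.map m).sum where
  nodup := hl.nodup.sigma fun t => (hr t).nodup
  mem := fun ⟨t, s⟩ => by simp [hl.mem, (hr t).mem]
  length := by
    have : (fun t => (r t).length) = m := funext fun t => (hr t).length
    rw [List.length_sigma, this]

end IsEnum

end Enumerations

/-! ### The coordinate-free endomorphism operad -/

section EndomorphismOperad

variable {D : Type u} [Category.{v} D] [MonoidalCategory D] [SymmetricCategory D]
  [SimplicialCategory D]

/-- The `n`-simplices of the space of operations with inputs `S` of the endomorphism operad of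
`x`: compatible families of simplices of `Map(x^{⊗ k}, x)`, one for each enumeration of `S`. -/
@[ext]
structure Operation (x : D) (S : Type) (n : SimplexCategoryᵒᵖ) where
  ev {k : ℕ} (l : List S) (h : IsEnum l k) : (Map (pow x k) x).obj n
  symm {k k' : ℕ} {l l' : List S} (h : IsEnum l k) (h' : IsEnum l' k')
    {φ : pow x k ⟶ pow x k'} (hφ : Symm x l l' φ) : ev l h = sComp (sOf φ n) (ev l' h')

namespace Operation

variable {x : D} {S T : Type} {n m : SimplexCategoryᵒᵖ} {k k' : ℕ} {l l' : List S}

lemma ev_congr (a : Operation x S n) (e : l = l') (h : IsEnum l k) :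
    a.ev l h = a.ev l' (e ▸ h) := by
  subst e; rfl

lemma ev_powCast (a : Operation x S n) (h : IsEnum l k) (h' : IsEnum l k') :
    sComp (sOf (powCast x (h.length.symm.trans h'.length)) n) (a.ev l h') = a.ev l h :=
  (a.symm h h' (.cast _ h.length _)).symm

/-- Two enumerations of `S` differ by a permutation, so some symmetry relates their values. -/
lemma ext_ev {a b : Operation x S n} (h : IsEnum l k) (e : a.ev l h = b.ev l h) : a = b := by
  refine Operation.ext (funext fun k' => funext fun l' => funext fun h' => ?_)
  obtain ⟨φ, hφ⟩ := Symm.exists_of_perm x (h'.perm h) h'.length h.length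
  rw [a.symm h' h hφ, b.symm h' h hφ, e]

/-- An operation is determined by its value at one enumeration. -/
def ofEnum (h : IsEnum l k) (a : (Map (pow x k) x).obj n) : Operation x S n where
  -- The choice is immaterial: the labels of an enumeration are distinct, so by `Symm.unique` there
  -- is only one symmetry between two enumerations.
  ev l' h' := sComp (sOf (Symm.exists_of_perm x (h'.perm h) h'.length h.length).choose n) a
  symm {k₁ k₂ l₁ l₂} h₁ h₂ φ hφ := by
    have e₁ := (Symm.exists_of_perm x (h₁.perm h) h₁.length h.length).choose_spec
    have e₂ := (Symm.exists_of_perm x (h₂.perm h) h₂.length h.length).choose_spec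
    rw [← sOf_comp_sComp, e₁.unique h₁.nodup (hφ.trans e₂)]

lemma ofEnum_ev (h : IsEnum l k) (a : (Map (pow x k) x).obj n) (h' : IsEnum l' k')
    {φ : pow x k' ⟶ pow x k} (hφ : Symm x l' l φ) :
    (ofEnum h a).ev l' h' = sComp (sOf φ n) a := by
  have e := (Symm.exists_of_perm x (h'.perm h) h'.length h.length).choose_spec
  exact congrArg (fun f => sComp (sOf f n) a) (e.unique h'.nodup hφ)

@[simp]
lemma ofEnum_ev_self (h : IsEnum l k) (a : (Map (pow x k) x).obj n) :
    (ofEnum h a).ev l h = a := by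
  rw [ofEnum_ev h a h (.refl h.length), sOf_id_sComp]

/-- Faces and degeneracies of operations. -/
@[simps]
def simplexMap (φ : n ⟶ m) (a : Operation x S n) : Operation x S m where
  ev l h := (Map _ _).map φ (a.ev l h)
  symm h h' _ hφ := by rw [a.symm h h' hφ, sComp_map, sOf_map]

/-- Relabelling of the inputs. -/
@[simps]
def relabel (e : S ≃ T) (a : Operation x S n) : Operation x T n where
  ev l h := a.ev (l.map e.symm) (h.map e.symm)
  symm _ _ _ hφ := a.symm _ _ (hφ.map e.symm)

lemma relabel_ev_map (e : S ≃ T) (a : Operation x S n) (h : IsEnum l k) :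
    (relabel e a).ev (l.map e) (h.map e) = a.ev l h :=
  a.ev_congr (by simp) _

lemma relabel_ev_of_eq (e : S ≃ T) (a : Operation x S n) (h : IsEnum l k) {l' : List T}
    (h' : IsEnum l' k) (hl : l' = l.map e) : (relabel e a).ev l' h' = a.ev l h := by
  subst hl
  exact relabel_ev_map e a h

/-- The identity operation. -/
def one (x : D) (n : SimplexCategoryᵒᵖ) : Operation x Unit n :=
  ofEnum (l := [()]) (k := 1) ⟨by simp, by simp, rfl⟩ (sOf (powOne x) n)

lemma simplexMap_id {S : Type} (a : Operation x S n) : a.simplexMap (𝟙 n) = a :=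
  Operation.ext (by
    funext k l h
    rw [simplexMap_ev, CategoryTheory.Functor.map_id]
    rfl)

lemma simplexMap_comp {S : Type} {n' : SimplexCategoryᵒᵖ} (φ : n ⟶ m) (ψ : m ⟶ n')
    (a : Operation x S n) : a.simplexMap (φ ≫ ψ) = (a.simplexMap φ).simplexMap ψ :=
  Operation.ext (by
    funext k l h
    rw [simplexMap_ev, CategoryTheory.Functor.map_comp]
    rfl)

lemma relabel_refl {S : Type} (a : Operation x S n) : a.relabel (Equiv.refl S) = a :=
  Operation.ext (by
    funext k l h
    rw [relabel_ev]
    exact a.ev_congr (by simp) _)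

lemma relabel_trans {S T R : Type} (e : S ≃ T) (e' : T ≃ R) (a : Operation x S n) :
    a.relabel (e.trans e') = (a.relabel e).relabel e' :=
  Operation.ext (by
    funext k l h
    rw [relabel_ev, relabel_ev, relabel_ev]
    exact a.ev_congr (by simp) _)

lemma isEnum_unit : IsEnum [()] 1 := ⟨by simp, by simp, rfl⟩

lemma one_ev (h : IsEnum [()] 1) : (one x n).ev [()] h = sOf (powOne x) n :=
  ofEnum_ev_self isEnum_unit _

variable [SimplicialSymmetricMonoidal D]

/-- Composition of operations. -/
def comp [Finite T] {S : T → Type} [∀ t, Finite (S t)] (p : Operation x T n)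
    (q : ∀ t, Operation x (S t) n) : Operation x (Σ t, S t) n :=
  ofEnum ((isEnum_enum T).sigma fun t => isEnum_enum (S t))
    (sComp (blockMap (fun t => (q t).ev _ (isEnum_enum (S t))) (enum T) rfl rfl)
      (p.ev _ (isEnum_enum T)))

/-- Composition is defined with chosen enumerations, but the formula holds for all of them:
`exists_symm_inner` changes the order inside the blocks and `exists_symm_outer` the order of the
blocks. The operad axioms are checked by evaluating both sides at enumerations for which this
formula applies. -/
lemma comp_ev [Finite T] {S : T → Type} [∀ t, Finite (S t)] (p : Operation x T n)
    (q : ∀ t, Operation x (S t) n) {l : List T} (hl : IsEnum l k) {r : ∀ t, List (S t)}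
    {m : T → ℕ} (hr : ∀ t, IsEnum (r t) (m t)) :
    (comp p q).ev (l.sigma r) (hl.sigma hr) =
      sComp (blockMap (fun t => (q t).ev (r t) (hr t)) l rfl hl.length) (p.ev l hl) := by
  choose φ hφ using fun t => Symm.exists_of_perm x ((hr t).perm (isEnum_enum (S t)))
    (hr t).length rfl
  obtain ⟨φ', hφ'⟩ := Symm.exists_of_perm x (hl.perm (isEnum_enum T)) hl.length rfl
  obtain ⟨ψ, h₁, h₂⟩ := exists_symm_inner (fun t => (q t).ev (r t) (hr t))
    (fun t => (q t).ev _ (isEnum_enum (S t))) (fun t => (r t).map (Sigma.mk t))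
    (fun t => (enum (S t)).map (Sigma.mk t)) φ (fun t => (hφ t).map _)
    (fun t => (q t).symm _ _ (hφ t)) l rfl rfl hl.length
  obtain ⟨ψ', h₁', h₂'⟩ := exists_symm_outer (fun t => (q t).ev _ (isEnum_enum (S t)))
    (fun t => (enum (S t)).map (Sigma.mk t)) (fun t => by simp) hφ' rfl rfl
  refine (ofEnum_ev _ _ _ (h₁.trans h₁')).trans ?_
  rw [h₂, p.symm hl (isEnum_enum T) hφ', sComp_assoc,
    sOf_comp_sComp, ← sComp_assoc _ (sOf φ' n), h₂', sComp_assoc]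

end Operation

variable [SimplicialSymmetricMonoidal D]

lemma blockMap_congr {x : D} {n : SimplexCategoryᵒᵖ} {T : Type} {m m' : T → ℕ}
    (q : ∀ t, (Map (pow x (m t)) x).obj n) (q' : ∀ t, (Map (pow x (m' t)) x).obj n)
    (h : ∀ t, m t = m' t) (hq : ∀ t, q t = sComp (sOf (powCast x (h t)) n) (q' t)) (l : List T)
    {a k : ℕ} (ha : (l.map m).sum = a) (ha' : (l.map m').sum = a) (hk : l.length = k) :
    blockMap q l ha hk = blockMap q' l ha' hk := by
  obtain rfl : m = m' := funext h
  obtain rfl : q = q' := funext fun t => by rw [hq, powCast_rfl, sOf_id_sComp]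
  rfl

lemma blockCons_simplexMap {x : D} {n n' : SimplexCategoryᵒᵖ} (φ : n ⟶ n') {m a k : ℕ}
    (q : (Map (pow x m) x).obj n) (g : (Map (pow x a) (pow x k)).obj n) :
    (Map _ _).map φ (blockCons q g) =
      blockCons ((Map _ _).map φ q) ((Map _ _).map φ g) := by
  rw [blockCons, sComp_map, sOf_map]
  exact congrArg (sComp _) (SimplicialSymmetricMonoidal.sTensor_map φ q g)

lemma blockMap_simplexMap {x : D} {n n' : SimplexCategoryᵒᵖ} (φ : n ⟶ n') {T : Type} {m : T → ℕ}
    (q : ∀ t, (Map (pow x (m t)) x).obj n) (l : List T)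
    {a k : ℕ} (ha : (l.map m).sum = a) (hk : l.length = k) :
    (Map _ _).map φ (blockMap q l ha hk) = blockMap (fun t => (Map _ _).map φ (q t)) l ha hk := by
  induction l generalizing a k with
  | nil => exact sOf_map _ _
  | cons t l ih =>
    simp only [blockMap, sComp_map, sOf_map, blockCons_simplexMap, ih]

lemma IsEnum.of_eq' {S : Type} {l l' : List S} {k k' : ℕ} (h : IsEnum l k) (e : l' = l)
    (e' : k = k') : IsEnum l' k' := by
  subst e e'; exact h

namespace Operation

variable {x : D} {n m : SimplexCategoryᵒᵖ}

lemma one_simplexMap (φ : n ⟶ m) : (one x n).simplexMap φ = one x m :=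
  ext_ev isEnum_unit (by rw [simplexMap_ev, one_ev, one_ev, sOf_map])

section

variable {T : Type} [Finite T] {S : T → Type} [∀ t, Finite (S t)]

lemma comp_simplexMap (φ : n ⟶ m) (p : Operation x T n) (q : ∀ t, Operation x (S t) n) :
    (comp p q).simplexMap φ = comp (p.simplexMap φ) (fun t => (q t).simplexMap φ) := by
  have hl := isEnum_enum T
  have hr := fun t => isEnum_enum (S t)
  refine ext_ev (hl.sigma hr) ?_
  rw [simplexMap_ev, comp_ev p q hl hr, comp_ev _ _ hl hr, sComp_map, blockMap_simplexMap]
  rfl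

lemma comp_relabel_left {T' : Type} [Finite T'] (e : T ≃ T') {S : T' → Type}
    [∀ t, Finite (S t)] (p : Operation x T n) (q : ∀ t, Operation x (S t) n) :
    comp (p.relabel e) q = (comp p (fun t => q (e t))).relabel (Equiv.sigmaCongrLeft (β := S) e) := by
  have hl := isEnum_enum T
  have hr := fun t => isEnum_enum (S t)
  have hlist : ((enum T).map e).sigma (fun t => enum (S t)) =
      ((enum T).sigma fun t => enum (S (e t))).map (Equiv.sigmaCongrLeft (β := S) e) := by
    simp [List.sigma, List.flatMap_map, List.map_flatMap, Function.comp_def, Equiv.sigmaCongrLeft]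
  have h := (hl.map e).sigma hr
  refine ext_ev h ?_
  -- The two tensor exponents are equal sums but not definitionally so; `ev_powCast` later passes
  -- from one to the other.
  have h' : ((enum T).map fun t => (enum (S (e t))).length).sum =
      (((enum T).map e).map fun t => (enum (S t)).length).sum := by
    rw [List.map_map]; rfl
  have h'' := hl.sigma (fun t => hr (e t))
  rw [h'] at h''
  rw [comp_ev _ _ (hl.map e) hr, blockMap_map, relabel_ev_map,
    relabel_ev_of_eq _ _ h'' h hlist, ← ev_powCast _ h'' (hl.sigma (fun t => hr (e t))),
    comp_ev p _ hl (fun t => hr (e t)), ← sComp_assoc, powCast_blockMap]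

lemma comp_relabel_right {S' : T → Type} [∀ t, Finite (S' t)] (e : ∀ t, S t ≃ S' t)
    (p : Operation x T n) (q : ∀ t, Operation x (S t) n) :
    comp p (fun t => (q t).relabel (e t)) = (comp p q).relabel (Equiv.sigmaCongrRight e) := by
  have hl := isEnum_enum T
  have hr := fun t => isEnum_enum (S t)
  have h := hl.sigma fun t => (hr t).map (e t)
  refine ext_ev h ?_
  rw [comp_ev _ _ hl fun t => (hr t).map (e t), relabel_ev_of_eq _ _ (hl.sigma hr) h (by
    simp [List.sigma, List.map_flatMap, Function.comp_def, Equiv.sigmaCongrRight]),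
    comp_ev p q hl hr]
  exact congrArg (fun f => sComp (blockMap f _ _ _) _)
    (funext fun t => relabel_ev_map (e t) (q t) (hr t))

lemma one_comp {S : Type} [Finite S] (p : Operation x S n) :
    (comp (one x n) (fun _ => p)).relabel (Equiv.uniqueSigma (fun _ : Unit => S)) = p := by
  have h := isEnum_enum S
  have h' := isEnum_unit.sigma (fun _ : Unit => h)
  refine ext_ev h ?_
  have h'' : IsEnum (List.sigma [()] fun _ => enum S) (enum S).length :=
    h'.of_eq' rfl (by simp)
  rw [relabel_ev_of_eq _ _ h'' h (by
    simp [List.sigma, Equiv.uniqueSigma, Function.comp_def]), ← ev_powCast _ h'' h',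
    comp_ev _ _ isEnum_unit (fun _ => h), one_ev, blockMap_singleton, ← sOf_comp_sComp,
    powCast_trans, powCast_rfl, sOf_id_sComp]

lemma comp_one (p : Operation x T n) :
    (comp p (fun _ => one x n)).relabel (Equiv.sigmaUnique T (fun _ => Unit)) = p := by
  have h := isEnum_enum T
  have h' := h.sigma (fun _ : T => isEnum_unit)
  refine ext_ev h ?_
  have h'' : IsEnum ((enum T).sigma fun _ => [()]) (enum T).length :=
    h'.of_eq' rfl (by simp)
  rw [relabel_ev_of_eq _ _ h'' h (by
    simp [List.sigma, Equiv.sigmaUnique, Function.comp_def, List.map_flatMap]), ← ev_powCast _ h'' h',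
    comp_ev _ _ h (fun _ => isEnum_unit)]
  simp only [one_ev]
  rw [blockMap_powOne, ← sOf_comp_sComp, powCast_trans, powCast_rfl, sOf_id_sComp]

lemma assoc {R : ∀ t, S t → Type} [∀ t s, Finite (R t s)] (p : Operation x T n)
    (q : ∀ t, Operation x (S t) n) (r : ∀ t s, Operation x (R t s) n) :
    (comp (comp p q) (fun ts : Σ t, S t => r ts.1 ts.2)).relabel (Equiv.sigmaAssoc R) =
      comp p (fun t => comp (q t) (r t)) := by
  have hl := isEnum_enum T
  have hr := fun t => isEnum_enum (S t)
  have hk := fun t s => isEnum_enum (R t s)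
  have h := hl.sigma fun t => (hr t).sigma (hk t)
  have h' := (hl.sigma hr).sigma (fun ts : Σ t, S t => hk ts.1 ts.2)
  have hlist : (enum T).sigma (fun t => (enum (S t)).sigma fun s => enum (R t s)) =
      (((enum T).sigma fun t => enum (S t)).sigma fun ts => enum (R ts.1 ts.2)).map
        (Equiv.sigmaAssoc R) := by
    simp [List.sigma, List.flatMap_assoc, List.flatMap_map, List.map_flatMap, Function.comp_def,
      Equiv.sigmaAssoc]
  have e : ((((enum T).sigma fun t => enum (S t)).map fun ts => (enum (R ts.1 ts.2)).length)).sum =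
      ((enum T).map fun t => ((enum (S t)).map fun s => (enum (R t s)).length).sum).sum := by
    rw [← h.length, ← h'.length, hlist, List.length_map]
  have h'' := h'.of_eq' rfl e
  refine ext_ev h ?_
  rw [relabel_ev_of_eq _ _ h'' h hlist, ← ev_powCast _ h'' h',
    comp_ev _ _ (hl.sigma hr) (fun ts : Σ t, S t => hk ts.1 ts.2), comp_ev p q hl hr,
    comp_ev _ _ hl fun t => (hr t).sigma (hk t), ← sComp_assoc, ← sComp_assoc, powCast_blockMap]
  refine congrArg (fun f => sComp f _) ?_
  -- Associativity itself is `blockMap_flatMap`; what remains is to compare sums of block lengths.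
  refine (blockMap_flatMap _ _ _ (fun t => by simp) _ _ _ _ _).trans
    (blockMap_congr _ _ (fun t => by rw [List.map_map]; rfl) (fun t => ?_) _ _ _ _)
  rw [comp_ev _ _ (hr t) (hk t), blockMap_map, ← sComp_assoc, powCast_blockMap]

end

end Operation

open Operation in
/-- The endomorphism operad of `x`. -/
def endOperad (x : D) : SimplicialOperad.{v} where
  obj S _ :=
    { obj n := Operation x S n
      map φ := ↾fun a => a.simplexMap φ
      map_id n := ConcreteCategory.hom_ext _ _ fun a => a.simplexMap_id
      map_comp φ ψ := ConcreteCategory.hom_ext _ _ fun a => a.simplexMap_comp φ ψ }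
  map e :=
    { app n := ↾fun a => a.relabel e
      naturality n m φ := rfl }
  map_refl S _ := NatTrans.ext (funext fun n => ConcreteCategory.hom_ext _ _ fun a => a.relabel_refl)
  map_trans e e' :=
    NatTrans.ext (funext fun n => ConcreteCategory.hom_ext _ _ fun a => a.relabel_trans e e')
  one n := Operation.one x n
  one_map φ := one_simplexMap φ
  comp p q := comp p q
  comp_map φ p q := comp_simplexMap φ p q
  comp_relabel_left e _ _ _ p q := comp_relabel_left e p q
  comp_relabel_right e _ p q := comp_relabel_right e p q
  one_comp p := one_comp p
  comp_one p := comp_one p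
  assoc p q r := assoc p q r

end EndomorphismOperad

end RigidOperad

end

noncomputable section

namespace RigidOperad

/-! ### Mapping complexes, suboperads and families of operad maps -/

lemma sset_naturality {X Y : SSet.{v}} (f : X ⟶ Y) {n m : SimplexCategoryᵒᵖ} (φ : n ⟶ m)
    (a : X.obj n) : f.app m (X.map φ a) = Y.map φ (f.app n a) :=
  ConcreteCategory.congr_hom (f.naturality φ) a

lemma sset_congr {X Y : SSet.{v}} {f g : X ⟶ Y} (h : f = g) (n : SimplexCategoryᵒᵖ)
    (a : X.obj n) : f.app n a = g.app n a := by
  rw [h]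

lemma sset_hom_ext {X Y : SSet.{v}} {f g : X ⟶ Y}
    (h : ∀ (n : SimplexCategoryᵒᵖ) (a : X.obj n), f.app n a = g.app n a) : f = g :=
  NatTrans.ext (funext fun n => ConcreteCategory.hom_ext _ _ fun a => h n a)

/-- The `n`-simplices of the mapping complex `Z ^ K`. -/
@[ext]
structure PowerSimplex (K Z : SSet.{v}) (n : SimplexCategoryᵒᵖ) where
  app {m : SimplexCategoryᵒᵖ} (φ : n ⟶ m) (d : K.obj m) : Z.obj m
  map_app {m l : SimplexCategoryᵒᵖ} (φ : n ⟶ m) (ψ : m ⟶ l) (d : K.obj m) :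
    Z.map ψ (app φ d) = app (φ ≫ ψ) (K.map ψ d)

/-- The mapping complex `Z ^ K`. -/
def power (K Z : SSet.{v}) : SSet.{v} where
  obj n := PowerSimplex K Z n
  map χ := ↾fun a =>
    { app := fun φ d => a.app (χ ≫ φ) d
      map_app := fun φ ψ d => by rw [a.map_app, Category.assoc] }
  map_id n := ConcreteCategory.hom_ext _ _ fun a =>
    PowerSimplex.ext (by funext m φ d; exact congrArg (fun χ => a.app χ d) (Category.id_comp φ))
  map_comp χ χ' := ConcreteCategory.hom_ext _ _ fun a =>
    PowerSimplex.ext (by funext m φ d; exact congrArg (fun χ => a.app χ d) (Category.assoc _ _ φ))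

lemma power_map_app {K Z : SSet.{v}} {n m l : SimplexCategoryᵒᵖ} (χ : n ⟶ m)
    (a : (power K Z).obj n) (φ : m ⟶ l) (d : K.obj l) :
    PowerSimplex.app ((power K Z).map χ a) φ d = PowerSimplex.app a (χ ≫ φ) d := rfl

/-- Maps to a mapping complex. -/
def powerHom {X K Z : SSet.{v}} (f : X ⊗ K ⟶ Z) : X ⟶ power K Z where
  app n := ↾fun x =>
    { app := fun {m} φ d => f.app m (X.map φ x, d)
      map_app := fun {_ l} φ ψ d => (sset_naturality f ψ _).symm.trans
        (congrArg (fun y => f.app l (y, K.map ψ d))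
          (ConcreteCategory.congr_hom (X.map_comp φ ψ) x).symm) }
  naturality n m φ := ConcreteCategory.hom_ext _ _ fun x => PowerSimplex.ext (by
    funext l ψ d
    exact congrArg (fun y => f.app l (y, d))
      (ConcreteCategory.congr_hom (X.map_comp φ ψ) x).symm)

/-- The map `X × K ⟶ Z` that corresponds to a map to a mapping complex. -/
def powerEval {X K Z : SSet.{v}} (f : X ⟶ power K Z) : X ⊗ K ⟶ Z where
  app n := ↾fun x => PowerSimplex.app (f.app n x.1) (𝟙 n) x.2
  naturality n m φ := ConcreteCategory.hom_ext _ _ fun x => by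
    obtain ⟨x, d⟩ := x
    refine Eq.trans ?_ (PowerSimplex.map_app (f.app n x) (𝟙 n) φ d).symm
    refine (congrArg (fun a => PowerSimplex.app a (𝟙 m) (K.map φ d)) (sset_naturality f φ x)).trans
      (congrArg (fun χ => PowerSimplex.app (f.app n x) χ (K.map φ d)) ?_)
    exact (Category.comp_id φ).trans (Category.id_comp φ).symm

lemma powerHom_powerEval {X K Z : SSet.{v}} (f : X ⟶ power K Z) : powerHom (powerEval f) = f :=
  sset_hom_ext fun n x => PowerSimplex.ext (by
    funext m φ d
    exact (congrArg (fun a => PowerSimplex.app a (𝟙 m) d) (sset_naturality f φ x)).trans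
      (congrArg (fun χ => PowerSimplex.app (f.app n x) χ d) (Category.comp_id φ)))

namespace SimplicialOperad

lemma map_app_map (P : SimplicialOperad.{v}) {S T : Type} [Finite S] [Finite T] (e : S ≃ T)
    {n m : SimplexCategoryᵒᵖ} (φ : n ⟶ m) (a : (P.obj S).obj n) :
    (P.obj T).map φ ((P.map e).app n a) = (P.map e).app m ((P.obj S).map φ a) :=
  (sset_naturality _ _ _).symm

lemma map_refl_app (P : SimplicialOperad.{v}) {S : Type} [Finite S]
    {n : SimplexCategoryᵒᵖ} (a : (P.obj S).obj n) : (P.map (Equiv.refl S)).app n a = a := by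
  rw [P.map_refl]; rfl

lemma map_trans_app (P : SimplicialOperad.{v}) {S T R : Type} [Finite S] [Finite T] [Finite R]
    (e : S ≃ T) (e' : T ≃ R) {n : SimplexCategoryᵒᵖ} (a : (P.obj S).obj n) :
    (P.map (e.trans e')).app n a = (P.map e').app n ((P.map e).app n a) := by
  rw [P.map_trans]; rfl

lemma Hom.app_map_apply {P Q : SimplicialOperad.{v}} (f : Hom P Q) {S T : Type} [Finite S]
    [Finite T] (e : S ≃ T) {n : SimplexCategoryᵒᵖ} (a : (P.obj S).obj n) :
    (f.app T).app n ((P.map e).app n a) = (Q.map e).app n ((f.app S).app n a) :=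
  sset_congr (f.app_map e) n a

/-- The levelwise mapping complexes `P ^ K`. -/
def power (P : SimplicialOperad.{v}) (K : SSet.{v}) : SimplicialOperad.{v} where
  obj S _ := RigidOperad.power K (P.obj S)
  map e :=
    { app n := ↾fun a =>
        { app := fun {m} φ d => (P.map e).app m (a.app φ d)
          map_app := fun φ ψ d => by rw [map_app_map, a.map_app] }
      naturality n m φ := rfl }
  map_refl S _ := sset_hom_ext fun n a => PowerSimplex.ext (by
    funext m φ d; exact P.map_refl_app _)
  map_trans e e' := sset_hom_ext fun n a => PowerSimplex.ext (by
    funext m φ d; exact P.map_trans_app _ _ _)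
  one n :=
    { app := fun {m} φ d => P.one m
      map_app := fun φ ψ d => P.one_map ψ }
  one_map φ := rfl
  comp p q :=
    { app := fun φ d => P.comp (p.app φ d) (fun t => (q t).app φ d)
      map_app := fun φ ψ d => by
        rw [P.comp_map, p.map_app]
        exact congrArg (P.comp _) (funext fun t => (q t).map_app φ ψ d) }
  comp_map φ p q := rfl
  comp_relabel_left e _ _ _ p q := PowerSimplex.ext (by
    funext m φ d; exact P.comp_relabel_left e _ _)
  comp_relabel_right e _ p q := PowerSimplex.ext (by
    funext m φ d; exact P.comp_relabel_right e _ _)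
  one_comp p := PowerSimplex.ext (by
    funext m φ d; exact P.one_comp _)
  comp_one p := PowerSimplex.ext (by
    funext m φ d; exact P.comp_one _)
  assoc p q r := PowerSimplex.ext (by
    funext m φ d
    exact P.assoc (p.app φ d) (fun t => (q t).app φ d) (fun t s => (r t s).app φ d))

/-- The product of two operads. -/
def prod (P Q : SimplicialOperad.{v}) : SimplicialOperad.{v} where
  obj S _ := P.obj S ⊗ Q.obj S
  map e := P.map e ⊗ₘ Q.map e
  map_refl S _ := by rw [P.map_refl, Q.map_refl]; simp
  map_trans e e' := by rw [P.map_trans, Q.map_trans]; simp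
  one n := (P.one n, Q.one n)
  one_map φ := Prod.ext (P.one_map φ) (Q.one_map φ)
  comp p q := (P.comp p.1 (fun t => (q t).1), Q.comp p.2 (fun t => (q t).2))
  comp_map φ p q := Prod.ext (P.comp_map φ _ _) (Q.comp_map φ _ _)
  comp_relabel_left e _ _ _ p q := Prod.ext (P.comp_relabel_left e _ _) (Q.comp_relabel_left e _ _)
  comp_relabel_right e _ p q := Prod.ext (P.comp_relabel_right e _ _) (Q.comp_relabel_right e _ _)
  one_comp p := Prod.ext (P.one_comp _) (Q.one_comp _)
  comp_one p := Prod.ext (P.comp_one _) (Q.comp_one _)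
  assoc p q r := Prod.ext (P.assoc _ _ fun t s => (r t s).1) (Q.assoc _ _ fun t s => (r t s).2)

/-- A family of sets of operations of `P` that is closed under the operad structure. -/
structure Sub (P : SimplicialOperad.{v}) where
  mem {S : Type} [Finite S] {n : SimplexCategoryᵒᵖ} (a : (P.obj S).obj n) : Prop
  simplexMap {S : Type} [Finite S] {n m : SimplexCategoryᵒᵖ} (φ : n ⟶ m) {a : (P.obj S).obj n}
    (h : mem a) : mem ((P.obj S).map φ a)
  map {S T : Type} [Finite S] [Finite T] (e : S ≃ T) {n : SimplexCategoryᵒᵖ}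
    {a : (P.obj S).obj n} (h : mem a) : mem ((P.map e).app n a)
  one (n : SimplexCategoryᵒᵖ) : mem (P.one n)
  comp {T : Type} [Finite T] {S : T → Type} [∀ t, Finite (S t)] {n : SimplexCategoryᵒᵖ}
    {p : (P.obj T).obj n} {q : ∀ t, (P.obj (S t)).obj n} (hp : mem p) (hq : ∀ t, mem (q t)) :
    mem (P.comp p q)

namespace Sub

variable {P : SimplicialOperad.{v}} (M : P.Sub)

/-- A suboperad. -/
def toOperad : SimplicialOperad.{v} where
  obj S _ :=
    { obj n := { a : (P.obj S).obj n // M.mem a }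
      map φ := ↾fun a => ⟨(P.obj S).map φ a.1, M.simplexMap φ a.2⟩
      map_id n := ConcreteCategory.hom_ext _ _ fun a => Subtype.ext
        (ConcreteCategory.congr_hom ((P.obj S).map_id n) a.1)
      map_comp φ ψ := ConcreteCategory.hom_ext _ _ fun a => Subtype.ext
        (ConcreteCategory.congr_hom ((P.obj S).map_comp φ ψ) a.1) }
  map e :=
    { app n := ↾fun a => ⟨(P.map e).app n a.1, M.map e a.2⟩
      naturality _ _ φ := ConcreteCategory.hom_ext _ _ fun a => Subtype.ext
        (sset_naturality (P.map e) φ a.1) }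
  map_refl _ _ := sset_hom_ext fun _ _ => Subtype.ext (P.map_refl_app _)
  map_trans _ _ := sset_hom_ext fun _ _ => Subtype.ext (P.map_trans_app _ _ _)
  one n := ⟨P.one n, M.one n⟩
  one_map φ := Subtype.ext (P.one_map φ)
  comp p q := ⟨P.comp p.1 (fun t => (q t).1), M.comp p.2 (fun t => (q t).2)⟩
  comp_map φ _ _ := Subtype.ext (P.comp_map φ _ _)
  comp_relabel_left e _ _ _ _ _ := Subtype.ext (P.comp_relabel_left e _ _)
  comp_relabel_right e _ _ _ := Subtype.ext (P.comp_relabel_right e _ _)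
  one_comp _ := Subtype.ext (P.one_comp _)
  comp_one _ := Subtype.ext (P.comp_one _)
  assoc _ _ r := Subtype.ext (P.assoc _ _ fun t s => (r t s).1)

end Sub

/-- A family of maps of operads `P ⟶ Q` that is parametrized by a simplicial set `K`. -/
structure HomFamily (P Q : SimplicialOperad.{v}) (K : SSet.{v}) where
  act {S : Type} [Finite S] {n : SimplexCategoryᵒᵖ} (d : K.obj n) (e : (P.obj S).obj n) :
    (Q.obj S).obj n
  act_simplexMap {S : Type} [Finite S] {n m : SimplexCategoryᵒᵖ} (φ : n ⟶ m) (d : K.obj n)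
    (e : (P.obj S).obj n) : (Q.obj S).map φ (act d e) = act (K.map φ d) ((P.obj S).map φ e)
  act_map {S T : Type} [Finite S] [Finite T] (σ : S ≃ T) {n : SimplexCategoryᵒᵖ} (d : K.obj n)
    (e : (P.obj S).obj n) : act d ((P.map σ).app n e) = (Q.map σ).app n (act d e)
  act_one {n : SimplexCategoryᵒᵖ} (d : K.obj n) : act d (P.one n) = Q.one n
  act_comp {T : Type} [Finite T] {S : T → Type} [∀ t, Finite (S t)] {n : SimplexCategoryᵒᵖ}
    (d : K.obj n) (p : (P.obj T).obj n) (q : ∀ t, (P.obj (S t)).obj n) :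
    act d (P.comp p q) = Q.comp (act d p) (fun t => act d (q t))

/-- The map of operads to the operad of mapping complexes that corresponds to a family. -/
def HomFamily.toHom {P Q : SimplicialOperad.{v}} {K : SSet.{v}} (f : HomFamily P Q K) :
    Hom P (Q.power K) where
  app S _ :=
    { app n := ↾fun e =>
        { app := fun φ d => f.act d ((P.obj S).map φ e)
          map_app := fun φ ψ d => by
            rw [f.act_simplexMap, CategoryTheory.Functor.map_comp]; rfl }
      naturality n m φ := ConcreteCategory.hom_ext _ _ fun e => PowerSimplex.ext (by
        funext l ψ d
        exact congrArg (f.act d) (ConcreteCategory.congr_hom ((P.obj S).map_comp φ ψ) e).symm) }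
  app_map e := sset_hom_ext fun n a => PowerSimplex.ext (by
    funext m φ d
    exact (congrArg (f.act d) (map_app_map _ _ _ _)).trans (f.act_map e d _))
  app_one n := PowerSimplex.ext (by
    funext m φ d
    exact (congrArg (f.act d) (P.one_map φ)).trans (f.act_one d))
  app_comp p q := PowerSimplex.ext (by
    funext m φ d
    exact (congrArg (f.act d) (P.comp_map φ p q)).trans (f.act_comp d _ _))

/-- The family that corresponds to a map of operads to the operad of mapping complexes. -/
def HomFamily.ofHom {P Q : SimplicialOperad.{v}} {K : SSet.{v}} (f : Hom P (Q.power K)) :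
    HomFamily P Q K where
  act {S _ n} d e := PowerSimplex.app ((f.app S).app n e) (𝟙 n) d
  act_simplexMap {S _ n m} φ d e := by
    refine (PowerSimplex.map_app ((f.app S).app n e) (𝟙 n) φ d).trans ?_
    refine Eq.trans (congrArg (fun χ => PowerSimplex.app ((f.app S).app n e) χ (K.map φ d)) ?_)
      (congrArg (fun a => PowerSimplex.app a (𝟙 m) (K.map φ d)) (sset_naturality (f.app S) φ e)).symm
    exact (Category.id_comp φ).trans (Category.comp_id φ).symm
  act_map σ n d e := by rw [f.app_map_apply]; rfl
  act_one d := by rw [f.app_one]; rfl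
  act_comp d p q := by rw [f.app_comp]; rfl

/-! ### Lifting families of maps out of a cofibrant operad -/

section Lifting

variable {N R : SimplicialOperad.{v}} (f : Hom N R) {A B : SSet.{v}} (i : A ⟶ B)

/-- The operad `N ^ A ×_{R ^ A} R ^ B`. -/
def relativePower : ((N.power A).prod (R.power B)).Sub where
  mem {S _ n} a := ∀ {m : SimplexCategoryᵒᵖ} (φ : n ⟶ m) (d : A.obj m),
    (f.app S).app m (PowerSimplex.app a.1 φ d) = PowerSimplex.app a.2 φ (i.app m d)
  simplexMap φ a h m ψ d := h (φ ≫ ψ) d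
  map e n a h m φ d := (f.app_map_apply e _).trans (congrArg _ (h φ d))
  one n m φ d := f.app_one m
  comp {T _ S _ n p q} hp hq m φ d := by
    refine (f.app_comp _ _).trans ?_
    rw [hp]
    simp only [hq]
    rfl

/-- The map `N ^ B ⟶ N ^ A ×_{R ^ A} R ^ B`. -/
def toRelativePower : Hom (N.power B) (Sub.toOperad (relativePower f i)) where
  app S _ :=
    { app n := ↾fun a => ⟨(
        { app := fun {m} φ d => PowerSimplex.app a φ (i.app m d)
          map_app := fun φ ψ d => (PowerSimplex.map_app a φ ψ (i.app _ d)).trans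
            (congrArg (PowerSimplex.app a (φ ≫ ψ)) (sset_naturality i ψ d).symm) },
        { app := fun {m} φ d => (f.app S).app m (PowerSimplex.app a φ d)
          map_app := fun φ ψ d => (sset_naturality (f.app S) ψ _).symm.trans
            (congrArg _ (PowerSimplex.map_app a φ ψ d)) }),
        fun _ _ => rfl⟩
      naturality n m φ := rfl }
  app_map {S T _ _} e := sset_hom_ext fun n a => Subtype.ext (Prod.ext rfl
    (PowerSimplex.ext (K := B) (Z := R.obj T) (by
      funext m φ d
      exact f.app_map_apply e (PowerSimplex.app a φ d))))
  app_one n := Subtype.ext (Prod.ext rfl (PowerSimplex.ext (K := B) (Z := R.obj Unit) (by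
    funext m φ d
    exact f.app_one m)))
  app_comp {T _ S _ n} p q := Subtype.ext (Prod.ext rfl
    (PowerSimplex.ext (K := B) (Z := R.obj (Σ t, S t)) (by
      funext m φ d
      exact f.app_comp (PowerSimplex.app p φ d) (fun t => PowerSimplex.app (q t) φ d))))

/-- By the exponential law, lifting against the inclusion of `C` in `X` becomes lifting against `f`
for the inclusion of `C.unionProd A` in `X ⊗ B`, which is a monomorphism. -/
lemma trivialFibration_toRelativePower (hf : ∀ (S : Type) [Finite S], TrivialFibration (f.app S))
    {B : SSet.{v}} (A : B.Subcomplex) (S : Type) [Finite S] :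
    TrivialFibration ((toRelativePower f A.ι).app S) := by
  refine trivialFibration_of_exists_lift fun X C u w h => ?_
  let w₁ : X ⟶ RigidOperad.power (A : SSet.{v}) (N.obj S) :=
    { app := fun n => ↾fun x => (w.app n x).1.1
      naturality := fun n m φ => ConcreteCategory.hom_ext _ _ fun x =>
        congrArg (fun z => z.1.1) (sset_naturality w φ x) }
  let w₂ : X ⟶ RigidOperad.power B (R.obj S) :=
    { app := fun n => ↾fun x => (w.app n x).1.2
      naturality := fun n m φ => ConcreteCategory.hom_ext _ _ fun x =>
        congrArg (fun z => z.1.2) (sset_naturality w φ x) }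
  have h₀ (n) (c : (C : SSet.{v}).obj n) : ((toRelativePower f A.ι).app S).app n (u.app n c) =
      w.app n (C.ι.app n c) := sset_congr h n c
  obtain ⟨l, h₁, h₂, h₃⟩ := exists_lift_unionProd C A (f.app S) (hf S _ (inferInstanceAs (Mono _)))
    (powerEval w₁) (powerEval (K := B) (Z := N.obj S) u)
    (sset_hom_ext fun n x => (congrArg (fun z => PowerSimplex.app z.1.1 (𝟙 n) x.2) (h₀ n x.1)).symm)
    (powerEval w₂)
    (sset_hom_ext fun n x => (w.app n x.1).2 (𝟙 n) x.2)
    (sset_hom_ext fun n x => congrArg (fun z => PowerSimplex.app z.1.2 (𝟙 n) x.2) (h₀ n x.1))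
  have h₁' (n) (x : X.obj n) (d : (A : SSet.{v}).obj n) :
      l.app n (x, A.ι.app n d) = PowerSimplex.app (w₁.app n x) (𝟙 n) d :=
    sset_congr h₁ n (x, d)
  have h₃' (n) (x : X.obj n) (d : B.obj n) :
      (f.app S).app n (l.app n (x, d)) = PowerSimplex.app (w₂.app n x) (𝟙 n) d :=
    sset_congr h₃ n (x, d)
  refine ⟨powerHom l, ?_, ?_⟩
  · rw [← powerHom_powerEval (K := B) (Z := N.obj S) u, ← h₂]
    rfl
  · refine sset_hom_ext fun n x => Subtype.ext (Prod.ext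
      (PowerSimplex.ext (K := (A : SSet.{v})) (Z := N.obj S) ?_)
      (PowerSimplex.ext (K := B) (Z := R.obj S) ?_))
    · funext m φ d
      refine (h₁' m (X.map φ x) d).trans ?_
      rw [sset_naturality, power_map_app, Category.comp_id]
      rfl
    · funext m φ d
      refine (h₃' m (X.map φ x) d).trans ?_
      rw [sset_naturality, power_map_app, Category.comp_id]
      rfl

/-- Families of maps out of a cofibrant operad lift along levelwise trivial fibrations, relative
to a subcomplex of the parameter space. -/
lemma IsCofibrant.exists_lift {E : SimplicialOperad.{v}} (hE : E.IsCofibrant)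
    (hf : ∀ (S : Type) [Finite S], TrivialFibration (f.app S))
    {B : SSet.{v}} (A : B.Subcomplex) (a : HomFamily E N (A : SSet.{v})) (b : HomFamily E R B)
    (h : ∀ {S : Type} [Finite S] {n : SimplexCategoryᵒᵖ} (d : (A : SSet.{v}).obj n)
      (e : (E.obj S).obj n), (f.app S).app n (a.act d e) = b.act (A.ι.app n d) e) :
    ∃ c : HomFamily E N B,
      (∀ {S : Type} [Finite S] {n : SimplexCategoryᵒᵖ} (d : (A : SSet.{v}).obj n)
        (e : (E.obj S).obj n), c.act (A.ι.app n d) e = a.act d e) ∧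
      (∀ {S : Type} [Finite S] {n : SimplexCategoryᵒᵖ} (d : B.obj n)
        (e : (E.obj S).obj n), (f.app S).app n (c.act d e) = b.act d e) := by
  -- The families `a` and `b` together are one map of operads to `N ^ A ×_{R ^ A} R ^ B`. Cofibrancy
  -- of `E` lifts it to `N ^ B`, that is, to a family over `B`.
  let g : Hom E (Sub.toOperad (relativePower f A.ι)) :=
    { app := fun S _ =>
        { app := fun n => ↾fun e => ⟨((a.toHom.app S).app n e, (b.toHom.app S).app n e),
            fun φ d => h d _⟩
          naturality := fun n m φ => ConcreteCategory.hom_ext _ _ fun e => Subtype.ext (Prod.ext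
            (sset_naturality (a.toHom.app S) φ e) (sset_naturality (b.toHom.app S) φ e)) }
      app_map := fun e => sset_hom_ext fun n x => Subtype.ext (Prod.ext
        (a.toHom.app_map_apply e x) (b.toHom.app_map_apply e x))
      app_one := fun n => Subtype.ext (Prod.ext (a.toHom.app_one n) (b.toHom.app_one n))
      app_comp := fun p q => Subtype.ext (Prod.ext (a.toHom.app_comp p q) (b.toHom.app_comp p q)) }
  obtain ⟨c, hc⟩ := hE _ _ (toRelativePower f A.ι)
    (fun S _ => ⟨(trivialFibration_toRelativePower f hf A S).kanFibration,
      (trivialFibration_toRelativePower f hf A S).weakHomotopyEquivalences⟩) g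
  have hc' (S) [Finite S] (n) (e : (E.obj S).obj n) :=
    sset_congr (hc S) n e
  have hid {S : Type} [Finite S] {n} (e : (E.obj S).obj n) : (E.obj S).map (𝟙 n) e = e :=
    ConcreteCategory.congr_hom ((E.obj S).map_id n) e
  refine ⟨.ofHom c, fun {S _ n} d e => ?_, fun {S _ n} d e => ?_⟩
  · exact (congrArg (fun z => PowerSimplex.app z.1.1 (𝟙 n) d) (hc' S n e)).trans
      (congrArg (a.act d) (hid e))
  · exact (congrArg (fun z => PowerSimplex.app z.1.2 (𝟙 n) d) (hc' S n e)).trans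
      (congrArg (b.act d) (hid e))

end Lifting

end SimplicialOperad

end RigidOperad

end

noncomputable section

namespace RigidOperad

/-! ### Standard enumerations of `Fin k` -/

section Enumerations

lemma isEnum_finRange (k : ℕ) : IsEnum (List.finRange k) k :=
  ⟨List.nodup_finRange k, List.mem_finRange, List.length_finRange⟩

namespace IsEnum

variable {S T : Type} {l : List S} {k : ℕ}

/-- The bijection given by an enumeration. -/
def equiv (h : IsEnum l k) : Fin k ≃ S :=
  Equiv.ofBijective (fun i => l.get (i.cast h.length.symm)) (by
    constructor
    · intro i j hij
      simpa using h.nodup.injective_get hij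
    · intro s
      obtain ⟨i, hi⟩ := List.mem_iff_get.1 (h.mem s)
      exact ⟨i.cast h.length, hi⟩)

lemma finRange_map_equiv (h : IsEnum l k) : (List.finRange k).map h.equiv = l := by
  obtain rfl := h.length
  exact List.map_get_finRange l

lemma map_eq (h : IsEnum l k) (e : S ≃ T) :
    l.map e = (List.finRange k).map (h.equiv.trans e) := by
  rw [Equiv.coe_trans, ← List.map_map, h.finRange_map_equiv]

lemma equiv_eq (h : IsEnum l k) {e : Fin k ≃ S} (he : (List.finRange k).map e = l) :
    h.equiv = e := by
  ext i
  have := (finRange_map_equiv h).trans he.symm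
  exact List.map_inj_left.1 this i (List.mem_finRange i)

end IsEnum

/-- Both `List.sigma` and `finSigmaFinEquiv` order pairs lexicographically. After passing to natural
numbers, this is an induction that removes the last block. -/
lemma sigma_finRange_map {k : ℕ} (m : Fin k → ℕ) :
    ((List.finRange k).sigma fun i => List.finRange (m i)).map finSigmaFinEquiv =
      List.finRange (∑ i, m i) := by
  apply List.map_injective_iff.2 Fin.val_injective
  rw [List.map_map, List.map_coe_finRange_eq_range]
  have h : ((List.finRange k).sigma fun i => List.finRange (m i)).map
      (Fin.val ∘ finSigmaFinEquiv) = (List.finRange k).flatMap fun i =>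
        (List.range (m i)).map fun j => ∑ i' : Fin i, m (Fin.castLE i.2.le i') + j := by
    rw [List.sigma, List.map_flatMap]
    refine List.flatMap_congr fun i _ => ?_
    rw [List.map_map, ← List.map_coe_finRange_eq_range, List.map_map]
    refine List.map_congr_left fun j _ => ?_
    simp [finSigmaFinEquiv_apply]
  rw [h]
  clear h
  induction k with
  | zero => simp
  | succ k ih =>
    rw [List.finRange_succ_last, List.flatMap_append, List.flatMap_map, Fin.sum_univ_castSucc,
      List.range_add, ← ih]
    simp only [List.flatMap_cons, List.flatMap_nil, List.append_nil]
    rfl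

end Enumerations

/-! ### Adjacent transpositions as symmetries of labelled factors -/

section Symmetries

variable {D : Type u} [Category.{v} D] [MonoidalCategory D] [SymmetricCategory D]

lemma powSwap_succ (x : D) (k i : ℕ) :
    RigidOperad.powSwap x (k + 1) (i + 1) = powCons (RigidOperad.powSwap x k i) := by
  cases k <;> rfl

/-- For `i = 0` this is a generating exchange; otherwise the first label stays in place and
induction applies to the rest. -/
lemma Symm.powSwap (x : D) {L : Type} {k i : ℕ} (hi : i + 1 < k) (f : Fin k → L) :
    Symm x ((List.finRange k).map fun j => f (Equiv.swap ⟨i, Nat.lt_of_succ_lt hi⟩ ⟨i + 1, hi⟩ j))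
      ((List.finRange k).map f) (RigidOperad.powSwap x k i) := by
  induction k generalizing i with
  | zero => omega
  | succ k ih =>
    rw [List.finRange_succ, List.map_cons, List.map_cons, List.map_map, List.map_map]
    cases i with
    | succ i =>
      have h (j : Fin k) : Equiv.swap (⟨i + 1, Nat.lt_of_succ_lt hi⟩ : Fin (k + 1)) ⟨i + 2, hi⟩ j.succ =
          (Equiv.swap ⟨i, by omega⟩ ⟨i + 1, by omega⟩ j).succ := by
        have := (Fin.succ_injective k).swap_apply ⟨i, by omega⟩ ⟨i + 1, by omega⟩ j
        exact this
      have h0 : Equiv.swap (⟨i + 1, Nat.lt_of_succ_lt hi⟩ : Fin (k + 1)) ⟨i + 2, hi⟩ 0 = 0 :=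
        Equiv.swap_apply_of_ne_of_ne (by simp [Fin.ext_iff]) (by simp [Fin.ext_iff])
      have := (ih (i := i) (by omega) fun j => f j.succ).cons (f 0)
      simp only [h0, Function.comp_def, h, powSwap_succ]
      exact this
    | zero =>
      obtain ⟨k, rfl⟩ : ∃ l, k = l + 1 := ⟨k - 1, by omega⟩
      rw [List.finRange_succ, List.map_cons, List.map_cons, List.map_map, List.map_map]
      have h (j : Fin k) : Equiv.swap (0 : Fin (k + 2)) 1 j.succ.succ = j.succ.succ :=
        Equiv.swap_apply_of_ne_of_ne (by simp [Fin.ext_iff]) (by simp [Fin.ext_iff])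
      have h0 : Equiv.swap (0 : Fin (k + 2)) 1 0 = 1 := Equiv.swap_apply_left _ _
      have h1 : Equiv.swap (0 : Fin (k + 2)) 1 1 = 0 := Equiv.swap_apply_right _ _
      have := Symm.swap (x := x) (f 1) (f 0)
        ((List.finRange k).map fun j => f j.succ.succ) (m := k) (by simp)
      have e : (List.finRange k).map (((fun j => f (Equiv.swap (0 : Fin (k + 2)) 1 j)) ∘ Fin.succ) ∘
          Fin.succ) = (List.finRange k).map fun j => f j.succ.succ := by
        simp only [Function.comp_def, h]
      have e0 : f (Equiv.swap (0 : Fin (k + 2)) 1 0) = f 1 := by rw [h0]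
      have e1 : f (Equiv.swap (0 : Fin (k + 2)) 1 (Fin.succ 0)) = f 0 := congrArg f h1
      rw [← e0, ← e1, ← e] at this
      exact this

end Symmetries

/-! ### Algebra structures in coordinates and maps to the endomorphism operad -/

section Correspondence

open SimplicialSymmetricMonoidal SimplicialOperad

variable {D : Type u} [Category.{v} D] [MonoidalCategory D] [SymmetricCategory D]
  [SimplicialCategory D] [SimplicialSymmetricMonoidal D]

lemma sOf_whiskerLeft_sTensorCons {x a b b' : D} {n : SimplexCategoryᵒᵖ} {k : ℕ} (f : b' ⟶ b)
    (q : (Map a x).obj n) (g : (Map b (pow x k)).obj n) :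
    sComp (sOf (a ◁ f) n) (sTensorCons q g) = sTensorCons q (sComp (sOf f n) g) := by
  rw [← MonoidalCategory.id_tensorHom, sOf_sTensorCons, sOf_id_sComp]

lemma blockMap_list_congr {x : D} {n : SimplexCategoryᵒᵖ} {T : Type} {m : T → ℕ}
    (q : ∀ t, (Map (pow x (m t)) x).obj n) {l l' : List T} (h : l = l') {a k : ℕ}
    (ha : (l.map m).sum = a) (hk : l.length = k) :
    blockMap q l ha hk = blockMap q l' (h ▸ ha) (h ▸ hk) := by
  subst h; rfl

lemma sum_map_finRange {k : ℕ} (m : Fin k → ℕ) : ((List.finRange k).map m).sum = ∑ i, m i := by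
  rw [← List.ofFn_eq_map, List.sum_ofFn]

/-- Here the list-based tensor product of operations meets the splitting and the tensor product used
in the composition axiom of `AlgebraFamily`. -/
lemma blockMap_finRange {x : D} {n : SimplexCategoryᵒᵖ} {k : ℕ} (m : Fin k → ℕ)
    (q : ∀ i, (Map (pow x (m i)) x).obj n) :
    blockMap q (List.finRange k) (sum_map_finRange m) List.length_finRange =
      sComp (sOf (powSplit x m) n) (sTensorFamily m q) := by
  induction k with
  | zero =>
    refine Eq.trans ?_ (sComp_sOf_id _).symm
    rfl
  | succ k ih =>
    have h : (((List.finRange k).map Fin.succ).map m).sum = ∑ i : Fin k, m i.succ := by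
      rw [List.map_map]
      exact sum_map_finRange fun i => m i.succ
    refine (blockMap_list_congr q List.finRange_succ _ _).trans ?_
    refine (blockMap_cons q 0 _ h (by simp) (Fin.sum_univ_succ m).symm).trans ?_
    rw [blockMap_map, ih (fun i => m i.succ) (fun i => q i.succ), blockCons,
      ← sOf_whiskerLeft_sTensorCons, ← sOf_comp_sComp, ← sOf_comp_sComp, Category.assoc]
    rfl

/-- The family of algebra structures that corresponds to a family of maps to the endomorphism
operad. -/
def SimplicialOperad.HomFamily.toAlgebra {E : SimplicialOperad.{v}} {x : D} {K : SSet.{v}}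
    (f : HomFamily E (endOperad x) K) : AlgebraFamily E x K where
  act k n d e := Operation.ev (f.act d e) (List.finRange k) (isEnum_finRange k)
  act_map k n m φ d e := congrArg (fun a => Operation.ev a (List.finRange k) (isEnum_finRange k))
    (f.act_simplexMap φ d e)
  act_one {n} d := by
    rw [f.act_map, f.act_one]
    have h : (List.finRange 1).map (Equiv.ofUnique Unit (Fin 1)).symm = [()] := by
      simp [List.finRange_succ]
    exact (Operation.ev_congr (Operation.one x n) h ((isEnum_finRange 1).map _)).trans
      (Operation.one_ev Operation.isEnum_unit)
  act_swap k i hi n d e := by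
    rw [f.act_map]
    refine Operation.symm (f.act d e) _ (isEnum_finRange k) ?_
    have := Symm.powSwap x hi id
    rw [List.map_id] at this
    exact this
  act_comp {k} m n d p q := by
    rw [f.act_map, f.act_comp]
    have h := (isEnum_finRange k).sigma fun i => isEnum_finRange (m i)
    have h' := h.of_eq' rfl (sum_map_finRange m)
    -- By `sigma_finRange_map` the standard enumeration of `Fin (∑ i, m i)` corresponds to the
    -- lexicographic enumeration of the pairs, where `Operation.comp_ev` applies.
    refine (Operation.relabel_ev_of_eq finSigmaFinEquiv _ h' (isEnum_finRange _)
      (sigma_finRange_map m).symm).trans ?_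
    refine (Operation.ev_powCast _ h' h).symm.trans ?_
    refine (congrArg (sComp _) (Operation.comp_ev (f.act d p) (fun i => f.act d (q i))
      (isEnum_finRange k) fun i => isEnum_finRange (m i))).trans ?_
    rw [← sComp_assoc, powCast_blockMap _ _ _ _ (sum_map_finRange m).symm, ← sComp_assoc]
    exact congrArg (fun g => sComp g _) (blockMap_finRange m _)

namespace AlgebraFamily

variable {E : SimplicialOperad.{v}} {x : D} {K : SSet.{v}} (θ : AlgebraFamily E x K)

/-- Equivariance is given for adjacent transpositions only. These generate the symmetric group, and
by coherence the symmetry obtained from a word in them depends only on the permutation. -/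
lemma act_perm {k : ℕ} (τ : Equiv.Perm (Fin k)) {n : SimplexCategoryᵒᵖ} (d : K.obj n)
    (e : (E.obj (Fin k)).obj n) {φ : pow x k ⟶ pow x k}
    (hφ : Symm x (List.finRange k) ((List.finRange k).map τ) φ) :
    θ.act k d ((E.map τ).app n e) = sComp (sOf φ n) (θ.act k d e) := by
  have h1 {k : ℕ} (e : (E.obj (Fin k)).obj n) {φ : pow x k ⟶ pow x k}
      (hφ : Symm x (List.finRange k) ((List.finRange k).map (1 : Equiv.Perm (Fin k))) φ) :
      θ.act k d ((E.map (1 : Equiv.Perm (Fin k))).app n e) = sComp (sOf φ n) (θ.act k d e) := by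
    have h : (List.finRange k).map (1 : Equiv.Perm (Fin k)) = List.finRange k := List.map_id _
    rw [h] at hφ
    rw [hφ.unique (List.nodup_finRange k) (.refl List.length_finRange), sOf_id_sComp]
    exact congrArg (θ.act k d) (E.map_refl_app e)
  cases k with
  | zero =>
    obtain rfl : τ = 1 := Subsingleton.elim _ _
    exact h1 e hφ
  | succ k =>
    have hτ : τ ∈ Submonoid.closure (Set.range fun i : Fin k => Equiv.swap i.castSucc i.succ) := by
      rw [Equiv.Perm.mclosure_swap_castSucc_succ]
      trivial
    induction hτ using Submonoid.closure_induction generalizing φ e with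
    | one => exact h1 e hφ
    | mem τ h =>
      obtain ⟨i, rfl⟩ := h
      have h := θ.act_swap (k + 1) i (Nat.succ_lt_succ i.2) d e
      have h' : Symm x ((List.finRange (k + 1)).map fun j => Equiv.swap i.castSucc i.succ
          (Equiv.swap i.castSucc i.succ j)) _ _ :=
        Symm.powSwap x (Nat.succ_lt_succ i.2) (Equiv.swap i.castSucc i.succ)
      have h'' : ((List.finRange (k + 1)).map fun j => Equiv.swap i.castSucc i.succ
          (Equiv.swap i.castSucc i.succ j)) = List.finRange (k + 1) := by simp
      rw [h''] at h'
      exact Eq.trans h (congrArg (fun φ => sComp (sOf φ n) _)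
        (Symm.unique (List.nodup_finRange _) h' hφ))
    | mul τ τ' _ _ ih ih' =>
      have hp (τ : Equiv.Perm (Fin (k + 1))) : (List.finRange (k + 1)).Perm
          ((List.finRange (k + 1)).map τ) :=
        (isEnum_finRange _).perm ((isEnum_finRange _).map τ)
      obtain ⟨ψ, hψ⟩ := Symm.exists_of_perm x (hp τ) (m := k + 1) (n := k + 1) (by simp) (by simp)
      obtain ⟨ψ', hψ'⟩ := Symm.exists_of_perm x (hp τ') (m := k + 1) (n := k + 1) (by simp) (by simp)
      -- Renaming labels does not change the underlying morphism, so `ψ'` still composes with `ψ`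
      -- after its labels are moved by `τ`.
      have h := hψ.trans (hψ'.map τ)
      rw [List.map_map] at h
      rw [hφ.unique (List.nodup_finRange _) h, sOf_comp_sComp, ← ih' e hψ', ← ih _ hψ]
      exact congrArg (θ.act (k + 1) d) (E.map_trans_app τ' τ e)

/-- This is the compatibility required of an `Operation`: an operation of `E` with inputs `S` acts
through any enumeration of `S`, and two enumerations differ by a permutation of `Fin k`. -/
lemma act_enum {S : Type} [Finite S] {n : SimplexCategoryᵒᵖ} (d : K.obj n) (e : (E.obj S).obj n)
    {k k' : ℕ} {l l' : List S} (h : IsEnum l k) (h' : IsEnum l' k') {φ : pow x k ⟶ pow x k'}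
    (hφ : Symm x l l' φ) :
    θ.act k d ((E.map h.equiv.symm).app n e) =
      sComp (sOf φ n) (θ.act k' d ((E.map h'.equiv.symm).app n e)) := by
  obtain rfl := hφ.eq_nat
  have hl : l.map h.equiv.symm = List.finRange k := by
    rw [h.map_eq h.equiv.symm]
    simp
  have hl' : l'.map h.equiv.symm = (List.finRange k).map (h'.equiv.trans h.equiv.symm) :=
    h'.map_eq h.equiv.symm
  have := hφ.map h.equiv.symm
  rw [hl, hl'] at this
  rw [← θ.act_perm _ d _ this, ← E.map_trans_app]
  have : h'.equiv.symm.trans (h'.equiv.trans h.equiv.symm) = h.equiv.symm := by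
    ext s
    simp
  rw [this]

/-- The family of maps to the endomorphism operad that corresponds to a family of algebra
structures. -/
def toHomFamily : HomFamily E (endOperad x) K where
  act {S _ n} d e :=
    { ev := fun {k} l h => θ.act k d ((E.map h.equiv.symm).app n e)
      symm := fun h h' _ hφ => θ.act_enum d e h h' hφ }
  act_simplexMap {S _ n m} φ d e := Operation.ext (by
    funext k l h
    refine (θ.act_map k φ d _).trans ?_
    rw [E.map_app_map])
  act_map {S T _ _} σ n d e := Operation.ext (by
    funext k l h
    refine congrArg (θ.act k d) ((E.map_trans_app _ _ _).symm.trans ?_)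
    have : (h.map σ.symm).equiv = h.equiv.trans σ.symm :=
      IsEnum.equiv_eq _ (h.map_eq σ.symm).symm
    rw [this]
    rfl)
  act_one {n} d := by
    refine Operation.ext_ev Operation.isEnum_unit (Eq.trans ?_ (Operation.one_ev _).symm)
    refine Eq.trans (congrArg (θ.act 1 d) ?_) (θ.act_one d)
    rw [Subsingleton.elim Operation.isEnum_unit.equiv.symm (Equiv.ofUnique Unit (Fin 1))]
  act_comp {T _ S _ n} d p q := by
    have hl := isEnum_enum T
    have hr := fun t => isEnum_enum (S t)
    let m := fun i => (enum (S (hl.equiv i))).length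
    let p' := (E.map hl.equiv.symm).app n p
    let q' := fun i => (E.map (hr (hl.equiv i)).equiv.symm).app n (q (hl.equiv i))
    -- The lexicographic enumeration of the pairs. Relabelling along it expresses `E.comp p q` by
    -- the composite of the coordinate operations `p'` and `q'`, to which `act_comp` applies.
    let ε : Fin (∑ i, m i) ≃ Σ t, S t := finSigmaFinEquiv.symm.trans
      ((Equiv.sigmaCongrRight fun i => (hr (hl.equiv i)).equiv).trans
        (Equiv.sigmaCongrLeft (β := S) hl.equiv))
    have hε : finSigmaFinEquiv.trans ε = (Equiv.sigmaCongrRight fun i => (hr (hl.equiv i)).equiv).trans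
        (Equiv.sigmaCongrLeft (β := S) hl.equiv) := by
      rw [← Equiv.trans_assoc, Equiv.self_trans_symm, Equiv.refl_trans]
    have h := (isEnum_finRange (∑ i, m i)).map ε
    have he : E.comp p q = (E.map ε).app n ((E.map finSigmaFinEquiv).app n (E.comp p' q')) := by
      rw [← E.map_trans_app, hε, E.map_trans_app, ← E.comp_relabel_right]
      simp only [q', ← E.map_trans_app, Equiv.symm_trans_self, E.map_refl_app]
      rw [← E.comp_relabel_left, ← E.map_trans_app, Equiv.symm_trans_self, E.map_refl_app]
    have hlist : (List.finRange (∑ i, m i)).map ε = (enum T).sigma fun t => enum (S t) := by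
      have h' : ε ∘ finSigmaFinEquiv = (finSigmaFinEquiv.trans ε : _ → _) := rfl
      have hT : enum T = (List.finRange (enum T).length).map hl.equiv := hl.finRange_map_equiv.symm
      rw [← sigma_finRange_map m, List.map_map, h', hε, List.sigma, List.sigma, List.map_flatMap]
      refine Eq.trans ?_ (congrArg (List.flatMap _) hT).symm
      rw [List.flatMap_map]
      refine List.flatMap_congr fun i _ => ?_
      refine Eq.trans ?_ (congrArg (List.map _) (hr (hl.equiv i)).finRange_map_equiv)
      rw [List.map_map, List.map_map]
      rfl
    have hm : ((enum T).map fun t => (enum (S t)).length).sum = ∑ i, m i := by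
      refine (congrArg (fun l => (List.map _ l).sum) hl.finRange_map_equiv.symm).trans ?_
      rw [List.map_map]
      exact sum_map_finRange m
    refine Operation.ext_ev h ?_
    refine Eq.trans (b := θ.act (∑ i, m i) d ((E.map finSigmaFinEquiv).app n (E.comp p' q')))
      (congrArg (θ.act _ d) ?_) ?_
    · rw [he, ← E.map_trans_app, IsEnum.equiv_eq h rfl, Equiv.self_trans_symm, E.map_refl_app]
    · rw [θ.act_comp, ← sComp_assoc, ← blockMap_finRange]
      refine Eq.trans ?_ (Operation.ev_congr (Operation.comp _ _) hlist h).symm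
      refine Eq.trans ?_ (Operation.ev_powCast (Operation.comp _ _) _ (hl.sigma hr))
      refine Eq.trans ?_ (congrArg (sComp _) (Operation.comp_ev _ _ hl hr)).symm
      rw [← sComp_assoc, powCast_blockMap _ _ _ _ hm.symm]
      refine congrArg (fun g => sComp g (θ.act _ d p')) ?_
      refine Eq.trans ?_ (blockMap_list_congr _ hl.finRange_map_equiv.symm _ _).symm
      rw [blockMap_map]

/-- This makes `toAlgebra` a left inverse of `toHomFamily`: the standard enumeration of `Fin k`
relabels by the identity. -/
lemma toHomFamily_act_ev {k : ℕ} {n : SimplexCategoryᵒᵖ} (d : K.obj n)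
    (e : (E.obj (Fin k)).obj n) :
    Operation.ev (θ.toHomFamily.act d e) (List.finRange k) (isEnum_finRange k) = θ.act k d e := by
  refine congrArg (θ.act k d) ?_
  rw [(isEnum_finRange k).equiv_eq (e := Equiv.refl _) (List.map_id _)]
  exact E.map_refl_app e

end AlgebraFamily

end Correspondence

end RigidOperad

end

noncomputable section

namespace RigidOperad

/-! ### Naturality of splittings and symmetries; the case of the unit -/

section Naturality

variable {D : Type u} [Category.{v} D] [MonoidalCategory D]

lemma powAdd_powMap {x y : D} (f : x ⟶ y) (a b : ℕ) :
    powAdd x a b ≫ (powMap f a ⊗ₘ powMap f b) = powMap f (a + b) ≫ powAdd y a b := by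
  induction a with
  | zero =>
    have h : powZeroAdd x b ≫ (powMap f 0 ⊗ₘ powMap f b) = powMap f b ≫ powZeroAdd y b := by
      have : (λ_ (pow x b)).inv ≫ (𝟙 (𝟙_ D) ⊗ₘ powMap f b) = powMap f b ≫ (λ_ (pow y b)).inv := by
        simp
      exact this
    rw [powAdd_zero_left, powAdd_zero_left, Category.assoc, h, ← Category.assoc, powCast_powMap,
      Category.assoc]
  | succ a ih =>
    have h {m a b : ℕ} (u : pow x m ⟶ pow x a ⊗ pow x b) (w : pow y m ⟶ pow y a ⊗ pow y b)
        (h : u ≫ (powMap f a ⊗ₘ powMap f b) = powMap f m ≫ w) :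
        powConsAdd u ≫ (powMap f (a + 1) ⊗ₘ powMap f b) = powMap f (m + 1) ≫ powConsAdd w := by
      have : (x ◁ u ≫ (α_ x (pow x a) (pow x b)).inv) ≫ ((f ⊗ₘ powMap f a) ⊗ₘ powMap f b) =
          (f ⊗ₘ powMap f m) ≫ y ◁ w ≫ (α_ _ _ _).inv := by
        rw [Category.assoc, ← associator_inv_naturality, ← MonoidalCategory.id_tensorHom,
          ← MonoidalCategory.id_tensorHom, MonoidalCategory.tensorHom_comp_tensorHom_assoc,
          MonoidalCategory.tensorHom_comp_tensorHom_assoc, h]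
        simp
      exact this
    rw [powAdd_succ, powAdd_succ, Category.assoc, h _ _ ih, ← Category.assoc, powCast_powMap,
      Category.assoc]

lemma powCons_powMap {x y : D} (f : x ⟶ y) {m n : ℕ} {φ : pow x m ⟶ pow x n}
    {ψ : pow y m ⟶ pow y n} (h : φ ≫ powMap f n = powMap f m ≫ ψ) :
    powCons φ ≫ powMap f (n + 1) = powMap f (m + 1) ≫ powCons ψ := by
  have : x ◁ φ ≫ (f ⊗ₘ powMap f n) = (f ⊗ₘ powMap f m) ≫ y ◁ ψ := by
    rw [← MonoidalCategory.id_tensorHom, ← MonoidalCategory.id_tensorHom,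
      MonoidalCategory.tensorHom_comp_tensorHom, MonoidalCategory.tensorHom_comp_tensorHom, h]
    simp
  exact this

variable [SymmetricCategory D]

lemma powSwap₀_powMap {x y : D} (f : x ⟶ y) (m : ℕ) :
    powSwap₀ x m ≫ powMap f (m + 2) = powMap f (m + 2) ≫ powSwap₀ y m := by
  have : swapFirst x x (pow x m) ≫ (f ⊗ₘ f ⊗ₘ powMap f m) =
      (f ⊗ₘ f ⊗ₘ powMap f m) ≫ swapFirst y y (pow y m) := by
    simp only [swapFirst, Category.assoc]
    rw [← associator_naturality, ← MonoidalCategory.tensorHom_id,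
      MonoidalCategory.tensorHom_comp_tensorHom_assoc, ← BraidedCategory.braiding_naturality,
      associator_inv_naturality_assoc, ← MonoidalCategory.tensorHom_id,
      MonoidalCategory.tensorHom_comp_tensorHom_assoc]
    simp
  exact this

/-- The same word in the generators is read in powers of `y`; each generator is natural. -/
lemma Symm.exists_powMap {x y : D} (f : x ⟶ y) {L : Type} {l l' : List L} {m n : ℕ}
    {φ : pow x m ⟶ pow x n} (h : Symm x l l' φ) :
    ∃ ψ : pow y m ⟶ pow y n, Symm y l l' ψ ∧ φ ≫ powMap f n = powMap f m ≫ ψ := by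
  induction h with
  | cast l hm hmn => exact ⟨_, .cast l hm hmn, powCast_powMap f hmn⟩
  | cons a _ ih =>
    obtain ⟨ψ, h, h'⟩ := ih
    exact ⟨_, .cons a h, powCons_powMap f h'⟩
  | swap a b l hm => exact ⟨_, .swap a b l hm, powSwap₀_powMap f _⟩
  | trans _ _ ih ih' =>
    obtain ⟨ψ, h, e⟩ := ih
    obtain ⟨ψ', h', e'⟩ := ih'
    exact ⟨_, h.trans h', by rw [Category.assoc, e', ← Category.assoc, e, Category.assoc]⟩

lemma powCast_unitMul {m n : ℕ} (h : m = n) : powCast (𝟙_ D) h ≫ unitMul D n = unitMul D m := by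
  subst h; simp

lemma powCons_unitMul {m n : ℕ} {φ : pow (𝟙_ D) m ⟶ pow (𝟙_ D) n} (h : φ ≫ unitMul D n = unitMul D m) :
    powCons φ ≫ unitMul D (n + 1) = unitMul D (m + 1) := by
  have : 𝟙_ D ◁ φ ≫ (λ_ (pow (𝟙_ D) n)).hom ≫ unitMul D n = (λ_ _).hom ≫ unitMul D m := by
    simp [h]
  exact this

lemma powSwap₀_unitMul (m : ℕ) : powSwap₀ (𝟙_ D) m ≫ unitMul D (m + 2) = unitMul D (m + 2) := by
  have h (z : D) : swapFirst (𝟙_ D) (𝟙_ D) z ≫ (λ_ (𝟙_ D ⊗ z)).hom ≫ (λ_ z).hom =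
      (λ_ (𝟙_ D ⊗ z)).hom ≫ (λ_ z).hom := by
    simp [swapFirst]
  have : swapFirst (𝟙_ D) (𝟙_ D) (pow (𝟙_ D) m) ≫ (λ_ (𝟙_ D ⊗ pow (𝟙_ D) m)).hom ≫
      (λ_ (pow (𝟙_ D) m)).hom ≫ unitMul D m = (λ_ (𝟙_ D ⊗ pow (𝟙_ D) m)).hom ≫
      (λ_ (pow (𝟙_ D) m)).hom ≫ unitMul D m := by
    have := congrArg (· ≫ unitMul D m) (h (pow (𝟙_ D) m))
    simpa only [Category.assoc] using this
  exact this

/-- Since the symmetry of `I ⊗ I` is the identity, exchanging factors of `I^{⊗ k}` does not affect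
the multiplication. -/
lemma Symm.unitMul {L : Type} {l l' : List L} {m n : ℕ} {φ : pow (𝟙_ D) m ⟶ pow (𝟙_ D) n}
    (h : Symm (𝟙_ D) l l' φ) : φ ≫ RigidOperad.unitMul D n = RigidOperad.unitMul D m := by
  induction h with
  | cast l hm hmn => exact powCast_unitMul hmn
  | cons a _ ih => exact powCons_unitMul ih
  | swap a b l hm => exact powSwap₀_unitMul _
  | trans _ _ ih ih' => rw [Category.assoc, ih', ih]

lemma powAdd_unitMul (a b : ℕ) :
    powAdd (𝟙_ D) a b ≫ (unitMul D a ⊗ₘ unitMul D b) ≫ (λ_ (𝟙_ D)).hom = unitMul D (a + b) := by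
  induction a with
  | zero =>
    have h : powZeroAdd (𝟙_ D) b ≫ (unitMul D 0 ⊗ₘ unitMul D b) ≫ (λ_ (𝟙_ D)).hom =
        unitMul D b := by
      have : (λ_ (pow (𝟙_ D) b)).inv ≫ (𝟙 (𝟙_ D) ⊗ₘ unitMul D b) ≫ (λ_ (𝟙_ D)).hom = unitMul D b := by
        simp
      exact this
    rw [powAdd_zero_left, Category.assoc, h, powCast_unitMul]
  | succ a ih =>
    have h {m : ℕ} (u : pow (𝟙_ D) m ⟶ pow (𝟙_ D) a ⊗ pow (𝟙_ D) b)
        (h : u ≫ (unitMul D a ⊗ₘ unitMul D b) ≫ (λ_ (𝟙_ D)).hom = unitMul D m) :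
        powConsAdd u ≫ (unitMul D (a + 1) ⊗ₘ unitMul D b) ≫ (λ_ (𝟙_ D)).hom =
          unitMul D (m + 1) := by
      have : (𝟙_ D ◁ u ≫ (α_ _ (pow (𝟙_ D) a) (pow (𝟙_ D) b)).inv) ≫
          (((λ_ (pow (𝟙_ D) a)).hom ≫ unitMul D a) ⊗ₘ unitMul D b) ≫ (λ_ (𝟙_ D)).hom =
          (λ_ _).hom ≫ unitMul D m := by
        rw [← h]
        simp [MonoidalCategory.tensorHom_def]
      exact this
    rw [powAdd_succ, Category.assoc, h _ ih, powCast_unitMul]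

end Naturality

/-! ### Operations compatible with a morphism -/

section Compat

open SimplicialSymmetricMonoidal SimplicialOperad

variable {D : Type u} [Category.{v} D] [MonoidalCategory D] [SymmetricCategory D]
  [SimplicialCategory D]

namespace Operation

variable {x y : D} (f : x ⟶ y) {S T : Type} {n m : SimplexCategoryᵒᵖ} {k : ℕ} {l : List S}

/-- The operations `a` and `b` are compatible with the morphism `f`. -/
def Compat (a : Operation x S n) (b : Operation y S n) : Prop :=
  ∀ (k : ℕ) (l : List S) (h : IsEnum l k),
    sComp (a.ev l h) (sOf f n) = sComp (sOf (powMap f k) n) (b.ev l h)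

variable {f} {a : Operation x S n} {b : Operation y S n}

/-- One enumeration suffices, since symmetries of powers of `x` and of `y` correspond under `f`. -/
lemma compat_of_enum (h : IsEnum l k)
    (e : sComp (a.ev l h) (sOf f n) = sComp (sOf (powMap f k) n) (b.ev l h)) : Compat f a b := by
  intro k' l' h'
  obtain ⟨φ, hφ⟩ := Symm.exists_of_perm x (h'.perm h) h'.length h.length
  obtain ⟨ψ, hψ, e'⟩ := hφ.exists_powMap f
  rw [a.symm h' h hφ, b.symm h' h hψ, sComp_assoc, e, ← sOf_comp_sComp, ← sOf_comp_sComp, e']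

lemma Compat.simplexMap (h : Compat f a b) (φ : n ⟶ m) :
    Compat f (a.simplexMap φ) (b.simplexMap φ) := by
  intro k l hl
  have := congrArg ((Map (pow x k) y).map φ) (h k l hl)
  rw [sComp_map, sComp_map, sOf_map, sOf_map] at this
  exact this

lemma Compat.relabel (h : Compat f a b) (e : S ≃ T) : Compat f (a.relabel e) (b.relabel e) :=
  fun _ _ _ => h _ _ _

lemma compat_one (f : x ⟶ y) : Compat f (one x n) (one y n) := by
  refine compat_of_enum isEnum_unit ?_
  rw [one_ev, one_ev, ← sOf_comp, ← sOf_comp]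
  have : (ρ_ x).hom ≫ f = (f ⊗ₘ 𝟙 (𝟙_ D)) ≫ (ρ_ y).hom := by simp
  exact congrArg (sOf · n) this

variable [SimplicialSymmetricMonoidal D]

lemma blockCons_powMap {m a k : ℕ} {q : (Map (pow x m) x).obj n}
    {g : (Map (pow x a) (pow x k)).obj n} {r : (Map (pow y m) y).obj n}
    {h : (Map (pow y a) (pow y k)).obj n}
    (hq : sComp q (sOf f n) = sComp (sOf (powMap f m) n) r)
    (hg : sComp g (sOf (powMap f k) n) = sComp (sOf (powMap f a) n) h) :
    sComp (blockCons q g) (sOf (powMap f (k + 1)) n) =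
      sComp (sOf (powMap f (m + a)) n) (blockCons r h) := by
  have e : sComp (sTensorCons q g) (sOf (powMap f (k + 1)) n) =
      sComp (sOf (powMap f m ⊗ₘ powMap f a) n) (sTensorCons r h) := by
    have : sComp (sTensor q g) (sOf (f ⊗ₘ powMap f k) n) =
      sComp (sOf (powMap f m ⊗ₘ powMap f a) n) (sTensor r h) := by
      rw [← sTensor_sOf, ← sTensor_sOf, ← sTensor_sComp, ← sTensor_sComp, hq, hg]
    exact this
  rw [blockCons, sComp_assoc, e, ← sOf_comp_sComp, powAdd_powMap, sOf_comp_sComp, blockCons]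

lemma blockMap_powMap {m : T → ℕ} {q : ∀ t, (Map (pow x (m t)) x).obj n}
    {r : ∀ t, (Map (pow y (m t)) y).obj n}
    (hq : ∀ t, sComp (q t) (sOf f n) = sComp (sOf (powMap f (m t)) n) (r t)) (l : List T)
    {a k : ℕ} (ha : (l.map m).sum = a) (hk : l.length = k) :
    sComp (blockMap q l ha hk) (sOf (powMap f k) n) =
      sComp (sOf (powMap f a) n) (blockMap r l ha hk) := by
  subst ha hk
  induction l with
  | nil => exact (sComp_sOf_id (sOf (𝟙 (𝟙_ D)) n)).trans (sOf_id_sComp (sOf (𝟙 (𝟙_ D)) n)).symm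
  | cons t l ih =>
    have e₁ := blockMap_cons q t l rfl rfl rfl
    have e₂ := blockMap_cons r t l rfl rfl rfl
    rw [powCast_rfl, sOf_id_sComp] at e₁ e₂
    refine (congrArg (fun g => sComp g _) e₁).trans (Eq.trans ?_ (congrArg (sComp _) e₂).symm)
    exact blockCons_powMap (hq t) ih

lemma Compat.comp [Finite T] {S : T → Type} [∀ t, Finite (S t)] {p : Operation x T n}
    {p' : Operation y T n} {q : ∀ t, Operation x (S t) n} {q' : ∀ t, Operation y (S t) n}
    (h : Compat f p p') (h' : ∀ t, Compat f (q t) (q' t)) :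
    Compat f (Operation.comp p q) (Operation.comp p' q') := by
  have hl := isEnum_enum T
  have hr := fun t => isEnum_enum (S t)
  refine compat_of_enum (hl.sigma hr) ?_
  rw [comp_ev _ _ hl hr, comp_ev _ _ hl hr, sComp_assoc, h, ← sComp_assoc,
    blockMap_powMap fun t => h' t _ _ (hr t), sComp_assoc]

/-- The operation on the unit that is given by the canonical isomorphisms `I^{⊗ k} ⟶ I`. -/
def unitOperation (D : Type u) [Category.{v} D] [MonoidalCategory D] [SymmetricCategory D]
    [SimplicialCategory D] (S : Type) (n : SimplexCategoryᵒᵖ) : Operation (𝟙_ D) S n where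
  ev {k} _ _ := sOf (unitMul D k) n
  symm h h' _ hφ := by rw [← sOf_comp, hφ.unitMul]

lemma unitOperation_one : unitOperation D Unit n = one (𝟙_ D) n := by
  refine ext_ev isEnum_unit ?_
  rw [one_ev]
  refine congrArg (sOf · n) ?_
  have : (λ_ (𝟙_ D)).hom ≫ 𝟙 _ = (ρ_ (𝟙_ D)).hom := by
    rw [unitors_equal, Category.comp_id]
  exact this

lemma blockMap_unitMul (m : T → ℕ) (l : List T) {a k : ℕ} (ha : (l.map m).sum = a)
    (hk : l.length = k) :
    ∃ φ : pow (𝟙_ D) a ⟶ pow (𝟙_ D) k, φ ≫ unitMul D k = unitMul D a ∧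
      blockMap (fun t => sOf (unitMul D (m t)) n) l ha hk = sOf φ n := by
  subst ha hk
  induction l with
  | nil => exact ⟨_, Category.id_comp _, rfl⟩
  | cons t l ih =>
    obtain ⟨φ, h, e⟩ := ih
    have e₁ := blockMap_cons (fun t => sOf (unitMul D (m t)) n) t l rfl rfl rfl
    rw [powCast_rfl, sOf_id_sComp, e] at e₁
    refine ⟨powAdd (𝟙_ D) (m t) _ ≫ (unitMul D (m t) ⊗ₘ φ), ?_, e₁.trans ?_⟩
    · have : (unitMul D (m t) ⊗ₘ φ) ≫ (λ_ _).hom ≫ unitMul D l.length =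
          (unitMul D (m t) ⊗ₘ unitMul D _) ≫ (λ_ (𝟙_ D)).hom := by
        rw [← h]
        simp [MonoidalCategory.tensorHom_def]
      refine Eq.trans ?_ (powAdd_unitMul (m t) (l.map m).sum)
      refine (Category.assoc _ _ _).trans ?_
      exact congrArg (_ ≫ ·) this
    · have : sTensor (sOf (unitMul D (m t)) n) (sOf φ n) = sOf (unitMul D (m t) ⊗ₘ φ) n :=
        sTensor_sOf _ _ _
      refine (congrArg (sComp _) this).trans ?_
      exact (sOf_comp _ _ n).symm

/-- With `unitOperation_one`, this says that the canonical isomorphisms form an image of the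
commutative operad in `End(I)`. It makes `unitSub` closed under the operad structure. -/
lemma unitOperation_comp [Finite T] (S : T → Type) [∀ t, Finite (S t)] :
    comp (unitOperation D T n) (fun t => unitOperation D (S t) n) =
      unitOperation D (Σ t, S t) n := by
  have hl := isEnum_enum T
  have hr := fun t => isEnum_enum (S t)
  refine ext_ev (hl.sigma hr) ?_
  rw [comp_ev _ _ hl hr]
  obtain ⟨φ, h, e⟩ := blockMap_unitMul (D := D) (n := n) (fun t => (enum (S t)).length) (enum T)
    rfl rfl
  refine (congrArg (fun g => sComp g _) e).trans ?_
  exact (sOf_comp _ _ n).symm.trans (congrArg (sOf · n) h)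

end Operation

end Compat

end RigidOperad

end

noncomputable section

namespace RigidOperad

/-! ### Vertices of the interval and the commutative operad -/

section Interval

open scoped Simplicial

/-- The degenerate simplices of `Δ[1]` at the vertices. -/
def intervalVertex (i : Fin 2) (n : SimplexCategoryᵒᵖ) : (Δ[1] : SSet.{v}).obj n :=
  (Δ[1] : SSet.{v}).map (n.unop.const _ 0).op (SSet.stdSimplex.obj₀Equiv.{v}.symm i)

lemma intervalVertex_map (i : Fin 2) {n m : SimplexCategoryᵒᵖ} (φ : n ⟶ m) :
    (Δ[1] : SSet.{v}).map φ (intervalVertex i n) = intervalVertex i m :=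
  (sset_naturality (SSet.const (X := Δ[1]) (SSet.stdSimplex.obj₀Equiv.{v}.symm i)) φ
    (SSet.stdSimplex.const _ 0 n)).symm

end Interval

namespace SimplicialOperad

/-- The commutative operad. -/
def commutative : SimplicialOperad.{v} where
  obj _ _ := 𝟙_ SSet.{v}
  map _ := 𝟙 _
  map_refl _ _ := rfl
  map_trans _ _ := rfl
  one _ := PUnit.unit
  one_map _ := rfl
  comp _ _ := PUnit.unit
  comp_map _ _ _ := rfl
  comp_relabel_left _ _ _ _ _ _ := rfl
  comp_relabel_right _ _ _ _ := rfl
  one_comp _ := rfl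
  comp_one _ := rfl
  assoc _ _ _ := rfl

/-- The map to the commutative operad. -/
def toCommutative (P : SimplicialOperad.{v}) : Hom P commutative where
  app S _ := toUnit (P.obj S)
  app_map _ := toUnit_unique _ _
  app_one _ := rfl
  app_comp _ _ := rfl

/-- The constant family of maps to the commutative operad. -/
def HomFamily.toCommutative (P : SimplicialOperad.{v}) (K : SSet.{v}) :
    HomFamily P commutative K where
  act _ _ := PUnit.unit
  act_simplexMap _ _ _ := rfl
  act_map _ _ _ _ := rfl
  act_one _ := rfl
  act_comp _ _ _ := rfl

end SimplicialOperad

/-! ### The two operads over which the lifting takes place -/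

section Suboperads

open SimplicialSymmetricMonoidal SimplicialOperad Operation
open scoped Simplicial

variable {D : Type u} [Category.{v} D] [MonoidalCategory D] [SymmetricCategory D]
  [SimplicialCategory D]

variable [SimplicialSymmetricMonoidal D]

/-- The evaluation of operations at an enumeration. -/
def endOperadEval (x : D) (S : Type) [Finite S] :
    (endOperad x).obj S ⟶ Map (pow x (enum S).length) x where
  app n := ↾fun a => Operation.ev a (enum S) (isEnum_enum S)
  naturality _ _ _ := rfl

/-- The operations that are given by simplices of `Map(x^{⊗ k}, x)`. -/
def toEndOperad (x : D) (S : Type) [Finite S] :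
    Map (pow x (enum S).length) x ⟶ (endOperad x).obj S where
  app n := ↾fun a => ofEnum (isEnum_enum S) a
  naturality n m φ := ConcreteCategory.hom_ext _ _ fun a => ext_ev (isEnum_enum S) <|
    (ofEnum_ev_self _ _).trans (congrArg ((Map _ x).map φ) (ofEnum_ev_self (isEnum_enum S) a).symm)

/-- An operation is determined by its value at one enumeration. Levelwise lifting problems for
`endOperad x` thereby become lifting problems for `Map(x^{⊗ k}, x)`. -/
lemma endOperadEval_toEndOperad (x : D) (S : Type) [Finite S] :
    endOperadEval x S ≫ toEndOperad x S = 𝟙 _ :=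
  sset_hom_ext fun _ _ => ext_ev (isEnum_enum S) (ofEnum_ev_self _ _)

lemma comp_toEndOperad {A B : SSet.{v}} {x : D} {S : Type} [Finite S] {i : A ⟶ B}
    {w : B ⟶ Map (pow x (enum S).length) x} {u : A ⟶ (endOperad x).obj S}
    (h : i ≫ w = u ≫ endOperadEval x S) : i ≫ w ≫ toEndOperad x S = u := by
  rw [← Category.assoc, h, Category.assoc, endOperadEval_toEndOperad, Category.comp_id]

/-- The suboperad of the endomorphism operad of `y` of those operations that are compatible with
the multiplication of the unit along `j`. -/
def unitSub {y : D} (j : 𝟙_ D ⟶ y) : (endOperad y).Sub where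
  mem {S _ n} b := Compat j (unitOperation D S n) b
  simplexMap φ b h := by
    have := Compat.simplexMap h φ
    have e {S n m} (φ : n ⟶ m) : (unitOperation D S n).simplexMap φ = unitOperation D S m :=
      Operation.ext (by
        funext k l h
        exact sOf_map _ φ)
    rw [e] at this
    exact this
  map e n a h := Compat.relabel h e
  one n := by
    rw [unitOperation_one]
    exact compat_one j
  comp hp hq := by
    rw [← unitOperation_comp]
    exact Compat.comp hp hq

/-- Level `S` of the suboperad is the fiber of `Map(y^{⊗ k}, y) ⟶ Map(I^{⊗ k}, y)` over the vertex
`unitMul D k ≫ j`, and trivial fibrations are stable under base change. -/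
lemma trivialFibration_unitSub {y : D} (j : 𝟙_ D ⟶ y)
    (hj : ∀ k, TrivialFibration (((SimplicialCategory.sHomFunctor D).map (powMap j k).op).app y))
    (S : Type) [Finite S] : TrivialFibration ((unitSub j).toOperad.toCommutative.app S) := by
  refine trivialFibration_of_exists_lift fun Z A u w h => ?_
  let i : (unitSub j).toOperad.obj S ⟶ (endOperad y).obj S :=
    { app := fun n => ↾fun a => a.1
      naturality := fun _ _ _ => rfl }
  let k := (enum S).length
  let c : Z ⟶ Map (pow (𝟙_ D) k) y :=
    { app := fun n => ↾fun _ => sOf (unitMul D k ≫ j) n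
      naturality := fun n m φ => ConcreteCategory.hom_ext _ _ fun _ => (sOf_map _ φ).symm }
  obtain ⟨l, h₁, h₂⟩ := (hj k).exists_lift A.ι (u ≫ i ≫ endOperadEval y S) c
    (sset_hom_ext fun n a => by
      refine ((u.app n a).2 k (enum S) (isEnum_enum S)).symm.trans ?_
      exact (sOf_comp _ _ n).symm)
  refine ⟨
    { app := fun n => ↾fun z => ⟨(toEndOperad y S).app n (l.app n z),
        compat_of_enum (isEnum_enum S) ?_⟩
      naturality := fun n m φ => ConcreteCategory.hom_ext _ _ fun z => Subtype.ext
        (sset_naturality (l ≫ toEndOperad y S) φ z) }, ?_, toUnit_unique _ _⟩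
  · refine Eq.trans ?_ (congrArg (sComp (sOf (powMap j k) n)) (ofEnum_ev_self _ _).symm)
    exact (sOf_comp _ _ n).symm.trans (sset_congr h₂ n z).symm
  · refine sset_hom_ext fun n a => Subtype.ext ?_
    refine (congrArg ((toEndOperad y S).app n) (sset_congr h₁ n a)).trans ?_
    exact sset_congr (endOperadEval_toEndOperad y S) n (u.app n a).1

variable {x y : D} (p : x ⟶ y)

/-- The operad of pairs of an operation on `y` and a path of operations on `x` whose end point is
compatible with the operation on `y`. -/
def arrowSub : ((endOperad y).prod ((endOperad x).power Δ[1])).Sub where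
  mem {S _ n} a := ∀ {m : SimplexCategoryᵒᵖ} (φ : n ⟶ m),
    Compat p (PowerSimplex.app a.2 φ (intervalVertex 1 m)) (((endOperad y).obj S).map φ a.1)
  simplexMap {S _ n m} χ a h l φ := by
    have := h (χ ≫ φ)
    rw [CategoryTheory.Functor.map_comp] at this
    exact this
  map e n a h m φ := Compat.relabel (h φ) e
  one n m φ := by
    exact (congrArg (Compat p (Operation.one x m)) (one_simplexMap φ)).mpr (compat_one p)
  comp {T _ S _ n a b} ha hb m φ := by
    exact (congrArg (Compat p _) (comp_simplexMap φ a.1 fun t => (b t).1)).mpr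
      (Compat.comp (ha φ) fun t => hb t φ)

/-- The starting point of the path of operations. -/
def arrowSubStart : Hom (Sub.toOperad (arrowSub p)) (endOperad x) where
  app S _ :=
    { app := fun n => ↾fun a => PowerSimplex.app a.1.2 (𝟙 n) (intervalVertex 0 n)
      naturality := fun n m φ => ConcreteCategory.hom_ext _ _ fun a => by
        refine Eq.trans ?_ (PowerSimplex.map_app a.1.2 (𝟙 n) φ (intervalVertex 0 n)).symm
        rw [intervalVertex_map, Category.id_comp]
        exact congrArg (fun χ => PowerSimplex.app a.1.2 χ (intervalVertex 0 m)) (Category.comp_id φ) }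
  app_map _ := rfl
  app_one _ := rfl
  app_comp _ _ := rfl

/-- At level `S` a point is an operation in `Map(y^{⊗ k}, y)` and a path in `Map(x^{⊗ k}, x)` whose
end has the same image in `Map(x^{⊗ k}, y)`. Lifting against the start of the path is
`KanFibration.exists_lift_mappingPath` for the weak equivalence `(p^{⊗ k})^*` and the Kan fibration
`p_*`. -/
lemma trivialFibration_arrowSubStart
    (hy : ∀ k, SSet.KanComplex (Map (pow y k) y)) (hxy : ∀ k, SSet.KanComplex (Map (pow x k) y))
    (hp : ∀ k, weakHomotopyEquivalences
      (((SimplicialCategory.sHomFunctor D).map (powMap p k).op).app y))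
    (hp' : ∀ k, KanFibration (((SimplicialCategory.sHomFunctor D).obj (op (pow x k))).map p))
    (S : Type) [Finite S] : TrivialFibration ((arrowSubStart p).app S) := by
  refine trivialFibration_of_exists_lift fun Z A u r h => ?_
  let k := (enum S).length
  have := hy k
  have := hxy k
  let u₁ : (A : SSet.{v}) ⟶ (endOperad y).obj S :=
    { app := fun n => ↾fun a => (u.app n a).1.1
      naturality := fun n m φ => ConcreteCategory.hom_ext _ _ fun a =>
        congrArg (fun b => b.1.1) (sset_naturality u φ a) }
  let u₂ : (A : SSet.{v}) ⟶ RigidOperad.power Δ[1] ((endOperad x).obj S) :=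
    { app := fun n => ↾fun a => (u.app n a).1.2
      naturality := fun n m φ => ConcreteCategory.hom_ext _ _ fun a =>
        congrArg (fun b => b.1.2) (sset_naturality u φ a) }
  obtain ⟨u', w', h₁, h₂, h₃, h₄⟩ := KanFibration.exists_lift_mappingPath (P := Map (pow y k) y)
    (R := Map (pow x k) y) (hp k) (hp' k) A
    (u₁ ≫ endOperadEval y S) (powerEval u₂ ≫ endOperadEval x S)
    (sset_hom_ext fun n a => by
      refine ((u.app n a).2 (𝟙 n) k (enum S) (isEnum_enum S)).trans
        (congrArg (fun b => sComp (sOf (powMap p k) n) (Operation.ev b (enum S) (isEnum_enum S))) ?_)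
      exact (u.app n a).1.1.simplexMap_id)
    (r ≫ endOperadEval x S)
    (sset_hom_ext fun n a => congrArg (fun b => Operation.ev b (enum S) (isEnum_enum S))
      (sset_congr h n a))
  refine ⟨
    { app := fun n => ↾fun z => ⟨((toEndOperad y S).app n (u'.app n z),
        (powerHom (w' ≫ toEndOperad x S)).app n z), fun {m} φ => ?_⟩
      naturality := fun n m φ => ConcreteCategory.hom_ext _ _ fun z => Subtype.ext (Prod.ext
        (sset_naturality (u' ≫ toEndOperad y S) φ z)
        (sset_naturality (powerHom (w' ≫ toEndOperad x S)) φ z)) }, ?_, ?_⟩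
  · refine (congrArg (Compat p _) (sset_naturality (u' ≫ toEndOperad y S) φ z)).mp ?_
    refine compat_of_enum (isEnum_enum S) ?_
    refine (congrArg (fun b => sComp b (sOf p m)) (ofEnum_ev_self _ _)).trans (Eq.trans ?_
      (congrArg (sComp (sOf (powMap p k) m)) (ofEnum_ev_self _ _)).symm)
    exact sset_congr h₃ m (Z.map φ z)
  · refine sset_hom_ext fun n a => Subtype.ext (Prod.ext ?_ (PowerSimplex.ext
      (K := Δ[1]) (Z := (endOperad x).obj S) ?_))
    · refine (congrArg ((toEndOperad y S).app n) (sset_congr h₁ n a)).trans ?_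
      exact sset_congr (endOperadEval_toEndOperad y S) n (u₁.app n a)
    · have e := comp_toEndOperad h₂
      have e' : A.ι ≫ powerHom (w' ≫ toEndOperad x S) = u₂ := by
        rw [← powerHom_powerEval u₂, ← e]
        rfl
      funext m φ t
      exact congrArg (fun b => PowerSimplex.app b φ t) (sset_congr e' n a)
  · refine sset_hom_ext fun n z => ?_
    have e := comp_toEndOperad h₄
    refine Eq.trans ?_ (sset_congr e n z)
    have hz : Z.map (𝟙 n) z = z := ConcreteCategory.congr_hom (Z.map_id n) z
    exact congrArg (fun z => (toEndOperad x S).app n (w'.app n (z, intervalVertex 0 n))) hz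

end Suboperads

end RigidOperad

end

noncomputable section

namespace RigidOperad

/-! ### Contractibility of the spaces of algebra structures -/

section AlgebraSpaces

open SimplicialSymmetricMonoidal SimplicialOperad Operation
open scoped Simplicial

/-- The identity as a simplex of the standard simplex. -/
def idSimplex (n : SimplexCategoryᵒᵖ) : (SSet.stdSimplex.{v}.obj n.unop).obj n :=
  SSet.yonedaEquiv (𝟙 (SSet.stdSimplex.{v}.obj n.unop))

lemma yonedaEquiv_symm_idSimplex {Z : SSet.{v}} {n : SimplexCategoryᵒᵖ} (z : Z.obj n) :
    (SSet.yonedaEquiv.symm z : SSet.stdSimplex.obj n.unop ⟶ Z).app n (idSimplex n) = z :=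
  SSet.yonedaEquiv.apply_symm_apply z

lemma stdSimplex_map_idSimplex {n m : SimplexCategoryᵒᵖ} (φ : n ⟶ m) :
    (SSet.stdSimplex.{v}.map φ.unop).app m (idSimplex m) =
      (SSet.stdSimplex.{v}.obj n.unop).map φ (idSimplex n) :=
  (SSet.yonedaEquiv_naturality φ.unop (𝟙 (SSet.stdSimplex.{v}.obj n.unop))).symm

lemma exists_map_idSimplex {n m : SimplexCategoryᵒᵖ} (s : (SSet.stdSimplex.{v}.obj n.unop).obj m) :
    ∃ φ : n ⟶ m, s = (SSet.stdSimplex.{v}.obj n.unop).map φ (idSimplex n) := by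
  refine ⟨(SSet.stdSimplex.objEquiv s).op, ?_⟩
  have h : s = (SSet.yonedaEquiv.symm (idSimplex n)).app m s := by
    rw [idSimplex, Equiv.symm_apply_apply]
    rfl
  exact h

variable {D : Type u} [Category.{v} D] [MonoidalCategory D] [SymmetricCategory D]
  [SimplicialCategory D] [SimplicialSymmetricMonoidal D] {E : SimplicialOperad.{v}} {x y : D}
  {Z W : SSet.{v}}

namespace AlgebraFamily

/-- The family of algebra structures that corresponds to a map to the space of algebra
structures. -/
def ofMap (u : Z ⟶ algebraSpace E x) : AlgebraFamily E x Z where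
  act k n d e := AlgebraFamily.act (u.app n d) k (idSimplex n) e
  act_map k n m φ d e := by
    refine (AlgebraFamily.act_map (u.app n d) k φ _ _).trans ?_
    refine Eq.trans ?_ (congrArg (fun θ => AlgebraFamily.act θ k (idSimplex m)
      ((E.obj (Fin k)).map φ e)) (sset_naturality u φ d)).symm
    exact congrArg (fun s => AlgebraFamily.act (u.app n d) k s _) (stdSimplex_map_idSimplex φ).symm
  act_one d := AlgebraFamily.act_one (u.app _ d) _
  act_swap k i hi n d e := AlgebraFamily.act_swap (u.app n d) k i hi _ e
  act_comp m n d p q := AlgebraFamily.act_comp (u.app n d) m _ p q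

/-- The map to the space of algebra structures that corresponds to a family of algebra
structures. -/
def toMap (θ : AlgebraFamily E x Z) : Z ⟶ algebraSpace E x where
  app n := ↾fun z => θ.precomp (SSet.yonedaEquiv.symm z)
  naturality n m φ := ConcreteCategory.hom_ext _ _ fun z =>
    congrArg θ.precomp (SSet.yonedaEquiv_symm_naturality_left φ.unop z).symm

/-- A Yoneda argument: every simplex of a standard simplex is the image of `idSimplex` under a
simplicial operator. -/
lemma toMap_ofMap (u : Z ⟶ algebraSpace E x) : (ofMap u).toMap = u :=
  sset_hom_ext fun n z => AlgebraFamily.ext (by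
    funext k m s e
    obtain ⟨φ, rfl⟩ := exists_map_idSimplex s
    have h : (SSet.yonedaEquiv.symm z).app m
        ((SSet.stdSimplex.{v}.obj n.unop).map φ (idSimplex n)) = Z.map φ z :=
      (sset_naturality _ _ _).trans (congrArg (Z.map φ) (yonedaEquiv_symm_idSimplex z))
    refine (congrArg (fun z => (ofMap u).act k z e) h).trans ?_
    refine (congrArg (fun θ => AlgebraFamily.act θ k (idSimplex m) e)
      (sset_naturality u φ z)).trans ?_
    exact congrArg (fun s => AlgebraFamily.act (u.app n z) k s _) (stdSimplex_map_idSimplex φ))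

lemma comp_toMap (f : W ⟶ Z) (θ : AlgebraFamily E x Z) :
    f ≫ θ.toMap = (θ.precomp f).toMap :=
  sset_hom_ext fun n w => congrArg θ.precomp (SSet.yonedaEquiv_symm_comp (n := n.unop) w f).symm

lemma toHomFamily_toAlgebra (θ : AlgebraFamily E x Z) : θ.toHomFamily.toAlgebra = θ :=
  AlgebraFamily.ext (by
    funext k n z e
    exact θ.toHomFamily_act_ev z e)

end AlgebraFamily

lemma unitExtensionSpace_hom_ext {j : 𝟙_ D ⟶ y} {u w : Z ⟶ unitExtensionSpace E j}
    (h : u ≫ unitExtensionSpaceToAlgebraSpace E j = w ≫ unitExtensionSpaceToAlgebraSpace E j) :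
    u = w :=
  sset_hom_ext fun n z => UnitExtension.ext (sset_congr h n z)

/-- The map to the space of extensions that corresponds to a family of extensions. -/
def UnitExtension.toMap {j : 𝟙_ D ⟶ y} (θ : UnitExtension E j Z) : Z ⟶ unitExtensionSpace E j where
  app n := ↾fun z =>
    { algebra := θ.algebra.toMap.app n z
      comm := fun k _ _ e => θ.comm k _ e }
  naturality n m φ := ConcreteCategory.hom_ext _ _ fun z => UnitExtension.ext
    (sset_naturality θ.algebra.toMap φ z)

/-- A map from `Z` to the space of extensions is a `Z`-family of operad maps from `E` to `unitSub
j`. Extending it from a subcomplex `A` is a lifting problem against the trivial fibration to the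
commutative operad, which is solvable as `E` is cofibrant. -/
theorem contractible_unitExtensionSpace (hE : E.IsCofibrant) (j : 𝟙_ D ⟶ y)
    (hj : ∀ k, TrivialFibration (((SimplicialCategory.sHomFunctor D).map (powMap j k).op).app y)) :
    Contractible (unitExtensionSpace E j) := by
  refine contractible_of_trivialFibration (trivialFibration_of_exists_lift fun Z A u w _ => ?_)
  let θ := AlgebraFamily.ofMap (u ≫ unitExtensionSpaceToAlgebraSpace E j)
  have hθ (k : ℕ) {n : SimplexCategoryᵒᵖ} (d : (A : SSet.{v}).obj n) (e : (E.obj (Fin k)).obj n) :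
    sOf (unitMul D k ≫ j) n = sComp (sOf (powMap j k) n) (θ.act k d e) :=
    UnitExtension.comm (u.app n d) k _ e
  let a : HomFamily E (Sub.toOperad (unitSub j)) (A : SSet.{v}) :=
    { act := fun d e => ⟨θ.toHomFamily.act d e, fun k l h =>
        (sOf_comp _ _ _).symm.trans (hθ k d _)⟩
      act_simplexMap := fun φ d e => Subtype.ext (θ.toHomFamily.act_simplexMap φ d e)
      act_map := fun σ _ d e => Subtype.ext (θ.toHomFamily.act_map σ d e)
      act_one := fun d => Subtype.ext (θ.toHomFamily.act_one d)
      act_comp := fun d p q => Subtype.ext (θ.toHomFamily.act_comp d p q) }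
  obtain ⟨c, hc, -⟩ := hE.exists_lift (Sub.toOperad (unitSub j)).toCommutative
    (trivialFibration_unitSub j hj) A a (HomFamily.toCommutative E Z) (fun _ _ => rfl)
  let c' : HomFamily E (endOperad y) Z :=
    { act := fun d e => (c.act d e).1
      act_simplexMap := fun φ d e => congrArg Subtype.val (c.act_simplexMap φ d e)
      act_map := fun σ _ d e => congrArg Subtype.val (c.act_map σ d e)
      act_one := fun d => congrArg Subtype.val (c.act_one d)
      act_comp := fun d p q => congrArg Subtype.val (c.act_comp d p q) }
  let l : UnitExtension E j Z :=
    { algebra := c'.toAlgebra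
      comm := fun k n d e => (sOf_comp _ _ _).trans ((c.act d e).2 k _ (isEnum_finRange k)) }
  refine ⟨l.toMap, unitExtensionSpace_hom_ext ?_, toUnit_unique _ _⟩
  have h : c'.toAlgebra.precomp A.ι = θ := by
    rw [← θ.toHomFamily_toAlgebra]
    exact AlgebraFamily.ext (by
      funext k n d e
      exact congrArg (fun b => Operation.ev b.1 _ (isEnum_finRange k)) (hc d e))
  refine (AlgebraFamily.comp_toMap A.ι c'.toAlgebra).trans ?_
  rw [h, AlgebraFamily.toMap_ofMap]

/-- The restriction of algebra structures on a morphism to the target. -/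
def arrowAlgebraSpaceTarget (E : SimplicialOperad.{v}) (p : x ⟶ y) :
    arrowAlgebraSpace E p ⟶ algebraSpace E y where
  app _ := ↾fun θ => ArrowAlgebraFamily.target θ
  naturality _ _ _ := rfl

lemma arrowAlgebraSpace_hom_ext {p : x ⟶ y} {u w : Z ⟶ arrowAlgebraSpace E p}
    (h : u ≫ arrowAlgebraSpaceSource E p = w ≫ arrowAlgebraSpaceSource E p)
    (h' : u ≫ arrowAlgebraSpaceTarget E p = w ≫ arrowAlgebraSpaceTarget E p) : u = w :=
  sset_hom_ext fun n z => ArrowAlgebraFamily.ext (sset_congr h n z) (sset_congr h' n z)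

/-- The map to the space of algebra structures on a morphism that corresponds to a family. -/
def ArrowAlgebraFamily.toMap {p : x ⟶ y} (θ : ArrowAlgebraFamily E p Z) :
    Z ⟶ arrowAlgebraSpace E p where
  app n := ↾fun z =>
    { source := θ.source.toMap.app n z
      target := θ.target.toMap.app n z
      comm := fun k _ _ e => θ.comm k _ e }
  naturality n m φ := ConcreteCategory.hom_ext _ _ fun z => ArrowAlgebraFamily.ext
    (sset_naturality θ.source.toMap φ z) (sset_naturality θ.target.toMap φ z)

/-! ### Maps to iterated pullbacks -/

section IteratedPullback

variable {C : Type*} [Category* C] [HasPullbacks C] {A B P T : C} (f : A ⟶ B) (s e : P ⟶ B)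
  (c : T ⟶ B)

/-- The projection of an iterated pullback to the middle factor. -/
def iteratedPullbackMid : pullback f (pullback.fst s c ≫ e) ⟶ P :=
  pullback.snd _ _ ≫ pullback.fst _ _

lemma iteratedPullbackMid_comp_right :
    iteratedPullbackMid f s e c ≫ e = pullback.fst _ _ ≫ f := by
  rw [pullback.condition, iteratedPullbackMid, Category.assoc]

lemma iteratedPullbackMid_comp_left :
    iteratedPullbackMid f s e c ≫ s = (pullback.snd _ _ ≫ pullback.snd _ _) ≫ c := by
  rw [iteratedPullbackMid, Category.assoc, Category.assoc, pullback.condition]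

lemma iteratedPullback_hom_ext {Z : C} {u w : Z ⟶ pullback f (pullback.fst s c ≫ e)}
    (h : u ≫ pullback.fst _ _ = w ≫ pullback.fst _ _)
    (h' : u ≫ iteratedPullbackMid f s e c = w ≫ iteratedPullbackMid f s e c)
    (ht : ∀ t t' : Z ⟶ T, t = t') : u = w := by
  refine pullback.hom_ext h (pullback.hom_ext ?_ (ht _ _))
  rw [Category.assoc, Category.assoc]
  exact h'

lemma exists_iteratedPullback_lift {Z : C} (g : Z ⟶ A) (γ : Z ⟶ P) (t : Z ⟶ T)
    (h : γ ≫ e = g ≫ f) (h' : γ ≫ s = t ≫ c) :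
    ∃ u : Z ⟶ pullback f (pullback.fst s c ≫ e),
      u ≫ pullback.fst _ _ = g ∧ u ≫ iteratedPullbackMid f s e c = γ :=
  ⟨pullback.lift g (pullback.lift γ t h') (by rw [pullback.lift_fst_assoc, h]),
    pullback.lift_fst _ _ _, by rw [iteratedPullbackMid, pullback.lift_snd_assoc, pullback.lift_fst]⟩

end IteratedPullback

/-! ### Maps to homotopy fibers as homotopies -/

section HomotopyFiber

variable {A B : SSet.{v}} (f : A ⟶ B) (b : B _⦋0⦌)

/-- The projection from the homotopy fiber. -/
def homotopyFiberFst : homotopyFiber f b ⟶ A := pullback.fst _ _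

/-- The path part of a map to a homotopy fiber. -/
def homotopyFiberPath (u : Z ⟶ homotopyFiber f b) : Z ⊗ Δ[1] ⟶ B :=
  (pathEquiv Z B).symm
    (u ≫ iteratedPullbackMid f (pathStart B) (pathEnd B) ((SSet.unitHomEquiv B).symm b))

lemma ι₁_homotopyFiberPath (u : Z ⟶ homotopyFiber f b) :
    SSet.ι₁ ≫ homotopyFiberPath f b u = (u ≫ homotopyFiberFst f b) ≫ f :=
  (ι₁_pathEquiv_symm _).trans <| (Category.assoc _ _ _).trans <|
    (congrArg (u ≫ ·) (iteratedPullbackMid_comp_right f _ _ _)).trans (Category.assoc _ _ _).symm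

lemma ι₀_homotopyFiberPath (u : Z ⟶ homotopyFiber f b) :
    SSet.ι₀ ≫ homotopyFiberPath f b u = toUnit Z ≫ (SSet.unitHomEquiv B).symm b :=
  (ι₀_pathEquiv_symm _).trans <| (Category.assoc _ _ _).trans <|
    (congrArg (u ≫ ·) (iteratedPullbackMid_comp_left f _ _ _)).trans <|
    (Category.assoc _ _ _).symm.trans (congrArg (· ≫ _) (toUnit_unique _ _))

variable {f b} in
lemma homotopyFiber_hom_ext {u w : Z ⟶ homotopyFiber f b}
    (h : u ≫ homotopyFiberFst f b = w ≫ homotopyFiberFst f b)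
    (h' : homotopyFiberPath f b u = homotopyFiberPath f b w) : u = w :=
  iteratedPullback_hom_ext f _ _ _ h ((pathEquiv Z B).symm.injective h')
    fun _ _ => toUnit_unique _ _

lemma exists_homotopyFiber_lift (g : Z ⟶ A) (γ : Z ⊗ Δ[1] ⟶ B) (h : SSet.ι₁ ≫ γ = g ≫ f)
    (h' : SSet.ι₀ ≫ γ = toUnit Z ≫ (SSet.unitHomEquiv B).symm b) :
    ∃ u : Z ⟶ homotopyFiber f b, u ≫ homotopyFiberFst f b = g ∧ homotopyFiberPath f b u = γ := by
  obtain ⟨u, h₁, h₂⟩ := exists_iteratedPullback_lift f (pathStart B) (pathEnd B)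
    ((SSet.unitHomEquiv B).symm b) g (pathEquiv Z B γ) (toUnit Z)
    ((pathEquiv_pathEnd γ).trans h) ((pathEquiv_pathStart γ).trans h')
  exact ⟨u, h₁, (congrArg _ h₂).trans (Equiv.symm_apply_apply _ _)⟩

lemma comp_homotopyFiberPath (i : W ⟶ Z) (u : Z ⟶ homotopyFiber f b) :
    i ▷ _ ≫ homotopyFiberPath f b u = homotopyFiberPath f b (i ≫ u) :=
  (pathEquiv_symm_naturality i _).symm.trans (congrArg _ (Category.assoc _ _ _).symm)

end HomotopyFiber

/-- A map from `Z` to the homotopy fiber consists of a `Z`-family of structures on `p` and a path of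
structures on `x` from `θ` to its source. The source is the end of the path, so this is a `Z`-family
of operad maps to `arrowSub p` whose start is constant at `θ`. Such families extend from
subcomplexes by `trivialFibration_arrowSubStart`. -/
theorem contractible_homotopyFiber (hE : E.IsCofibrant) (p : x ⟶ y)
    (hy : ∀ k, SSet.KanComplex (Map (pow y k) y)) (hxy : ∀ k, SSet.KanComplex (Map (pow x k) y))
    (hp : ∀ k, weakHomotopyEquivalences
      (((SimplicialCategory.sHomFunctor D).map (powMap p k).op).app y))
    (hp' : ∀ k, KanFibration (((SimplicialCategory.sHomFunctor D).obj (op (pow x k))).map p))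
    (θ : (algebraSpace E x) _⦋0⦌) :
    Contractible (homotopyFiber (arrowAlgebraSpaceSource E p) θ) := by
  refine contractible_of_trivialFibration (trivialFibration_of_exists_lift fun Z A u w _ => ?_)
  let g := u ≫ homotopyFiberFst _ _
  let γ := homotopyFiberPath _ _ u
  let τ := AlgebraFamily.ofMap (g ≫ arrowAlgebraSpaceTarget E p)
  let ρ := AlgebraFamily.ofMap γ
  have hγ : SSet.ι₁ ≫ γ = g ≫ arrowAlgebraSpaceSource E p := ι₁_homotopyFiberPath _ _ u
  have hγ' : SSet.ι₀ ≫ γ = toUnit _ ≫ (SSet.unitHomEquiv _).symm θ := ι₀_homotopyFiberPath _ _ u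
  let θ' := AlgebraFamily.ofMap (toUnit Z ≫ (SSet.unitHomEquiv _).symm θ)
  have hρ₁ : ρ.precomp SSet.ι₁ = AlgebraFamily.ofMap (g ≫ arrowAlgebraSpaceSource E p) := by
    rw [← hγ]
    rfl
  have hρ₀ : ρ.precomp SSet.ι₀ = θ'.precomp A.ι := congrArg AlgebraFamily.ofMap hγ'
  have hcomm {S : Type} [Finite S] {n : SimplexCategoryᵒᵖ} (d : (A : SSet.{v}).obj n)
      (e : (E.obj S).obj n) : Compat p (ρ.toHomFamily.act (d, intervalVertex 1 n) e)
        (τ.toHomFamily.act d e) := fun k l h => by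
    refine (congrArg (fun θ => sComp (AlgebraFamily.act θ k d _) (sOf p n)) hρ₁).trans ?_
    exact ArrowAlgebraFamily.comm (g.app n d) k (idSimplex n) _
  -- The targets `τ` and the paths `ρ` over `A` are packed into one family. Membership in `arrowSub`
  -- is `hcomm`: at the vertex `1` of the interval, `ρ` is the source structure.
  let a : HomFamily E (Sub.toOperad (arrowSub p)) (A : SSet.{v}) :=
    { act := fun {S _ n} d e => ⟨(τ.toHomFamily.act d e,
          { app := fun {m} φ t => ρ.toHomFamily.act ((A : SSet.{v}).map φ d, t) ((E.obj S).map φ e)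
            map_app := fun φ ψ t => by
              refine (ρ.toHomFamily.act_simplexMap ψ _ _).trans ?_
              rw [CategoryTheory.Functor.map_comp, CategoryTheory.Functor.map_comp]
              rfl }), fun {m} φ => by
          refine (congrArg (Compat p _) (τ.toHomFamily.act_simplexMap φ d e)).mpr ?_
          exact hcomm _ _⟩
      act_simplexMap := fun {S _ n m} φ d e => Subtype.ext (Prod.ext
        (τ.toHomFamily.act_simplexMap φ d e)
        (PowerSimplex.ext (K := Δ[1]) (Z := (endOperad x).obj S) (by
          funext l ψ t
          refine congrArg₂ (fun d e => ρ.toHomFamily.act (S := S) (d, t) e) ?_ ?_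
          · exact ConcreteCategory.congr_hom ((A : SSet.{v}).map_comp φ ψ) d
          · exact ConcreteCategory.congr_hom ((E.obj S).map_comp φ ψ) e)))
      act_map := fun {S T _ _} σ _ d e => Subtype.ext (Prod.ext
        (τ.toHomFamily.act_map σ d e)
        (PowerSimplex.ext (K := Δ[1]) (Z := (endOperad x).obj T) (by
          funext l ψ t
          exact (congrArg (ρ.toHomFamily.act _) (E.map_app_map σ ψ e)).trans
            (ρ.toHomFamily.act_map σ _ _))))
      act_one := fun d => Subtype.ext (Prod.ext
        (τ.toHomFamily.act_one d)
        (PowerSimplex.ext (K := Δ[1]) (Z := (endOperad x).obj Unit) (by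
          funext l ψ t
          exact (congrArg (ρ.toHomFamily.act _) (E.one_map ψ)).trans (ρ.toHomFamily.act_one _))))
      act_comp := fun {T _ S _ _} d b q => Subtype.ext (Prod.ext
        (τ.toHomFamily.act_comp d b q)
        (PowerSimplex.ext (K := Δ[1]) (Z := (endOperad x).obj (Σ t, S t)) (by
          funext l ψ t
          exact (congrArg (ρ.toHomFamily.act _) (E.comp_map ψ b q)).trans
            (ρ.toHomFamily.act_comp _ _ _)))) }
  obtain ⟨c, hc, hc'⟩ := hE.exists_lift (arrowSubStart p)
    (trivialFibration_arrowSubStart p hy hxy hp hp') A a θ'.toHomFamily (fun {S _ n} d e => by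
      have h₁ : (A : SSet.{v}).map (𝟙 n) d = d :=
        ConcreteCategory.congr_hom ((A : SSet.{v}).map_id n) d
      have h₂ : (E.obj S).map (𝟙 n) e = e := ConcreteCategory.congr_hom ((E.obj S).map_id n) e
      refine (congrArg₂ (fun d e => ρ.toHomFamily.act (S := S) (d, intervalVertex 0 n) e)
        h₁ h₂).trans ?_
      exact congrArg (fun θ => (AlgebraFamily.toHomFamily θ).act d e) hρ₀)
  let c₁ : HomFamily E (endOperad y) Z :=
    { act := fun d e => (c.act d e).1.1
      act_simplexMap := fun φ d e => congrArg (fun b => b.1.1) (c.act_simplexMap φ d e)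
      act_map := fun σ _ d e => congrArg (fun b => b.1.1) (c.act_map σ d e)
      act_one := fun d => congrArg (fun b => b.1.1) (c.act_one d)
      act_comp := fun d p q => congrArg (fun b => b.1.1) (c.act_comp d p q) }
  let c₂ : HomFamily E (endOperad x) (Z ⊗ Δ[1]) :=
    { act := fun {S _ n} d e => PowerSimplex.app (c.act d.1 e).1.2 (𝟙 n) d.2
      act_simplexMap := fun {S _ n m} φ d e => by
        refine (PowerSimplex.map_app (c.act d.1 e).1.2 (𝟙 n) φ d.2).trans ?_
        refine Eq.trans ?_ (congrArg (fun b => PowerSimplex.app b.1.2 (𝟙 m)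
          ((Δ[1] : SSet.{v}).map φ d.2)) (c.act_simplexMap φ d.1 e))
        exact congrArg (fun χ => PowerSimplex.app (c.act d.1 e).1.2 χ ((Δ[1] : SSet.{v}).map φ d.2))
          ((Category.id_comp φ).trans (Category.comp_id φ).symm)
      act_map := fun σ n d e =>
        congrArg (fun b => PowerSimplex.app b.1.2 (𝟙 n) d.2) (c.act_map σ d.1 e)
      act_one := fun {n} d => congrArg (fun b => PowerSimplex.app b.1.2 (𝟙 n) d.2) (c.act_one d.1)
      act_comp := fun {_ _ _ _ n} d p q =>
        congrArg (fun b => PowerSimplex.app b.1.2 (𝟙 n) d.2) (c.act_comp d.1 p q) }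
  -- The source structure is recovered as the end of the path.
  let l : ArrowAlgebraFamily E p Z :=
    { source := c₂.toAlgebra.precomp SSet.ι₁
      target := c₁.toAlgebra
      comm := fun k n d e => by
        refine ((c.act d e).2 (𝟙 n) k _ (isEnum_finRange k)).trans
          (congrArg (fun b => sComp (sOf (powMap p k) n) (Operation.ev b _ (isEnum_finRange k))) ?_)
        exact (c.act d e).1.1.simplexMap_id }
  have hc₁ : c₁.toAlgebra.precomp A.ι = τ := by
    rw [← τ.toHomFamily_toAlgebra]
    exact AlgebraFamily.ext (by
      funext k n d e
      exact congrArg (fun b => Operation.ev b.1.1 _ (isEnum_finRange k)) (hc d e))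
  have hc₂ : c₂.toAlgebra.precomp (A.ι ▷ Δ[1]) = ρ := by
    rw [← ρ.toHomFamily_toAlgebra]
    exact AlgebraFamily.ext (by
      funext k n d e
      have h₁ : (A : SSet.{v}).map (𝟙 n) d.1 = d.1 :=
        ConcreteCategory.congr_hom ((A : SSet.{v}).map_id n) d.1
      have h₂ : (E.obj (Fin k)).map (𝟙 n) e = e :=
        ConcreteCategory.congr_hom ((E.obj (Fin k)).map_id n) e
      refine (congrArg (fun b => Operation.ev (PowerSimplex.app b.1.2 (𝟙 n) d.2) _
        (isEnum_finRange k)) (hc d.1 e)).trans ?_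
      exact congrArg₂ (fun b e => Operation.ev (ρ.toHomFamily.act (b, d.2) e) _ (isEnum_finRange k))
        h₁ h₂)
  have hc₀ : c₂.toAlgebra.precomp SSet.ι₀ = θ' := by
    rw [← θ'.toHomFamily_toAlgebra]
    exact AlgebraFamily.ext (by
      funext k n d e
      exact congrArg (fun b => Operation.ev b _ (isEnum_finRange k)) (hc' d e))
  obtain ⟨v, hv, hv'⟩ := exists_homotopyFiber_lift (arrowAlgebraSpaceSource E p) θ l.toMap
    c₂.toAlgebra.toMap (AlgebraFamily.comp_toMap _ _)
    ((AlgebraFamily.comp_toMap _ _).trans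
      ((congrArg AlgebraFamily.toMap hc₀).trans (AlgebraFamily.toMap_ofMap _)))
  refine ⟨v, homotopyFiber_hom_ext ?_ ?_, toUnit_unique _ _⟩
  · rw [Category.assoc, hv]
    refine arrowAlgebraSpace_hom_ext ?_ ?_
    · refine (AlgebraFamily.comp_toMap A.ι (c₂.toAlgebra.precomp SSet.ι₁)).trans ?_
      refine Eq.trans ?_ (AlgebraFamily.toMap_ofMap (g ≫ arrowAlgebraSpaceSource E p))
      rw [← hρ₁, ← hc₂]
      rfl
    · refine (AlgebraFamily.comp_toMap A.ι c₁.toAlgebra).trans ?_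
      rw [hc₁]
      exact AlgebraFamily.toMap_ofMap _
  · refine (comp_homotopyFiberPath _ _ A.ι v).symm.trans ?_
    refine (congrArg (A.ι ▷ _ ≫ ·) hv').trans ?_
    refine (AlgebraFamily.comp_toMap _ _).trans ?_
    rw [hc₂]
    exact AlgebraFamily.toMap_ofMap _

end AlgebraSpaces

end RigidOperad

end

noncomputable section
namespace RigidOperad

/-! ### Comparing derived functors with their point-set models -/

section Derived

open scoped Prod

lemma isIso_of_isIso_comp_comp {C : Type*} [Category* C] {a b c d : C} (f : a ⟶ b) (g : b ⟶ c)
    (h : c ⟶ d) [IsIso f] [IsIso h] [IsIso (f ≫ g ≫ h)] : IsIso g := by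
  have h1 : IsIso (g ≫ h) := IsIso.of_isIso_comp_left f (g ≫ h)
  exact IsIso.of_isIso_comp_right g h

/-- Invertibility of restriction along a morphism depends only on the isomorphism class of the
morphism and of the target object. -/
lemma isIso_prod_map_of_arrow {C H : Type*} [Category* C] [Category* H] (R : Cᵒᵖ × C ⥤ H)
    {a b a' b' z z' : C} (f : a ⟶ b) (t : a' ⟶ b') (u : a ≅ a') (w : b' ≅ b)
    (hf : f = u.hom ≫ t ≫ w.hom) (e : z ≅ z') (h : IsIso (R.map (f.op ×ₘ 𝟙 z))) :
    IsIso (R.map (t.op ×ₘ 𝟙 z')) := by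
  have h1 : R.map (f.op ×ₘ 𝟙 z) =
      R.map (w.hom.op ×ₘ e.hom) ≫ R.map (t.op ×ₘ 𝟙 z') ≫ R.map (u.hom.op ×ₘ e.inv) := by
    rw [← R.map_comp, ← R.map_comp]
    congr 1
    ext <;> simp [hf]
  rw [h1] at h
  have h2 : IsIso (w.hom.op ×ₘ e.hom) := by
    rw [isIso_prod_iff]
    exact ⟨inferInstanceAs (IsIso w.hom.op), inferInstanceAs (IsIso e.hom)⟩
  have h3 : IsIso (u.hom.op ×ₘ e.inv) := by
    rw [isIso_prod_iff]
    exact ⟨inferInstanceAs (IsIso u.hom.op), inferInstanceAs (IsIso e.inv)⟩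
  exact isIso_of_isIso_comp_comp (R.map (w.hom.op ×ₘ e.hom)) _ (R.map (u.hom.op ×ₘ e.inv))

variable {D : Type u} [Category.{v} D] [MonoidalCategory D] [SymmetricCategory D]
  [ModelCategory D] [SimplicialCategory D] [OperadicModelCategory D]

/-- The comparison of the derived mapping space functor with the mapping space functor. -/
def rMapIso : BifibrantObject.toHoCat.op.prod BifibrantObject.toHoCat ⋙ RMap D ≅ mapFunctor D :=
  Localization.fac (mapFunctor D) mapFunctor_inverts _

/-- The comparison of the derived tensor product functor with the tensor product functor. -/
def lTensorBifibrantIso :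
    BifibrantObject.toHoCat.prod BifibrantObject.toHoCat ⋙ LTensor D ≅ tensorFunctor D :=
  Localization.fac (tensorFunctor D) tensorFunctor_inverts _

lemma mapFunctor_map_left {a b : BifibrantObject D} (g : a ⟶ b) (w : BifibrantObject D) :
    (mapFunctor D).map (g.op ×ₘ 𝟙 w) =
      toHoSpace.map (((SimplicialCategory.sHomFunctor D).map g.hom.op).app w.obj) := by
  refine congrArg toHoSpace.map ?_
  refine Eq.trans (congrArg (fun k => (((SimplicialCategory.sHomFunctor D).map g.hom.op).app w.obj)
    ≫ k) (CategoryTheory.Functor.map_id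
      ((SimplicialCategory.sHomFunctor D).obj (op a.obj)) w.obj)) (Category.comp_id _)

lemma isIso_rMap_toHoCat {a b : BifibrantObject D} (g : a ⟶ b) (w : BifibrantObject D)
    (h : IsIso ((RMap D).map ((BifibrantObject.toHoCat.map g).op ×ₘ
      𝟙 (BifibrantObject.toHoCat.obj w)))) :
    IsIso (toHoSpace.map (((SimplicialCategory.sHomFunctor D).map g.hom.op).app w.obj)) := by
  have h1 : IsIso ((mapFunctor D).map (g.op ×ₘ 𝟙 w)) :=
    (NatIso.isIso_map_iff (rMapIso (D := D)) (X := (op b, w)) (Y := (op a, w)) (g.op ×ₘ 𝟙 w)).1 h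
  have h2 := mapFunctor_map_left g w
  exact h2 ▸ h1

/-- The derived mapping spaces use bifibrant resolutions. The source and target of `g` are compared
with theirs by `isIso_map_left`, and `y`, being already fibrant, with its own by `isIso_map_right`.
-/
lemma isIso_toHoSpace_of_isIso_rMap {a b y : CofibrantObject D} (g : a ⟶ b) [IsFibrant y.obj]
    (h : IsIso ((RMap D).map (((toHo D).map g).op ×ₘ 𝟙 ((toHo D).obj y)))) :
    IsIso (toHoSpace.map (((SimplicialCategory.sHomFunctor D).map g.hom.op).app y.obj)) := by
  have h0 := isIso_rMap_toHoCat (CofibrantObject.bifibrantResolutionMap g)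
    (CofibrantObject.bifibrantResolutionObj y) h
  have ha : IsCofibrant a.obj := a.2
  have hb : IsCofibrant b.obj := b.2
  have hy : IsCofibrant y.obj := y.2
  let w : BifibrantObject D := CofibrantObject.bifibrantResolutionObj y
  let ra : BifibrantObject D := CofibrantObject.bifibrantResolutionObj a
  let rb : BifibrantObject D := CofibrantObject.bifibrantResolutionObj b
  let ia : a.obj ⟶ ra.obj := (CofibrantObject.iBifibrantResolutionObj a).hom
  let ib : b.obj ⟶ rb.obj := (CofibrantObject.iBifibrantResolutionObj b).hom
  let iy : y.obj ⟶ w.obj := (CofibrantObject.iBifibrantResolutionObj y).hom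
  let r : ra.obj ⟶ rb.obj := (CofibrantObject.bifibrantResolutionMap g).hom
  have hia : WeakEquivalence ia :=
    inferInstanceAs (WeakEquivalence (CofibrantObject.iBifibrantResolutionObj a).hom)
  have hib : WeakEquivalence ib :=
    inferInstanceAs (WeakEquivalence (CofibrantObject.iBifibrantResolutionObj b).hom)
  have hiy : WeakEquivalence iy :=
    inferInstanceAs (WeakEquivalence (CofibrantObject.iBifibrantResolutionObj y).hom)
  have hr : ia ≫ r = g.hom ≫ ib :=
    congrArg (fun k => k.hom) (CofibrantObject.bifibrantResolutionMap_fac g)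
  let G (z : D) : Dᵒᵖ ⥤ HoSpace.{v} := (SimplicialCategory.sHomFunctor D).flip.obj z ⋙ toHoSpace
  have h1 : IsIso ((G w.obj).map ia.op) := isIso_map_left w.obj ia
  have h2 : IsIso ((G w.obj).map ib.op) := isIso_map_left w.obj ib
  have h3 : IsIso ((G w.obj).map r.op) := h0
  have h4 : (G w.obj).map r.op ≫ (G w.obj).map ia.op =
      (G w.obj).map ib.op ≫ (G w.obj).map g.hom.op := by
    rw [← (G w.obj).map_comp, ← (G w.obj).map_comp, ← op_comp, ← op_comp, hr]
  have h5 : IsIso ((G w.obj).map g.hom.op) := by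
    have : IsIso ((G w.obj).map ib.op ≫ (G w.obj).map g.hom.op) := by
      rw [← h4]; infer_instance
    exact IsIso.of_isIso_comp_left ((G w.obj).map ib.op) _
  -- Restriction along `g` is now invertible with values in the resolution `w` of `y`; `τ`
  -- transports this back to `y`.
  let τ : G y.obj ⟶ G w.obj :=
    Functor.whiskerRight ((SimplicialCategory.sHomFunctor D).flip.map iy) toHoSpace
  have h6 : IsIso (τ.app (op a.obj)) := isIso_map_right a.obj iy
  have h7 : IsIso (τ.app (op b.obj)) := isIso_map_right b.obj iy
  have h8 : IsIso ((G y.obj).map g.hom.op ≫ τ.app (op a.obj)) := by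
    rw [τ.naturality]; infer_instance
  exact IsIso.of_isIso_comp_right ((G y.obj).map g.hom.op) (τ.app (op a.obj))

/-- The tensor product of cofibrant objects. -/
def cofibrantTensor (a b : CofibrantObject D) : CofibrantObject D :=
  ⟨a.obj ⊗ b.obj, @isCofibrant_tensor D _ _ _ _ _ _ a.obj b.obj a.2 b.2⟩

/-- The tensor product of morphisms of cofibrant objects. -/
def cofibrantTensorMap {a b a' b' : CofibrantObject D} (f : a ⟶ a') (g : b ⟶ b') :
    cofibrantTensor a b ⟶ cofibrantTensor a' b' :=
  ⟨f.hom ⊗ₘ g.hom⟩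

lemma cofibrantTensorMap_comp {a b a' b' a'' b'' : CofibrantObject D} (f : a ⟶ a') (g : b ⟶ b')
    (f' : a' ⟶ a'') (g' : b' ⟶ b'') :
    cofibrantTensorMap f g ≫ cofibrantTensorMap f' g' = cofibrantTensorMap (f ≫ f') (g ≫ g') :=
  ObjectProperty.hom_ext _ (MonoidalCategory.tensorHom_comp_tensorHom f.hom g.hom f'.hom g'.hom)

instance isIso_toHo_map {a b : CofibrantObject D} (f : a ⟶ b) [WeakEquivalence f] :
    IsIso ((toHo D).map f) :=
  inferInstanceAs (IsIso (BifibrantObject.toHoCat.map (CofibrantObject.bifibrantResolutionMap f)))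

lemma weakEquivalence_tensorHom {x y x' y' : D} [IsCofibrant y] [IsCofibrant x'] (f : x ⟶ x')
    (g : y ⟶ y') [WeakEquivalence f] [WeakEquivalence g] : WeakEquivalence (f ⊗ₘ g) := by
  have h1 : WeakEquivalence (f ▷ y) := TensorModelCategory.whiskerRight_weakEquivalence y f
  have h2 : WeakEquivalence (x' ◁ g) := TensorModelCategory.whiskerLeft_weakEquivalence x' g
  rw [MonoidalCategory.tensorHom_def]
  infer_instance

/-- The map from a tensor product of cofibrant objects to the tensor product of their bifibrant
resolutions. -/
def resolutionTensor (a b : CofibrantObject D) :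
    cofibrantTensor a b ⟶ cofibrantTensor
      (BifibrantObject.ιCofibrantObject.obj (CofibrantObject.bifibrantResolutionObj a))
      (BifibrantObject.ιCofibrantObject.obj (CofibrantObject.bifibrantResolutionObj b)) :=
  cofibrantTensorMap (CofibrantObject.iBifibrantResolutionObj a)
    (CofibrantObject.iBifibrantResolutionObj b)

instance (a b : CofibrantObject D) : WeakEquivalence (resolutionTensor a b) := by
  rw [weakEquivalence_iff_of_objectProperty]
  have := b.2
  have := (CofibrantObject.bifibrantResolutionObj a).2.1
  exact weakEquivalence_tensorHom (CofibrantObject.iBifibrantResolutionObj a).hom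
    (CofibrantObject.iBifibrantResolutionObj b).hom

/-- The derived tensor product of cofibrant objects is represented by their tensor product. -/
def lTensorIso (a b : CofibrantObject D) :
    (LTensor D).obj ((toHo D).obj a, (toHo D).obj b) ≅ (toHo D).obj (cofibrantTensor a b) :=
  lTensorBifibrantIso.app (CofibrantObject.bifibrantResolutionObj a,
    CofibrantObject.bifibrantResolutionObj b) ≪≫ (asIso ((toHo D).map (resolutionTensor a b))).symm

lemma resolutionTensor_naturality {a b a' b' : CofibrantObject D} (f : a ⟶ a') (g : b ⟶ b') :
    resolutionTensor a b ≫ cofibrantTensorMap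
      (BifibrantObject.ιCofibrantObject.map (CofibrantObject.bifibrantResolutionMap f))
      (BifibrantObject.ιCofibrantObject.map (CofibrantObject.bifibrantResolutionMap g)) =
      cofibrantTensorMap f g ≫ resolutionTensor a' b' := by
  refine (cofibrantTensorMap_comp _ _ _ _).trans (Eq.trans ?_ (cofibrantTensorMap_comp _ _ _ _).symm)
  exact congrArg₂ cofibrantTensorMap (CofibrantObject.bifibrantResolutionMap_fac f)
    (CofibrantObject.bifibrantResolutionMap_fac g)

lemma lTensorIso_naturality {a b a' b' : CofibrantObject D} (f : a ⟶ a') (g : b ⟶ b') :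
    (LTensor D).map ((toHo D).map f ×ₘ (toHo D).map g) ≫ (lTensorIso a' b').hom =
      (lTensorIso a b).hom ≫ (toHo D).map (cofibrantTensorMap f g) := by
  have h1 := (lTensorBifibrantIso (D := D)).hom.naturality
    (CofibrantObject.bifibrantResolutionMap f ×ₘ CofibrantObject.bifibrantResolutionMap g)
  have h2 : (toHo D).map (cofibrantTensorMap
      (BifibrantObject.ιCofibrantObject.map (CofibrantObject.bifibrantResolutionMap f))
      (BifibrantObject.ιCofibrantObject.map (CofibrantObject.bifibrantResolutionMap g))) ≫
        inv ((toHo D).map (resolutionTensor a' b')) =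
      inv ((toHo D).map (resolutionTensor a b)) ≫ (toHo D).map (cofibrantTensorMap f g) := by
    rw [IsIso.comp_inv_eq, Category.assoc, IsIso.eq_inv_comp, ← (toHo D).map_comp,
      resolutionTensor_naturality, (toHo D).map_comp]
  refine (Category.assoc _ _ _).symm.trans ?_
  refine (congrArg (· ≫ inv ((toHo D).map (resolutionTensor a' b'))) h1).trans ?_
  refine (Category.assoc _ _ _).trans ?_
  refine (congrArg (lTensorBifibrantIso.hom.app (CofibrantObject.bifibrantResolutionObj a,
    CofibrantObject.bifibrantResolutionObj b) ≫ ·) h2).trans ?_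
  exact (Category.assoc _ _ _).symm

end Derived

end RigidOperad
end

noncomputable section
namespace RigidOperad

/-! ### Rigidity and tensor powers -/

section RigidPowers

open scoped Prod

variable {D : Type u} [Category.{v} D] [MonoidalCategory D] [SymmetricCategory D]
  [ModelCategory D] [SimplicialCategory D] [OperadicModelCategory D]

/-- Restriction along a rigid map `η : x ⟶ y` induces isomorphisms on derived mapping spaces
`RMap(w ⊗ -, y)`, if the weak function object provides the adjoints. -/
lemma WeakFunctionObject.IsRigid.isIso_rMap {F : WeakFunctionObject D} {x y : Ho D} {η : x ⟶ y}
    (hη : F.IsRigid η) (w : Ho D) (hy : F.ProvidesAdjoint w y y) (hx : F.ProvidesAdjoint w x y) :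
    IsIso ((RMap D).map (((LTensor D).map (𝟙 w ×ₘ η)).op ×ₘ 𝟙 y)) := by
  have h := F.adj_natural (𝟙 w) η (𝟙 y)
  have h1 : IsIso (F.adj w y y) := hy
  have h2 : IsIso (F.adj w x y) := hx
  have h3 : IsIso (F.functor.map (η.op ×ₘ 𝟙 y)) := hη
  have h4 : IsIso ((𝟙 w : w ⟶ w).op ×ₘ F.functor.map (η.op ×ₘ 𝟙 y)) := by
    rw [isIso_prod_iff]
    exact ⟨inferInstanceAs (IsIso (𝟙 w : w ⟶ w).op), h3⟩
  -- By naturality this composite equals `adj w y y` followed by the map induced by `η^*`, and both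
  -- are invertible.
  have h5 : IsIso ((RMap D).map (((LTensor D).map (𝟙 w ×ₘ η)).op ×ₘ 𝟙 y) ≫ F.adj w x y) := by
    rw [h]; infer_instance
  exact IsIso.of_isIso_comp_right _ (F.adj w x y)

/-- The tensor powers of a cofibrant object, bracketed to the left. -/
def cofibrantPow (y : CofibrantObject D) : ℕ → CofibrantObject D
  | 0 => CofibrantObject.mk (𝟙_ D)
  | n + 1 => cofibrantTensor (cofibrantPow y n) y

/-- The derived tensor powers are represented by the tensor powers of cofibrant objects. -/
def hoPowIso (y : CofibrantObject D) {z : Ho D} (e : (toHo D).obj y ≅ z) :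
    (n : ℕ) → (hoPow z n ≅ (toHo D).obj (cofibrantPow y n))
  | 0 => Iso.refl _
  | n + 1 => (LTensor D).mapIso (Iso.prod (hoPowIso y e n) e.symm) ≪≫ lTensorIso _ _

/-- The tensor powers with the two ways of bracketing. -/
def cofibrantPowIso (y : CofibrantObject D) : (n : ℕ) → ((cofibrantPow y n).obj ≅ pow y.obj n)
  | 0 => Iso.refl _
  | n + 1 => whiskerRightIso (cofibrantPowIso y n) y.obj ≪≫ β_ _ _

/-- Restriction along `g` induces an isomorphism of mapping spaces into `y` in the homotopy
category of spaces. -/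
def MapIso (y : D) {a b : D} (g : a ⟶ b) : Prop :=
  IsIso (toHoSpace.map (((SimplicialCategory.sHomFunctor D).map g.op).app y))

/-- The functor of mapping spaces into `y`, with values in the homotopy category of spaces. -/
def mapInto (y : D) : Dᵒᵖ ⥤ HoSpace.{v} :=
  (SimplicialCategory.sHomFunctor D).flip.obj y ⋙ toHoSpace

lemma mapIso_iff (y : D) {a b : D} (g : a ⟶ b) : MapIso y g ↔ IsIso ((mapInto y).map g.op) :=
  Iff.rfl

lemma MapIso.comp {y a b c : D} {f : a ⟶ b} {g : b ⟶ c} (hf : MapIso y f) (hg : MapIso y g) :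
    MapIso y (f ≫ g) := by
  rw [mapIso_iff] at *
  rw [op_comp, (mapInto y).map_comp]
  infer_instance

lemma MapIso.of_comp_left {y a b c : D} {f : a ⟶ b} {g : b ⟶ c} (hf : MapIso y f)
    (hfg : MapIso y (f ≫ g)) : MapIso y g := by
  rw [mapIso_iff] at *
  rw [op_comp, (mapInto y).map_comp] at hfg
  exact IsIso.of_isIso_comp_right _ ((mapInto y).map f.op)

lemma MapIso.of_isIso (y : D) {a b : D} (f : a ⟶ b) [IsIso f] : MapIso y f := by
  rw [mapIso_iff]
  infer_instance

lemma MapIso.of_weakEquivalence (y : D) [IsFibrant y] {a b : D} [IsCofibrant a] [IsCofibrant b]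
    (f : a ⟶ b) [WeakEquivalence f] : MapIso y f :=
  isIso_map_left y f

lemma MapIso.of_arrow_iso {y a b a' b' : D} {f : a ⟶ b} {f' : a' ⟶ b'} (hf : MapIso y f)
    (u : a ≅ a') (w : b ≅ b') (h : u.hom ≫ f' = f ≫ w.hom) : MapIso y f' :=
  (MapIso.of_isIso y u.hom).of_comp_left (h ▸ hf.comp (MapIso.of_isIso y w.hom))

/-- The map `j^{⊗ (n + 1)}` is `I ◁ j^{⊗ n}`, which is isomorphic to `j^{⊗ n}`, followed by `j ▷
x^{⊗ n}`. Thus the factors `I` are replaced by `x` one at a time. -/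
lemma MapIso.powMap_of_whiskerRight {x y : D} (j : 𝟙_ D ⟶ x)
    (hj : ∀ n, MapIso y (j ▷ pow x n)) : ∀ n, MapIso y (powMap j n)
  | 0 => MapIso.of_isIso y (𝟙 (𝟙_ D))
  | n + 1 => by
      have h : powMap j (n + 1) = (𝟙_ D) ◁ powMap j n ≫ j ▷ pow x n :=
        MonoidalCategory.tensorHom_def' j (powMap j n)
      rw [h]
      refine MapIso.comp ?_ (hj n)
      exact (MapIso.powMap_of_whiskerRight j hj n).of_arrow_iso (λ_ _).symm (λ_ _).symm
        (leftUnitor_inv_naturality _).symm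

/-- Restriction along the tensor powers of a map that represents a rigid map induces isomorphisms
of mapping spaces in the homotopy category of spaces. -/
lemma mapIso_powMap_of_isRigid {F : WeakFunctionObject D} {y : Ho D} {η : hoUnit D ⟶ y}
    (hη : F.IsRigid η) (hy : ∀ n : ℕ, F.ProvidesAdjoint (hoPow y n) y y)
    (hI : ∀ n : ℕ, F.ProvidesAdjoint (hoPow y n) (hoUnit D) y)
    {Y : D} [IsCofibrant Y] [IsFibrant Y] (j : 𝟙_ D ⟶ Y)
    (e : (toHo D).obj (CofibrantObject.mk Y) ≅ y)
    (he : (toHo D).map (CofibrantObject.homMk j) ≫ e.hom = η) (n : ℕ) :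
    MapIso Y (powMap j n) := by
  refine MapIso.powMap_of_whiskerRight j (fun n => ?_) n
  let Z : CofibrantObject D := CofibrantObject.mk Y
  let J : CofibrantObject.mk (𝟙_ D) ⟶ Z := CofibrantObject.homMk j
  let φ := hoPowIso Z e n
  have h1 := hη.isIso_rMap (hoPow y n) (hy n) (hI n)
  -- In `ho(D)` the map `y^{⊗ n} ⊗ η` is isomorphic to the class of the actual map `Y^{⊗ n} ⊗ j`, to
  -- which the point-set comparison applies.
  have h2 : (LTensor D).map (𝟙 (hoPow y n) ×ₘ η) =
      ((LTensor D).mapIso (Iso.prod φ (Iso.refl (hoUnit D))) ≪≫ lTensorIso _ _).hom ≫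
        (toHo D).map (cofibrantTensorMap (𝟙 (cofibrantPow Z n)) J) ≫
          ((lTensorIso (cofibrantPow Z n) Z).symm ≪≫
            (LTensor D).mapIso (Iso.prod φ.symm e)).hom := by
    have h3 := lTensorIso_naturality (𝟙 (cofibrantPow Z n)) J
    have h4 : (LTensor D).map ((toHo D).map (𝟙 (cofibrantPow Z n)) ×ₘ (toHo D).map J) =
        (lTensorIso _ _).hom ≫ (toHo D).map (cofibrantTensorMap (𝟙 (cofibrantPow Z n)) J) ≫
          (lTensorIso _ _).inv := by
      rw [← Category.assoc, Iso.eq_comp_inv]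
      exact h3
    have h5 : (𝟙 (hoPow y n) ×ₘ η) = (φ.hom ×ₘ 𝟙 (hoUnit D)) ≫
        ((toHo D).map (𝟙 (cofibrantPow Z n)) ×ₘ (toHo D).map J) ≫ (φ.inv ×ₘ e.hom) := by
      rw [CategoryTheory.Functor.map_id]
      apply Prod.hom_ext
      · exact ((congrArg (φ.hom ≫ ·) (Category.id_comp φ.inv)).trans φ.hom_inv_id).symm
      · exact ((Category.id_comp _).trans he).symm
    rw [h5, (LTensor D).map_comp, (LTensor D).map_comp, h4]
    simp only [Category.assoc, Iso.trans_hom, Iso.symm_hom]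
    rfl
  have h6 := isIso_prod_map_of_arrow (RMap D) _ _ _ _ h2 e.symm h1
  have h7 : IsFibrant Z.obj := inferInstanceAs (IsFibrant Y)
  have h8 : MapIso Y ((cofibrantTensorMap (𝟙 (cofibrantPow Z n)) J).hom) :=
    isIso_toHoSpace_of_isIso_rMap (y := Z) _ h6
  let ψ : (cofibrantPow Z n).obj ≅ pow Y n := cofibrantPowIso Z n
  have h9 : (cofibrantTensorMap (𝟙 (cofibrantPow Z n)) J).hom = (cofibrantPow Z n).obj ◁ j :=
    MonoidalCategory.id_tensorHom _ _
  rw [h9] at h8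
  -- The derived powers are bracketed to the left and `pow` to the right; after rebracketing, the
  -- braiding moves `j` to the front.
  have h10 : MapIso Y (pow Y n ◁ j) :=
    h8.of_arrow_iso (whiskerRightIso ψ (𝟙_ D)) (whiskerRightIso ψ Y) (MonoidalCategory.whisker_exchange _ _).symm
  exact h10.of_arrow_iso (β_ _ _) (β_ _ _)
    (BraidedCategory.braiding_naturality_right _ _).symm

end RigidPowers

end RigidOperad
end

noncomputable section
namespace RigidOperad

/-! ### Consequences of SM7 and of the pushout product axiom -/

section MappingSpaces

variable {D : Type u} [Category.{v} D] [MonoidalCategory D] [SymmetricCategory D]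
  [ModelCategory D] [SimplicialCategory D] [OperadicModelCategory D]

/-- `Map(x, -)` sends fibrations to Kan fibrations for `x` cofibrant. -/
lemma kanFibration_map_right (x : D) [IsCofibrant x] {y z : D} (p : y ⟶ z) [Fibration p] :
    KanFibration (((SimplicialCategory.sHomFunctor D).obj (op x)).map p) := by
  obtain ⟨hy⟩ := isTerminal_map_initial (initialIsInitial (C := D)) y
  obtain ⟨hz⟩ := isTerminal_map_initial (initialIsInitial (C := D)) z
  have hi : Cofibration (initial.to x) := (isCofibrant_iff x).1 inferInstance
  exact SimplicialModelCategory.sm7_fibration (initial.to x) p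
    { pt := Map x z
      fst := hy.from _
      snd := 𝟙 _
      isPullback := by
        have : IsIso (((SimplicialCategory.sHomFunctor D).obj (op (⊥_ D))).map p) :=
          isIso_of_isTerminal hy hz _
        exact @IsPullback.of_vert_isIso _ _ _ _ _ _ _ _ _ _ (IsIso.id (Map x z)) this
          ⟨hz.hom_ext _ _⟩
      π := ((SimplicialCategory.sHomFunctor D).obj (op x)).map p
      π_fst := hy.hom_ext _ _ }

/-- `Map(-, y)` sends cofibrations to Kan fibrations for `y` fibrant. -/
lemma kanFibration_map_left (y : D) [IsFibrant y] {x z : D} (i : x ⟶ z) [Cofibration i] :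
    KanFibration (((SimplicialCategory.sHomFunctor D).map i.op).app y) := by
  obtain ⟨hx⟩ := isTerminal_map_terminal (terminalIsTerminal (C := D)) x
  obtain ⟨hz⟩ := isTerminal_map_terminal (terminalIsTerminal (C := D)) z
  have hp : Fibration (terminal.from y) := (isFibrant_iff y).1 inferInstance
  exact SimplicialModelCategory.sm7_fibration i (terminal.from y)
    { pt := Map x y
      fst := 𝟙 _
      snd := hz.from _
      isPullback := by
        have : IsIso (((SimplicialCategory.sHomFunctor D).map i.op).app (⊤_ D)) :=
          isIso_of_isTerminal hz hx _
        exact @IsPullback.of_horiz_isIso _ _ _ _ _ _ _ _ _ _ (IsIso.id (Map x y)) this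
          ⟨hx.hom_ext _ _⟩
      π := ((SimplicialCategory.sHomFunctor D).map i.op).app y
      π_snd := hz.hom_ext _ _ }

/-- The mapping spaces from cofibrant to fibrant objects are Kan complexes. -/
lemma kanComplex_map (x y : D) [IsCofibrant x] [IsFibrant y] : SSet.KanComplex (Map x y) := by
  obtain ⟨hx⟩ := isTerminal_map_terminal (terminalIsTerminal (C := D)) x
  have hp : Fibration (terminal.from y) := (isFibrant_iff y).1 inferInstance
  have h1 := kanFibration_map_right x (terminal.from y)
  have h2 : KanFibration (toUnit (Map x (⊤_ D))) := by
    have : IsIso (toUnit (Map x (⊤_ D))) :=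
      isIso_of_isTerminal hx CartesianMonoidalCategory.isTerminalTensorUnit _
    exact MorphismProperty.of_isIso SSet.modelCategoryQuillen.J.rlp (toUnit (Map x (⊤_ D)))
  have h3 : toUnit (Map x y) =
      ((SimplicialCategory.sHomFunctor D).obj (op x)).map (terminal.from y) ≫
        toUnit (Map x (⊤_ D)) := toUnit_unique _ _
  refine kanComplex_of_kanFibration_toUnit ?_
  rw [h3]
  exact h1.comp h2

/-- This is the pushout product with `∅ ⟶ x`: since `∅ ⊗ y` and `∅ ⊗ z` are initial, its source is
`x ⊗ y`. -/
lemma cofibration_whiskerLeft (x : D) [IsCofibrant x] {y z : D} (i : y ⟶ z) [Cofibration i] :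
    Cofibration (x ◁ i) := by
  obtain ⟨hy⟩ := TensorModelCategory.initial_tensor y (⊥_ D) initialIsInitial
  obtain ⟨hz⟩ := TensorModelCategory.initial_tensor z (⊥_ D) initialIsInitial
  have hx' : Cofibration (initial.to x) := (isCofibrant_iff x).1 inferInstance
  exact TensorModelCategory.pushout_product (initial.to x) i
    { pt := x ⊗ y
      inl := 𝟙 _
      inr := hz.to _
      isPushout := by
        have : IsIso (((curriedTensor D).obj (⊥_ D)).map i) :=
          isIso_of_isInitial hy hz _
        exact IsPushout.of_vert_isIso ⟨hy.hom_ext _ _⟩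
      ι := x ◁ i
      inl_ι := Category.id_comp _
      inr_ι := hz.hom_ext _ _ }

lemma cofibration_whiskerRight (x : D) [IsCofibrant x] {y z : D} (i : y ⟶ z) [Cofibration i] :
    Cofibration (i ▷ x) := by
  have := cofibration_whiskerLeft x i
  have h : i ▷ x = (β_ y x).hom ≫ x ◁ i ≫ (β_ x z).hom := by simp
  rw [h]
  infer_instance

instance isCofibrant_pow (x : D) [IsCofibrant x] : ∀ k, IsCofibrant (pow x k)
  | 0 => inferInstanceAs (IsCofibrant (𝟙_ D))
  | k + 1 => @isCofibrant_tensor D _ _ _ _ _ _ x (pow x k) _ (isCofibrant_pow x k)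

lemma cofibration_powMap {x y : D} [IsCofibrant x] [IsCofibrant y] (i : x ⟶ y) [Cofibration i] :
    ∀ k, Cofibration (powMap i k)
  | 0 => inferInstanceAs (Cofibration (𝟙 (𝟙_ D)))
  | k + 1 => by
      have h1 := cofibration_powMap i k
      have h2 := cofibration_whiskerRight (pow x k) i
      have h3 := cofibration_whiskerLeft y (powMap i k)
      have h : powMap i (k + 1) = i ▷ pow x k ≫ y ◁ powMap i k :=
        MonoidalCategory.tensorHom_def _ _
      rw [h]
      exact inferInstanceAs (Cofibration (i ▷ pow x k ≫ y ◁ powMap i k))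

lemma weakEquivalence_powMap {x y : D} [IsCofibrant x] [IsCofibrant y] (f : x ⟶ y)
    [WeakEquivalence f] : ∀ k, WeakEquivalence (powMap f k)
  | 0 => inferInstanceAs (WeakEquivalence (𝟙 (𝟙_ D)))
  | k + 1 => by
      have h1 := weakEquivalence_powMap f k
      exact weakEquivalence_tensorHom f (powMap f k)

lemma powMap_comp {x y z : D} (f : x ⟶ y) (g : y ⟶ z) :
    ∀ k, powMap (f ≫ g) k = powMap f k ≫ powMap g k
  | 0 => (Category.id_comp _).symm
  | k + 1 => (congrArg (fun h => (f ≫ g) ⊗ₘ h) (powMap_comp f g k)).trans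
      (MonoidalCategory.tensorHom_comp_tensorHom f (powMap f k) g (powMap g k)).symm

end MappingSpaces

end RigidOperad
end
open RigidOperad
theorem corollary3p4 {D : Type u} [Category.{v} D] [MonoidalCategory D] [SymmetricCategory D]
    [ModelCategory D] [SimplicialCategory D] [OperadicModelCategory D]
    (F : WeakFunctionObject D) (y : Ho D) (η : hoUnit D ⟶ y) (hη : F.IsRigid η)
    (hy : ∀ n : ℕ, F.ProvidesAdjoint (hoPow y n) y y)
    (hI : ∀ n : ℕ, F.ProvidesAdjoint (hoPow y n) (hoUnit D) y)
    (E : SimplicialOperad.{v}) (hE : E.IsCofibrant) (hE' : E.IsEInfinity) :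
    -- the space of extensions for a cofibration `j : I ⟶ Y` that represents `η`, `Y` fibrant
    (∀ (Y : D) [IsCofibrant Y] [IsFibrant Y] (j : 𝟙_ D ⟶ Y) [Cofibration j]
      (e : (toHo D).obj (CofibrantObject.mk Y) ≅ y),
      (toHo D).map (CofibrantObject.homMk j) ≫ e.hom = η →
        Contractible (unitExtensionSpace E j)) ∧
    -- the space of extensions for a fibration `p : X ⟶ Y` that represents `η`, where `X` is a
    -- fibrant replacement of `I` with an `E_∞`-structure that extends the multiplication of `I`
    (∀ (X Y : D) [IsCofibrant X] [IsFibrant X] [IsCofibrant Y] [IsFibrant Y]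
      (f : 𝟙_ D ⟶ X) [Cofibration f] [WeakEquivalence f] (p : X ⟶ Y) [Fibration p]
      (e : (toHo D).obj (CofibrantObject.mk Y) ≅ y),
      (toHo D).map (CofibrantObject.homMk (f ≫ p)) ≫ e.hom = η →
        ∀ θ : (unitExtensionSpace E f).obj (op (SimplexCategory.mk 0)),
          Contractible (homotopyFiber (arrowAlgebraSpaceSource E p)
            ((unitExtensionSpaceToAlgebraSpace E f).app _ θ))) := by
  refine ⟨fun Y _ _ j _ e he => ?_, fun X Y _ _ _ _ f _ _ p _ e he θ => ?_⟩
  · refine contractible_unitExtensionSpace hE j fun k => ?_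
    -- Rigidity makes restriction along `j^{⊗ k}` a weak equivalence and SM7 makes it a Kan
    -- fibration; between Kan complexes this is a trivial fibration.
    have h1 := mapIso_powMap_of_isRigid hη hy hI j e he k
    have := cofibration_powMap j k
    have : SSet.KanComplex (((SimplicialCategory.sHomFunctor D).obj (op (pow (𝟙_ D) k))).obj Y) :=
      kanComplex_map (pow (𝟙_ D) k) Y
    exact (kanFibration_map_left Y (powMap j k)).trivialFibration
      ((weakHomotopyEquivalences_iff_isIso _).2 h1)
  · refine contractible_homotopyFiber hE p (fun k => kanComplex_map _ _)
      (fun k => kanComplex_map _ _) (fun k => ?_) (fun k => kanFibration_map_right _ p) _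
    -- Rigidity concerns the composite `f ≫ p`. The powers of the weak equivalence `f` can be
    -- cancelled, which leaves restriction along `p^{⊗ k}`.
    have h1 := mapIso_powMap_of_isRigid hη hy hI (f ≫ p) e he k
    have := weakEquivalence_powMap f k
    rw [powMap_comp] at h1
    exact (weakHomotopyEquivalences_iff_isIso _).2
      ((MapIso.of_weakEquivalence Y (powMap f k)).of_comp_left h1)
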